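/- Let $M$ be a smooth manifold (finite-dimensional, Hausdorff, second countable, without boundary), let $E\to M$ be a smooth real vector bundle of finite rank, let $k\ge 2$, and let $\omega\in\Omega^k(E)$ be a smooth $k$-form on the total space which is linear, i.e. $h_\lambda^*\omega=\lambda\omega$ for all $\lambda\in\mathbb R$, where $h_\lambda$ is fiberwise multiplication by $\lambda$. **Simple quotients.** A simple quotient of a manifold $M$ is a smooth surjective submersion $q_M:M\to\tilde M$ with connected fibers onto a manifold; the fibers are the leaves of a foliation with tangent distribution $\mathrm{Ker}(Tq_M)$, and the foliations so obtained are called simple. A simple quotient of $E\to M$ is a smooth vector bundle morphism $(q,q_M):(E\to M)\to(\tilde E\to\tilde M)$ such that $q_M$ is a simple quotient of $M$ and $q$ is fiberwise surjective. **Kernel-reducibility.** Put $\mathrm{Ker}(\omega|_e)=\{V\in T_eE:\ i_V\omega|_e=0\}$. The form $\omega$ is kernel-reducible if $\mathrm{Ker}(\omega)\subseteq TE$ has constant rank, $\mathrm{Ker}(\omega)\subseteq\mathrm{Ker}(d\omega)$, and the quotient map $q=q_{\mathrm{Ker}(\omega)}$ onto the leaf space of the foliation of $E$ integrating $\mathrm{Ker}(\omega)$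 is a simple quotient of the vector bundle $E\to M$; that is, there is a simple quotient $(q,q_M)$ of $E\to M$ with $\mathrm{Ker}(Tq)=\mathrm{Ker}(\omega)$. **Components.** The components $\mu:E\to\Lambda^{k-1}T^*M$ and $\eta:E\to\Lambda^kT^*M$ of $\omega$ are defined, for $e\in E_x$ and $v_i\in T_xM$, by $$\mu(e)(v_1,\dots,v_{k-1})=\omega|_{0_x}\Big(\tfrac{d}{dt}\big|_{0}(te),T0(v_1),\dots,T0(v_{k-1})\Big),$$ $$\eta(e)(v_1,\dots,v_k)=(d\omega)|_{0_x}\Big(\tfrac{d}{dt}\big|_{0}(te),T0(v_1),\dots,T0(v_k)\Big),$$ where $0:M\to E$ is the zero section. Put $\mu^\sharp(v)(e)=i_v\mu(e)$ and $\eta^\sharp(v)(e)=i_v\eta(e)$ for $v\in T_xM$, $e\in E_x$. The form $\omega$ is infinitesimally kernel-reducible if 1. $\mu$ has constant rank; 2. $\mu^\sharp:TM\to E^*\otimes\Lambda^{k-2}T^*M$ has constant rank; 3. $i_v(d\mu(e)+\eta(e))\in\Gamma(\mathrm{Im}\,\mu)$ for all $v\in\Gamma(\mathrm{Ker}\,\mu^\sharp)$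 and $e\in\Gamma(E)$; 4. $\mathrm{Ker}(\mu)\subseteq\mathrm{Ker}(\eta)$ and $\mathrm{Ker}(\mu^\sharp)\subseteq\mathrm{Ker}(\eta^\sharp)$; 5. $\mathrm{Ker}(\mu^\sharp)\subseteq TM$ is involutive; 6. the partial connection $\bar\nabla:\Gamma(\mathrm{Ker}\,\mu^\sharp)\times\Gamma(E/\mathrm{Ker}\,\mu)\to\Gamma(E/\mathrm{Ker}\,\mu)$ determined by $\mu(\bar\nabla_v\bar e)=i_v\,d\mu(e)$, where $\bar e=e$ mod $\mathrm{Ker}\,\mu$, is flat; 7. for $v\in\Gamma(\mathrm{Ker}\,\mu^\sharp)$ and $e\in\Gamma(E)$, if $\bar\nabla_v\bar e=0$ then $i_v\,d\eta(e)=0$. **Statement.** The form $\omega$ is kernel-reducible if and only if * $\omega$ is infinitesimally kernel-reducible; * the foliation $\mathcal F_M$ of $M$ integrating $\mathrm{Ker}(\mu^\sharp)$ is simple, i.e. there is a simple quotient $q_M:M\to\tilde M$ with $\mathrm{Ker}(Tq_M)=\mathrm{Ker}(\mu^\sharp)$; and * $\bar\nabla$ integrates to a representation of the submersion groupoid $M\times_{\mathcal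 F_M}M=\{(x,y):q_M(x)=q_M(y)\}$ on $E/\mathrm{Ker}(\mu)$, i.e. there are linear isomorphisms $\Delta_{x,y}:E_y/\mathrm{Ker}(\mu_y)\to E_x/\mathrm{Ker}(\mu_x)$, for $q_M(x)=q_M(y)$, depending smoothly on $(x,y)$, with $\Delta_{x,x}=\mathrm{id}$ and $\Delta_{x,y}\Delta_{y,z}=\Delta_{x,z}$, such that $$\bar\nabla_v\bar e\,|_x=\tfrac{d}{d\epsilon}\big|_{\epsilon=0}\Delta_{x,y(\epsilon)}\,\bar e(y(\epsilon))$$ for every smooth curve $y(\epsilon)$ in a fiber of $q_M$ with $y(0)=x$, $y'(0)=v$, and every $\bar e\in\Gamma(E/\mathrm{Ker}\,\mu)$. In that case $\omega$ is $q_{\mathrm{Ker}(\omega)}$-basic, i.e. $\omega=q^*\tilde\omega$ for some smooth $k$-form $\tilde\omega$ on $\tilde E$, where $q=q_{\mathrm{Ker}(\omega)}:E\to\tilde E$, and the (unique) quotient form $\tilde\omega=q_*\omega$ has trivial kernel at every point of $\tilde E$. -/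

import Mathlib

open Bundle Set Filter Topology Function
open scoped Manifold ContDiff

universe u v w

noncomputable section

/-! ## Differential forms on manifolds without boundary -/

section Forms

variable {V : Type*} [NormedAddCommGroup V] [NormedSpace ℝ V]
  {H : Type*} [TopologicalSpace H] (I : ModelWithCorners ℝ V H)
  (X : Type*) [TopologicalSpace X] [ChartedSpace H X]

/-- A (not necessarily smooth) field of alternating `k`-linear forms on the tangent spaces
of `X`. -/
abbrev FormField (k : ℕ) : Type _ := ∀ x : X, TangentSpace I x [⋀^Fin k]→L[ℝ] ℝ

variable {I X} {k : ℕ}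

/-- The expression of a form in the preferred chart at `x₀`: the pullback of `om` along the inverse
of the chart. It is meaningful on the (open) target of the chart. -/
def chartRep (om : FormField I X k) (x₀ : X) (y : V) : V [⋀^Fin k]→L[ℝ] ℝ :=
  (om ((extChartAt I x₀).symm y)).compContinuousLinearMap
    ((mfderiv 𝓘(ℝ, V) I (extChartAt I x₀).symm y).comp
      (NormedSpace.fromTangentSpace (𝕜 := ℝ) y).symm.toContinuousLinearMap)

/-- A `k`-form is smooth when its expressions in charts are smooth. -/
def IsSmoothForm (om : FormField I X k) : Prop :=
  ∀ x₀ : X, ContDiffOn ℝ ∞ (chartRep om x₀) (extChartAt I x₀).target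

/-- The exterior derivative `d om`, computed at `x` in the preferred chart at `x`. -/
def extD (om : FormField I X k) : FormField I X (k + 1) := fun x =>
  (extDeriv (chartRep om x) (extChartAt I x x)).compContinuousLinearMap
    ((NormedSpace.fromTangentSpace (𝕜 := ℝ) (extChartAt I x x)).toContinuousLinearMap.comp
      (mfderiv I 𝓘(ℝ, V) (extChartAt I x) x))

/-- The pullback of a form along a map. -/
def pullbackForm {V' : Type*} [NormedAddCommGroup V'] [NormedSpace ℝ V']
    {H' : Type*} [TopologicalSpace H'] {I' : ModelWithCorners ℝ V' H'}
    {X' : Type*} [TopologicalSpace X'] [ChartedSpace H' X']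
    (f : X → X') (om : FormField I' X' k) : FormField I X k := fun x =>
  (om (f x)).compContinuousLinearMap (mfderiv I I' f x)

/-- The interior product `(α, v) ↦ i_v α = α(v, ·, …, ·)`, as a bilinear map. -/
def iprod {T : Type*} [AddCommGroup T] [Module ℝ T] [TopologicalSpace T] {k : ℕ} :
    (T [⋀^Fin (k + 1)]→L[ℝ] ℝ) →ₗ[ℝ] T →ₗ[ℝ] (T [⋀^Fin k]→L[ℝ] ℝ) :=
  LinearMap.mk₂ ℝ
    (fun α v =>
      { α.toAlternatingMap.curryLeft v with
        cont := α.cont.comp (continuous_const.matrixVecCons continuous_id) })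
    (fun α β v => by ext; rfl)
    (fun c α v => by ext; rfl)
    (fun α v w => by
      ext z
      exact congrArg (fun a => a z) (map_add α.toAlternatingMap.curryLeft v w))
    (fun c α v => by
      ext z
      exact congrArg (fun a => a z) (map_smul α.toAlternatingMap.curryLeft c v))

@[simp] theorem iprod_apply {T : Type*} [AddCommGroup T] [Module ℝ T] [TopologicalSpace T] {k : ℕ}
    (α : T [⋀^Fin (k + 1)]→L[ℝ] ℝ) (v : T) (z : Fin k → T) :
    iprod α v z = α (Matrix.vecCons v z) := rfl

/-- `Ker(om|_x) = {V ∈ T_x X : i_V om|_x = 0}`. -/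
def kerForm (om : FormField I X (k + 1)) (x : X) : Submodule ℝ (TangentSpace I x) :=
  LinearMap.ker (iprod (om x))

variable [IsManifold I ∞ X]

variable (I) in
/-- A smooth vector field. -/
def IsSmoothVF (v : ∀ x : X, TangentSpace I x) : Prop :=
  ContMDiff I I.tangent ∞ (fun x => (⟨x, v x⟩ : TangentBundle I X))

variable (I) in
/-- A smooth section of the distribution `D`. -/
def IsSmoothVFIn (D : ∀ x : X, Submodule ℝ (TangentSpace I x)) (v : ∀ x : X, TangentSpace I x) :
    Prop :=
  IsSmoothVF I v ∧ ∀ x, v x ∈ D x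

variable (I) in
/-- The distribution `D` is involutive. -/
def IsInvolutive (D : ∀ x : X, Submodule ℝ (TangentSpace I x)) : Prop :=
  ∀ v w : ∀ x : X, TangentSpace I x, IsSmoothVFIn I D v → IsSmoothVFIn I D w →
    ∀ x, VectorField.mlieBracket I v w x ∈ D x

end Forms

/-! ## Simple quotients -/

/-- A simple quotient of an `n`-dimensional manifold `M`: a smooth surjective submersion with
connected fibers onto a (Hausdorff, second countable) manifold. The leaves of the corresponding
simple foliation are the fibers, and its tangent distribution is the kernel of the derivative. -/
structure SimpleQuotient (n : ℕ) (M : Type u) [TopologicalSpace M]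
    [ChartedSpace (EuclideanSpace ℝ (Fin n)) M] where
  dim : ℕ
  base : Type u
  [topBase : TopologicalSpace base]
  [chartedBase : ChartedSpace (EuclideanSpace ℝ (Fin dim)) base]
  [manifoldBase : IsManifold (𝓡 dim) ∞ base]
  [t2Base : T2Space base]
  [secondCountableBase : SecondCountableTopology base]
  map : M → base
  smooth : ContMDiff (𝓡 n) (𝓡 dim) ∞ map
  surjective : Surjective map
  submersion : ∀ x, Surjective (mfderiv (𝓡 n) (𝓡 dim) map x)
  connected : ∀ b, IsConnected (map ⁻¹' {b})

attribute [instance] SimpleQuotient.topBase SimpleQuotient.chartedBase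
  SimpleQuotient.manifoldBase SimpleQuotient.t2Base SimpleQuotient.secondCountableBase

/-- `Q` is the leaf space quotient of the foliation integrating the distribution `D`, that is,
the tangent distribution `Ker(T q_M)` of the simple foliation given by the fibers of `Q` is `D`. -/
def SimpleQuotient.Integrates {n : ℕ} {M : Type u} [TopologicalSpace M]
    [ChartedSpace (EuclideanSpace ℝ (Fin n)) M] (Q : SimpleQuotient n M)
    (D : ∀ x : M, Submodule ℝ (TangentSpace (𝓡 n) x)) : Prop :=
  ∀ x, LinearMap.ker (mfderiv (𝓡 n) (𝓡 Q.dim) Q.map x).toLinearMap = D x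

section Bundles

variable {n : ℕ} {M : Type u} [TopologicalSpace M] [ChartedSpace (EuclideanSpace ℝ (Fin n)) M]
  (F : Type w) [NormedAddCommGroup F] [NormedSpace ℝ F]
  (E : M → Type v) [∀ x, AddCommGroup (E x)] [∀ x, Module ℝ (E x)]
  [∀ x, TopologicalSpace (E x)] [TopologicalSpace (TotalSpace F E)]
  [FiberBundle F E] [VectorBundle ℝ F E]

/-- A simple quotient of the vector bundle `E → M`: a smooth vector bundle morphism, surjective on
fibers, from `E` to a smooth vector bundle, covering a simple quotient of `M`. -/
structure BundleSimpleQuotient where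
  qM : SimpleQuotient n M
  rk : ℕ
  fib : qM.base → Type v
  [addFib : ∀ b, AddCommGroup (fib b)]
  [moduleFib : ∀ b, Module ℝ (fib b)]
  [topFib : ∀ b, TopologicalSpace (fib b)]
  [topTotal : TopologicalSpace (TotalSpace (EuclideanSpace ℝ (Fin rk)) fib)]
  [fiberBundle : FiberBundle (EuclideanSpace ℝ (Fin rk)) fib]
  [vectorBundle : VectorBundle ℝ (EuclideanSpace ℝ (Fin rk)) fib]
  [smoothBundle : ContMDiffVectorBundle ∞ (EuclideanSpace ℝ (Fin rk)) fib (𝓡 qM.dim)]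
  fibMap : ∀ x : M, E x →ₗ[ℝ] fib (qM.map x)
  fib_surjective : ∀ x, Surjective (fibMap x)
  smooth : ContMDiff ((𝓡 n).prod 𝓘(ℝ, F)) ((𝓡 qM.dim).prod 𝓘(ℝ, EuclideanSpace ℝ (Fin rk))) ∞
    (fun e : TotalSpace F E =>
      (⟨qM.map e.proj, fibMap e.proj e.2⟩ : TotalSpace (EuclideanSpace ℝ (Fin rk)) fib))

attribute [instance] BundleSimpleQuotient.addFib BundleSimpleQuotient.moduleFib
  BundleSimpleQuotient.topFib BundleSimpleQuotient.topTotal BundleSimpleQuotient.fiberBundle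
  BundleSimpleQuotient.vectorBundle BundleSimpleQuotient.smoothBundle

variable {F E}

/-- The total space of the quotient bundle. -/
abbrev BundleSimpleQuotient.Total (Q : BundleSimpleQuotient (n := n) F E) : Type _ :=
  TotalSpace (EuclideanSpace ℝ (Fin Q.rk)) Q.fib

/-- The model with corners (without boundary) of the total space of the quotient bundle. -/
abbrev BundleSimpleQuotient.model (Q : BundleSimpleQuotient (n := n) F E) :=
  (𝓡 Q.qM.dim).prod 𝓘(ℝ, EuclideanSpace ℝ (Fin Q.rk))

/-- The quotient map on total spaces. -/
def BundleSimpleQuotient.map (Q : BundleSimpleQuotient (n := n) F E) (e : TotalSpace F E) :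
    Q.Total :=
  ⟨Q.qM.map e.proj, Q.fibMap e.proj e.2⟩

/-- The tangent distribution `Ker(T q)` of the foliation of the total space by the fibers of `q`
is `D`: `q` is the quotient map onto the leaf space of the foliation integrating `D`. -/
def BundleSimpleQuotient.Integrates (Q : BundleSimpleQuotient (n := n) F E)
    (D : ∀ e : TotalSpace F E, Submodule ℝ (TangentSpace ((𝓡 n).prod 𝓘(ℝ, F)) e)) : Prop :=
  ∀ e, LinearMap.ker (mfderiv ((𝓡 n).prod 𝓘(ℝ, F)) Q.model Q.map e).toLinearMap = D e

/-! ## Linear forms and their components -/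

/-- A `k`-form on the total space is linear if `h_λ^* om = λ om` for all real `λ`, where `h_λ` is
fiberwise multiplication by `λ`. -/
def IsLinearForm {k : ℕ} (om : FormField ((𝓡 n).prod 𝓘(ℝ, F)) (TotalSpace F E) k) : Prop :=
  ∀ (c : ℝ) (e : TotalSpace F E),
    pullbackForm (I := (𝓡 n).prod 𝓘(ℝ, F)) (fun e : TotalSpace F E =>
      (⟨e.proj, c • e.2⟩ : TotalSpace F E)) om e = c • om e

variable (F) in
/-- The vertical vector `d/dt|_{t=0} (t e)` at `0_x` for `e ∈ E_x` (see `vertLift_eq`), as a linear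
function of `e`: the derivative at the origin of the inclusion of the fiber, where `E_x` is
identified with `F` by a trivialization. -/
def vertLift (x : M) :
    E x →ₗ[ℝ] TangentSpace ((𝓡 n).prod 𝓘(ℝ, F)) (zeroSection F E x) :=
  (((mfderiv 𝓘(ℝ, F) ((𝓡 n).prod 𝓘(ℝ, F))
      (fun f : F => (⟨x, (trivializationAt F E x).symm x f⟩ : TotalSpace F E)) 0).comp
      (NormedSpace.fromTangentSpace (𝕜 := ℝ) (0 : F)).symm.toContinuousLinearMap).comp
    ((trivializationAt F E x).continuousLinearMapAt ℝ x)).toLinearMap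

/-- `vertLift F x e` is the velocity at `t = 0` of the curve `t ↦ t e` (both sides are vectors at
`0_x = 0 • e`, written in the model space of the tangent spaces). -/
theorem vertLift_eq [ContMDiffVectorBundle ∞ F E (𝓡 n)] (x : M) (e : E x) :
    (vertLift (n := n) F x e : EuclideanSpace ℝ (Fin n) × F) =
      mfderiv 𝓘(ℝ, ℝ) ((𝓡 n).prod 𝓘(ℝ, F)) (fun t : ℝ => (⟨x, t • e⟩ : TotalSpace F E)) 0
        ((NormedSpace.fromTangentSpace (𝕜 := ℝ) (0 : ℝ)).symm 1) := by
  have hx := FiberBundle.mem_baseSet_trivializationAt F E x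
  set φ := (trivializationAt F E x).continuousLinearMapAt ℝ x with hφ
  set j : F → TotalSpace F E := fun f => ⟨x, (trivializationAt F E x).symm x f⟩ with hj
  have hcurve : (fun t : ℝ => (⟨x, t • e⟩ : TotalSpace F E)) = j ∘ fun t : ℝ => t • φ e := by
    funext t
    simp only [hj, comp_apply, ← map_smul, hφ]
    congr 1
    have h := (trivializationAt F E x).symmL_continuousLinearMapAt (R := ℝ) hx (t • e)
    rw [(trivializationAt F E x).symmL_apply hx] at h
    exact h.symm
  have hjd : MDifferentiableAt 𝓘(ℝ, F) ((𝓡 n).prod 𝓘(ℝ, F)) j ((fun t : ℝ => t • φ e) 0) := by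
    have : ContMDiff 𝓘(ℝ, F) ((𝓡 n).prod 𝓘(ℝ, F)) ∞ j := by
      intro f
      rw [contMDiffAt_totalSpace]
      refine ⟨contMDiffAt_const, ?_⟩
      refine contMDiffAt_id.congr_of_eventuallyEq (Eventually.of_forall fun f' => ?_)
      have := (trivializationAt F E x).apply_mk_symm hx f'
      exact congrArg Prod.snd this
    exact (this _).mdifferentiableAt (by simp)
  have hl : HasFDerivAt (fun t : ℝ => t • φ e) (ContinuousLinearMap.toSpanSingleton ℝ (φ e)) 0 :=
    (ContinuousLinearMap.toSpanSingleton ℝ (φ e)).hasFDerivAt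
  have hc := HasMFDerivAt.comp (0 : ℝ) hjd.hasMFDerivAt hl.hasMFDerivAt
  rw [hcurve, hc.mfderiv]
  change (mfderiv 𝓘(ℝ, F) ((𝓡 n).prod 𝓘(ℝ, F)) j 0) (φ e) =
    (mfderiv 𝓘(ℝ, F) ((𝓡 n).prod 𝓘(ℝ, F)) j ((0 : ℝ) • φ e)) ((1 : ℝ) • φ e)
  rw [zero_smul]
  exact congrArg (mfderiv 𝓘(ℝ, F) ((𝓡 n).prod 𝓘(ℝ, F)) j 0) (one_smul ℝ (φ e)).symm

section Components

variable {m : ℕ} (om : FormField ((𝓡 n).prod 𝓘(ℝ, F)) (TotalSpace F E) (m + 2))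

variable (F E) in
/-- `T0 : T_x M → T_{0_x} E`, the derivative of the zero section. -/
def zeroLift (x : M) :
    TangentSpace (𝓡 n) x →L[ℝ] TangentSpace ((𝓡 n).prod 𝓘(ℝ, F)) (zeroSection F E x) :=
  mfderiv (𝓡 n) ((𝓡 n).prod 𝓘(ℝ, F)) (zeroSection F E) x

/-- For a `(k+1)`-form `β` on the total space, the map `E_x → Λ^k T_x^* M`,
`e ↦ β|_{0_x}(d/dt|_{t=0} (t e), T0(·), …, T0(·))`. -/
def zeroComponent {k : ℕ} (β : FormField ((𝓡 n).prod 𝓘(ℝ, F)) (TotalSpace F E) (k + 1)) (x : M) :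
    E x →ₗ[ℝ] (TangentSpace (𝓡 n) x [⋀^Fin k]→L[ℝ] ℝ) :=
  (ContinuousAlternatingMap.compContinuousLinearMapₗ (zeroLift F E x)).comp
    ((iprod (β (zeroSection F E x))).comp (vertLift F x))

/-- The component `μ : E → Λ^{k-1} T^*M` of a linear `k`-form, `k = m + 2`. -/
def muC (x : M) : E x →ₗ[ℝ] (TangentSpace (𝓡 n) x [⋀^Fin (m + 1)]→L[ℝ] ℝ) :=
  zeroComponent om x

/-- The component `η : E → Λ^k T^*M` of a linear `k`-form, `k = m + 2`. -/
def etaC (x : M) : E x →ₗ[ℝ] (TangentSpace (𝓡 n) x [⋀^Fin (m + 2)]→L[ℝ] ℝ) :=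
  zeroComponent (extD om) x

/-- The map `v ↦ (e ↦ i_v (φ e))` associated with `φ : E_x → Λ^{k+1} T_x^* M`. -/
def sharp {k : ℕ} {x : M} (φ : E x →ₗ[ℝ] (TangentSpace (𝓡 n) x [⋀^Fin (k + 1)]→L[ℝ] ℝ)) :
    TangentSpace (𝓡 n) x →ₗ[ℝ] E x →ₗ[ℝ] (TangentSpace (𝓡 n) x [⋀^Fin k]→L[ℝ] ℝ) :=
  (iprod.comp φ).flip

/-- `Ker(μ_x) ⊆ E_x`. -/
def kerMu (x : M) : Submodule ℝ (E x) := LinearMap.ker (muC om x)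

/-- `Ker(μ^♯_x) ⊆ T_x M`. -/
def kerMuSharp (x : M) : Submodule ℝ (TangentSpace (𝓡 n) x) := LinearMap.ker (sharp (muC om x))

/-- The form `μ(e)` on `M`, for a section `e` of `E`. -/
def muForm (e : ∀ x : M, E x) : FormField (𝓡 n) M (m + 1) := fun x => muC om x (e x)

/-- The form `η(e)` on `M`, for a section `e` of `E`. -/
def etaForm (e : ∀ x : M, E x) : FormField (𝓡 n) M (m + 2) := fun x => etaC om x (e x)

variable (n F) in
/-- A smooth section of `E`. -/
def IsSmoothSec (e : ∀ x : M, E x) : Prop :=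
  ContMDiff (𝓡 n) ((𝓡 n).prod 𝓘(ℝ, F)) ∞ (fun x => (⟨x, e x⟩ : TotalSpace F E))

variable (n F) in
/-- A smooth section of the quotient bundle `E/K`: the class of a smooth section of `E`. -/
def IsSmoothQuotSec (K : ∀ x : M, Submodule ℝ (E x)) (s : ∀ x : M, E x ⧸ K x) : Prop :=
  ∃ e : ∀ x : M, E x, IsSmoothSec n F e ∧ ∀ x, s x = (K x).mkQ (e x)

/-- The injective map `E_x/Ker(μ_x) → Λ^{k-1} T_x^* M` induced by `μ`. -/
def muBar (x : M) :
    (E x ⧸ kerMu om x) →ₗ[ℝ] (TangentSpace (𝓡 n) x [⋀^Fin (m + 1)]→L[ℝ] ℝ) :=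
  (kerMu om x).liftQ (muC om x) le_rfl

/-- The form `μ(s)` on `M`, for a section `s` of `E/Ker(μ)`. -/
def muBarForm (s : ∀ x : M, E x ⧸ kerMu om x) : FormField (𝓡 n) M (m + 1) :=
  fun x => muBar om x (s x)

/-- The partial connection on `E/Ker(μ)` along `Ker(μ^♯)`: the unique element `∇_v s` of
`E_x/Ker(μ_x)` with `μ(∇_v s) = i_v d(μ(s))`, whenever there is one. -/
def nablaBar {x : M} (v : TangentSpace (𝓡 n) x) (s : ∀ x : M, E x ⧸ kerMu om x) :
    E x ⧸ kerMu om x :=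
  invFun (muBar om x) (iprod (extD (muBarForm om s) x) v)

/-! ## Kernel-reducibility -/

/-- `Ker(om)` has constant rank and is contained in `Ker(d om)` (hence is an integrable
distribution), and the quotient map onto the leaf space of the foliation integrating it is a
simple quotient of the vector bundle `E → M`. -/
def IsKernelReducible : Prop :=
  (∃ r : ℕ, ∀ e : TotalSpace F E, Module.finrank ℝ (kerForm om e) = r) ∧
  (∀ e : TotalSpace F E, kerForm om e ≤ kerForm (extD om) e) ∧
  ∃ Q : BundleSimpleQuotient (n := n) F E, Q.Integrates (kerForm om)

variable [IsManifold (𝓡 n) ∞ M]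

/-- The form is infinitesimally kernel-reducible. -/
structure IsInfKernelReducible : Prop where
  mu_constRank : ∃ r : ℕ, ∀ x : M, Module.finrank ℝ (LinearMap.range (muC om x)) = r
  muSharp_constRank : ∃ r : ℕ, ∀ x : M, Module.finrank ℝ (LinearMap.range (sharp (muC om x))) = r
  /-- `i_v (dμ(e) + η(e)) ∈ Γ(Im μ)` for `v ∈ Γ(Ker μ^♯)` and `e ∈ Γ(E)`. -/
  contraction_mem : ∀ (v : ∀ x : M, TangentSpace (𝓡 n) x) (e : ∀ x : M, E x),
    IsSmoothVFIn (𝓡 n) (kerMuSharp om) v → IsSmoothSec n F e →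
    ∀ x, iprod (extD (muForm om e) x + etaForm om e x) (v x) ∈ LinearMap.range (muC om x)
  kerMu_le : ∀ x : M, kerMu om x ≤ LinearMap.ker (etaC om x)
  kerMuSharp_le : ∀ x : M, kerMuSharp om x ≤ LinearMap.ker (sharp (etaC om x))
  involutive : IsInvolutive (𝓡 n) (kerMuSharp om)
  flat : ∀ (v w : ∀ x : M, TangentSpace (𝓡 n) x) (s : ∀ x : M, E x ⧸ kerMu om x),
    IsSmoothVFIn (𝓡 n) (kerMuSharp om) v → IsSmoothVFIn (𝓡 n) (kerMuSharp om) w →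
    IsSmoothQuotSec n F (kerMu om) s →
    ∀ x, nablaBar om (v x) (fun y => nablaBar om (w y) s)
      - nablaBar om (w x) (fun y => nablaBar om (v y) s)
      - nablaBar om (VectorField.mlieBracket (𝓡 n) v w x) s = 0
  /-- `i_v dη(e) = 0` if `∇_v (e mod Ker μ) = 0`, for `v ∈ Γ(Ker μ^♯)` and `e ∈ Γ(E)`. -/
  contraction_eta : ∀ (v : ∀ x : M, TangentSpace (𝓡 n) x) (e : ∀ x : M, E x),
    IsSmoothVFIn (𝓡 n) (kerMuSharp om) v → IsSmoothSec n F e →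
    (∀ x, nablaBar om (v x) (fun y => (kerMu om y).mkQ (e y)) = 0) →
    ∀ x, iprod (extD (etaForm om e) x) (v x) = 0

end Components

/-! ## Representations of the submersion groupoid -/

variable (n F) in
/-- A representation on `E/K` of the submersion groupoid `{(x, y) : q x = q y}` of `q : M → B`.
The values `Δ x y` are only relevant for `q x = q y`, and then they are isomorphisms by the
two algebraic laws. Smoothness of the action `(x, e_y mod K_y) ↦ Δ_{x,y} (e_y mod K_y)`: locally,
the action is represented by the restriction to `{(x, e_y) : q x = q y}` of a smooth map from an
open subset of `M × E` to `E`. -/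
structure IsSubmersionGroupoidRep {B : Type*} (q : M → B) (K : ∀ x : M, Submodule ℝ (E x))
    (Δ : ∀ x y : M, (E y ⧸ K y) →ₗ[ℝ] (E x ⧸ K x)) : Prop where
  id_law : ∀ x, Δ x x = LinearMap.id
  comp_law : ∀ x y z, q x = q y → q y = q z → Δ x y ∘ₗ Δ y z = Δ x z
  smooth : ∀ (x₀ : M) (e₀ : TotalSpace F E), q x₀ = q e₀.proj →
    ∃ (U : Set (M × TotalSpace F E)) (Φ : M × TotalSpace F E → TotalSpace F E),
      IsOpen U ∧ (x₀, e₀) ∈ U ∧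
      ContMDiffOn ((𝓡 n).prod ((𝓡 n).prod 𝓘(ℝ, F))) ((𝓡 n).prod 𝓘(ℝ, F)) ∞ Φ U ∧
      ∀ p ∈ U, q p.1 = q p.2.proj →
        ∃ a : E p.1, Φ p = ⟨p.1, a⟩ ∧
          (K p.1).mkQ a = Δ p.1 p.2.proj ((K p.2.proj).mkQ p.2.2)

/-- `Δ` integrates the partial connection: `∇_v s = d/dε|_{ε=0} Δ_{x, γ(ε)} s(γ(ε))` for every
smooth curve `γ` in a fiber of `q`, with `x = γ(0)` and `v = γ'(0)`, and every smooth section `s` of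
`E/Ker(μ)`. -/
def IntegratesNablaBar {m : ℕ}
    (om : FormField ((𝓡 n).prod 𝓘(ℝ, F)) (TotalSpace F E) (m + 2)) {B : Type*} (q : M → B)
    (Δ : ∀ x y : M, (E y ⧸ kerMu om y) →ₗ[ℝ] (E x ⧸ kerMu om x)) : Prop :=
  ∀ (γ : ℝ → M) (s : ∀ x : M, E x ⧸ kerMu om x),
    ContMDiff 𝓘(ℝ, ℝ) (𝓡 n) ∞ γ → (∀ t, q (γ t) = q (γ 0)) → IsSmoothQuotSec n F (kerMu om) s →
    Tendsto (fun ε : ℝ => ε⁻¹ • (Δ (γ 0) (γ ε) (s (γ ε)) - s (γ 0))) (𝓝[≠] 0)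
      (𝓝 (nablaBar om (mfderiv 𝓘(ℝ, ℝ) (𝓡 n) γ 0
        ((NormedSpace.fromTangentSpace (𝕜 := ℝ) (0 : ℝ)).symm 1)) s))

end Bundles

end

set_option linter.unusedSectionVars false

noncomputable section

/-! ## Linear forms on a product of vector spaces -/

section LinearForms

variable {H F : Type*} [NormedAddCommGroup H] [NormedSpace ℝ H]
  [NormedAddCommGroup F] [NormedSpace ℝ F] {k : ℕ}

/-! In a bundle chart a linear form is a family Ω(y, f) whose pullback under (y, f) ↦ (y, c f) is c
Ω. Comparing powers of c and letting c tend to 0, Ω vanishes on two vertical vectors, its part with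
one vertical entry is μ and does not depend on f, and its horizontal part is linear in f, equal to
dμ(f) + η(f) (`IsFiberHom.two_vertical`, `IsFiberHom.one_vertical`, `IsFiberHom.horizontal_eq`).
Hence (v, b) lies in Ker ω at e(x) exactly when v ∈ Ker μ^♯ and i_v(dμ(e) + η(e)) + μ(b − De(v)) = 0
(`mem_kerForm_iff`). Since dω is linear with components η and 0, its kernel has the same
description. Once Ker μ^♯ ⊆ Ker η^♯, the term i_v η(e) drops out, and Ker ω consists of the
horizontal lifts for ∇̄ of vectors in Ker μ^♯, modulo the vertical vectors in Ker μ.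

The two sides of the equivalence are linked by adapted coframes: local fiberwise linear surjections
P : E → ℝ^r with kernel Ker μ and P(∇̄_v e) = v(P e). For such P, a vector w is in Ker ω iff it
projects into Ker μ^♯ and dP(w) = 0 (`IsAdaptedCoframe.mem_kerForm_iff`); conversely this property
makes a coframe adapted (`isAdaptedCoframe_of_mem_kerForm_iff`).

If ω is kernel-reducible, the fiber coordinates of the quotient bundle, composed with q, are an
adapted coframe, because in charts Tq is (Tq_M, dP). In this coframe ∇̄ is ordinary differentiation,
so it is flat; Δ identifies vectors of E/Ker μ with the same image under q; and the condition on dη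
is Ker ω ⊆ Ker dω, tested on tangent vectors of sections along which ∇̄_v vanishes.

Conversely, constant rank of μ gives local coframes, and Δ spreads the values of a coframe along a
local section of q_M over whole fibers of q_M (`exists_invariantCoframe`). Differentiating the
invariance along curves in the fibers shows that the result is adapted. The transition functions of
invariant coframes descend to the base and glue the spaces E_x/Ker μ_x to a bundle
(`exists_bundleSimpleQuotient`) with Ker Tq = Ker ω. Finally Ker ω ⊆ Ker dω follows from the
condition on dη, applied to a section with P e locally constant.

For the quotient form, Cartan's formula shows that a form killed by Ker Tq together with its
exterior derivative induces forms on the target that are locally constant along the fibers of q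
(`exists_fiberwise_pushforward`). These fibers are connected, so the form descends; local sections
give smoothness. The kernel of the quotient form is trivial because every vector of Ker ω is killed
by Tq. -/

theorem iprod_eq_curryLeft (α : H [⋀^Fin (k + 1)]→L[ℝ] ℝ) (v : H) :
    iprod α v = α.curryLeft v := by
  ext z; rfl

theorem curryLeft_eq_zero_iff {α : H [⋀^Fin (k + 1)]→L[ℝ] ℝ} {v : H} :
    α.curryLeft v = 0 ↔ ∀ z, α (Matrix.vecCons v z) = 0 :=
  ⟨fun h z => by rw [← ContinuousAlternatingMap.curryLeft_apply_apply, h]; rfl,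
    fun h => by ext z; exact h z⟩

theorem map_eq_zero_of_curryLeft_eq_zero {α : H [⋀^Fin (k + 1)]→L[ℝ] ℝ} {v : H}
    (h : α.curryLeft v = 0) {z : Fin (k + 1) → H} {i : Fin (k + 1)} (hz : z i = v) : α z = 0 := by
  rw [← Fin.insertNth_self_removeNth i z, hz, ContinuousAlternatingMap.map_insertNth,
    curryLeft_eq_zero_iff.1 h, smul_zero]

/-- An alternating form on a product vanishes if it vanishes on tuples with at least two vertical
entries, on tuples with one vertical entry, and on horizontal tuples. -/
theorem alternating_prod_eq_zero {β : (H × F) [⋀^Fin k]→L[ℝ] ℝ}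
    (hh : ∀ w : Fin k → H, β (fun i => (w i, 0)) = 0)
    (hv : ∀ (i : Fin k) (c : F) (w : Fin k → H),
      β (update (fun i => (w i, 0)) i (0, c)) = 0)
    (hvv : ∀ (i j : Fin k) (z : Fin k → H × F), i ≠ j → (z i).1 = 0 → (z j).1 = 0 → β z = 0) :
    β = 0 := by
  classical
  ext z
  have hz : z = (fun i => ((z i).1, (0 : F))) + fun i => ((0 : H), (z i).2) := by
    ext i <;> simp
  -- Splitting every entry into its horizontal and vertical parts expands the value as a sum over
  -- the sets `s` of slots receiving the horizontal part.
  rw [hz, ContinuousAlternatingMap.map_add_univ]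
  refine Finset.sum_eq_zero fun s _ => ?_
  by_cases h0 : sᶜ = ∅
  · rw [Finset.compl_eq_empty_iff] at h0
    subst h0
    rw [Finset.piecewise_univ]
    exact hh _
  obtain ⟨i, hi⟩ := Finset.nonempty_iff_ne_empty.2 h0
  rw [Finset.mem_compl] at hi
  by_cases h1 : ∃ j, j ∉ s ∧ i ≠ j
  · obtain ⟨j, hj, hij⟩ := h1
    exact hvv i j _ hij (by simp [Finset.piecewise, hi]) (by simp [Finset.piecewise, hj])
  · push Not at h1
    convert hv i (z i).2 (fun j => (z j).1) using 2
    ext j : 1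
    by_cases hj : j ∈ s
    · have : j ≠ i := by rintro rfl; exact hi hj
      simp [Finset.piecewise, hj, this]
    · have := h1 j hj
      subst this
      simp [Finset.piecewise, hj]

/-- The component of a form on `H × F` with one vertical entry, as a continuous linear function of
that entry. -/
def vertComp : ((H × F) [⋀^Fin (k + 1)]→L[ℝ] ℝ) →L[ℝ] F →L[ℝ] (H [⋀^Fin k]→L[ℝ] ℝ) :=
  (ContinuousLinearMap.compL ℝ F ((H × F) [⋀^Fin k]→L[ℝ] ℝ) (H [⋀^Fin k]→L[ℝ] ℝ)
      (ContinuousAlternatingMap.compContinuousLinearMapCLM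
        (ContinuousLinearMap.inl ℝ H F))).comp
    (((ContinuousLinearMap.compL ℝ F (H × F) ((H × F) [⋀^Fin k]→L[ℝ] ℝ)).flip
        (ContinuousLinearMap.inr ℝ H F)).comp
      ContinuousAlternatingMap.curryLeftLI.toContinuousLinearMap)

theorem vertComp_apply (α : (H × F) [⋀^Fin (k + 1)]→L[ℝ] ℝ) (f : F) (w : Fin k → H) :
    vertComp α f w = α (Matrix.vecCons (0, f) fun i => (w i, 0)) := rfl

theorem update_zero_vecCons {X : Type*} {k : ℕ} (a b : X) (z : Fin k → X) :
    update (Matrix.vecCons a z) 0 b = Matrix.vecCons b z := by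
  ext i; cases i using Fin.cases <;> simp [Matrix.vecCons]

theorem map_vecCons_add (α : H [⋀^Fin (k + 1)]→L[ℝ] ℝ) (a b : H) (z : Fin k → H) :
    α (Matrix.vecCons (a + b) z) = α (Matrix.vecCons a z) + α (Matrix.vecCons b z) := by
  have := α.map_update_add (Matrix.vecCons 0 z) 0 a b
  simpa only [update_zero_vecCons] using this

theorem removeNth_succ_vecCons {X : Type*} {k : ℕ} (a : X) (z : Fin (k + 1) → X)
    (i : Fin (k + 1)) :
    i.succ.removeNth (Matrix.vecCons a z) = Matrix.vecCons a (i.removeNth z) := by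
  ext j; cases j using Fin.cases <;> simp [Matrix.vecCons, Fin.removeNth]

theorem map_vecCons_swap (α : H [⋀^Fin (k + 2)]→L[ℝ] ℝ) (a b : H) (z : Fin k → H) :
    α (Matrix.vecCons a (Matrix.vecCons b z)) = -α (Matrix.vecCons b (Matrix.vecCons a z)) := by
  have := α.map_insertNth 1 b (Matrix.vecCons a z)
  have h2 : (Fin.insertNth (α := fun _ => H) 1 b (Matrix.vecCons a z)) =
      Matrix.vecCons a (Matrix.vecCons b z) := by
    rw [Fin.insertNth_eq_iff]
    refine ⟨rfl, ?_⟩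
    ext j; cases j using Fin.cases <;> simp [Matrix.vecCons, Fin.removeNth]
  rw [h2] at this
  simpa using this

/-- `Ω` is fiberwise homogeneous over `y`, as linear forms on a trivial bundle are. -/
def IsFiberHom (Ω : H × F → (H × F) [⋀^Fin k]→L[ℝ] ℝ) (y : H) : Prop :=
  ∀ (c : ℝ) (f : F), (Ω (y, c • f)).compContinuousLinearMap
    ((ContinuousLinearMap.id ℝ H).prodMap (c • ContinuousLinearMap.id ℝ F)) = c • Ω (y, f)

theorem IsFiberHom.apply {Ω : H × F → (H × F) [⋀^Fin k]→L[ℝ] ℝ} {y : H} (h : IsFiberHom Ω y)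
    (c : ℝ) (f : F) (z : Fin k → H × F) :
    Ω (y, c • f) (fun i => ((z i).1, c • (z i).2)) = c * Ω (y, f) z :=
  congrArg (fun α => α z) (h c f)

variable {Ω : H × F → (H × F) [⋀^Fin k]→L[ℝ] ℝ} {y : H}

theorem tendsto_smul_apply (hc : ContinuousAt Ω (y, 0)) (f : F) (z : ℝ → Fin k → H × F)
    (hz : ContinuousAt z 0) :
    Tendsto (fun c : ℝ => Ω (y, c • f) (z c)) (𝓝[≠] 0) (𝓝 (Ω (y, 0) (z 0))) := by
  have h1 : ContinuousAt (fun c : ℝ => Ω (y, c • f)) 0 := by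
    refine ContinuousAt.comp (g := Ω) (by simpa using hc) (by fun_prop)
  have h2 : ContinuousAt (fun c : ℝ => Ω (y, c • f) (z c)) 0 :=
    ContinuousAt.comp (g := fun p : ((H × F) [⋀^Fin k]→L[ℝ] ℝ) × (Fin k → H × F) => p.1 p.2)
      (f := fun c : ℝ => (Ω (y, c • f), z c)) continuous_eval.continuousAt (h1.prodMk hz)
  simpa using h2.tendsto.mono_left nhdsWithin_le_nhds

/-- Two vertical slots contribute c² while linearity contributes c, so Ω(y, f) z equals c times a
quantity that converges as c → 0. -/
theorem IsFiberHom.two_vertical (h : IsFiberHom Ω y) (hc : ContinuousAt Ω (y, 0)) {i j : Fin k}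
    (hij : i ≠ j) {z : Fin k → H × F} (hi : (z i).1 = 0) (hj : (z j).1 = 0) (f : F) :
    Ω (y, f) z = 0 := by
  set u : ℝ → Fin k → H × F := fun c l => if l = i ∨ l = j then z l else ((z l).1, c • (z l).2)
    with hu
  have key : ∀ c : ℝ, c ≠ 0 → Ω (y, f) z = c * Ω (y, c • f) (u c) := by
    intro c hc0
    have h1 := h.apply c f z
    have h2 : (fun l => ((z l).1, c • (z l).2)) =
        update (update (u c) i (c • (u c i))) j (c • (u c j)) := by
      ext l : 1
      by_cases hlj : l = j
      · subst hlj; rw [update_self]; simp [hu, Prod.ext_iff, hj]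
      · rw [update_of_ne hlj]
        by_cases hli : l = i
        · subst hli; rw [update_self]; simp [hu, Prod.ext_iff, hi]
        · rw [update_of_ne hli]; simp [hu, hli, hlj]
    have e1 : u c j = update (u c) i (c • u c i) j := by rw [update_of_ne hij.symm]
    rw [h2, ContinuousAlternatingMap.map_update_smul, e1, update_eq_self,
      ContinuousAlternatingMap.map_update_smul, update_eq_self] at h1
    have := mul_left_cancel₀ hc0 h1
    exact this.symm
  have hz : ContinuousAt u 0 := by
    refine continuousAt_pi.2 fun l => ?_
    simp only [hu]
    split_ifs <;> fun_prop
  have h3 := tendsto_smul_apply hc f u hz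
  have h4 : Tendsto (fun c : ℝ => c * Ω (y, c • f) (u c)) (𝓝[≠] 0) (𝓝 (0 * Ω (y, 0) (u 0))) :=
    (tendsto_id.mono_left nhdsWithin_le_nhds).mul h3
  rw [zero_mul] at h4
  refine tendsto_nhds_unique (tendsto_const_nhds.congr' ?_) h4
  filter_upwards [self_mem_nhdsWithin] with c hc0 using key c hc0

/-- A single vertical slot contributes the same factor c as linearity, so the value at f equals the
value at c f; let c → 0. -/
theorem IsFiberHom.one_vertical {Ω : H × F → (H × F) [⋀^Fin (k + 1)]→L[ℝ] ℝ}
    (h : IsFiberHom Ω y) (hc : ContinuousAt Ω (y, 0)) (f b : F) (w : Fin k → H) :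
    Ω (y, f) (Matrix.vecCons (0, b) fun i => (w i, 0)) = vertComp (Ω (y, 0)) b w := by
  set z : Fin (k + 1) → H × F := Matrix.vecCons (0, b) fun i => (w i, 0) with hz
  have key : ∀ c : ℝ, c ≠ 0 → Ω (y, f) z = Ω (y, c • f) z := by
    intro c hc0
    have h1 := h.apply c f z
    have h2 : (fun l => ((z l).1, c • (z l).2)) = update z 0 (c • z 0) := by
      ext l : 1
      cases l using Fin.cases <;> simp [hz, Matrix.vecCons]
    rw [h2, ContinuousAlternatingMap.map_update_smul, update_eq_self] at h1
    exact (mul_left_cancel₀ hc0 h1).symm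
  have h3 := tendsto_smul_apply hc f (fun _ => z) continuousAt_const
  refine tendsto_nhds_unique (tendsto_const_nhds.congr' ?_) h3
  filter_upwards [self_mem_nhdsWithin] with c hc0 using key c hc0

theorem IsFiberHom.horizontal (h : IsFiberHom Ω y) (c : ℝ) (f : F) (w : Fin k → H) :
    Ω (y, c • f) (fun i => (w i, 0)) = c * Ω (y, f) (fun i => (w i, 0)) := by
  simpa using h.apply c f (fun i => (w i, 0))

/-- For a linear form, the horizontal part at `(y, f)` is `dB(f) + C(f)`, where `B`, `C` are the
components of the form and of its exterior derivative. -/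
theorem IsFiberHom.horizontal_eq {Ω : H × F → (H × F) [⋀^Fin (k + 1)]→L[ℝ] ℝ}
    (h : IsFiberHom Ω y) (hd : DifferentiableAt ℝ Ω (y, 0)) (f : F) (w : Fin (k + 1) → H) :
    Ω (y, f) (fun i => (w i, 0)) =
      extDeriv (fun y => vertComp (Ω (y, 0)) f) y w + vertComp (extDeriv Ω (y, 0)) f w := by
  have hd0 : DifferentiableAt ℝ (fun y => Ω (y, (0 : F))) y :=
    DifferentiableAt.comp y (f := fun y => (y, (0 : F))) hd (by fun_prop)
  have hdB : DifferentiableAt ℝ (fun y => vertComp (Ω (y, 0)) f) y :=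
    ((ContinuousLinearMap.apply ℝ _ f).comp
      (vertComp (k := k) (H := H) (F := F))).differentiableAt.comp y hd0
  rw [vertComp_apply, extDeriv_apply hd, extDeriv_apply hdB]
  -- In the expansion of dΩ at (y, 0) on (0, f), w₀, …, the term differentiating along (0, f) is
  -- Ω(y, f) itself, because t ↦ Ω(y, t f) is linear on horizontal entries. The other terms (`e2`)
  -- are those of dB(f) with the opposite sign.
  have e0 : fderiv ℝ (fun p => Ω p ((0 : Fin (k + 2)).removeNth
      (Matrix.vecCons (0, f) fun i => (w i, (0 : F))))) (y, 0) (0, f) =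
      Ω (y, f) fun i => (w i, 0) := by
    have hr : (0 : Fin (k + 2)).removeNth (Matrix.vecCons ((0 : H), f) fun i => (w i, (0 : F))) =
        fun i => (w i, 0) := by ext i <;> simp [Fin.removeNth, Matrix.vecCons]
    rw [hr]
    set g : H × F → ℝ := fun p => Ω p fun i => (w i, 0)
    have hg : HasFDerivAt g (fderiv ℝ g (y, 0)) (y, 0) :=
      (hd.continuousAlternatingMap_apply fun _ => differentiableAt_const _).hasFDerivAt
    have hl : HasDerivAt (fun t : ℝ => ((y, t • f) : H × F)) (0, f) 0 := by
      refine (hasDerivAt_const _ _).prodMk ?_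
      simpa using (hasDerivAt_id (0 : ℝ)).smul_const f
    have h1 : HasDerivAt (fun t : ℝ => g (y, t • f)) (fderiv ℝ g (y, 0) (0, f)) 0 := by
      have hg' : HasFDerivAt g (fderiv ℝ g (y, 0)) ((fun t : ℝ => ((y, t • f) : H × F)) 0) := by
        simpa using hg
      exact hg'.comp_hasDerivAt (0 : ℝ) hl
    have h2 : HasDerivAt (fun t : ℝ => g (y, t • f)) (g (y, f)) 0 := by
      have : (fun t : ℝ => g (y, t • f)) = fun t => t * g (y, f) := by
        funext t; exact h.horizontal t f w
      rw [this]
      simpa using (hasDerivAt_id (0 : ℝ)).mul_const (g (y, f))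
    exact h1.unique h2
  have e1 : ∀ i : Fin (k + 1), fderiv ℝ (fun p => Ω p (i.succ.removeNth
      (Matrix.vecCons (0, f) fun i => (w i, (0 : F))))) (y, 0) (w i, 0) =
      fderiv ℝ (fun y => vertComp (Ω (y, 0)) f (i.removeNth w)) y (w i) := by
    intro i
    rw [removeNth_succ_vecCons]
    set g : H × F → ℝ := fun p => Ω p (Matrix.vecCons (0, f) (i.removeNth fun i => (w i, (0 : F))))
    have hg : HasFDerivAt g (fderiv ℝ g (y, 0)) (y, 0) :=
      (hd.continuousAlternatingMap_apply fun _ => differentiableAt_const _).hasFDerivAt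
    have hl : HasFDerivAt (fun y : H => (y, (0 : F))) (ContinuousLinearMap.inl ℝ H F) y :=
      (ContinuousLinearMap.inl ℝ H F).hasFDerivAt
    have h1 := HasFDerivAt.comp y (f := fun y : H => (y, (0 : F))) hg hl
    have h2 : (fun y => vertComp (Ω (y, 0)) f (i.removeNth w)) = g ∘ fun y : H => (y, (0 : F)) := by
      funext y; rfl
    rw [h2, h1.fderiv]
    rfl
  have e2 : ∀ i : Fin (k + 1), (-1 : ℤ) ^ (i.succ : ℕ) • fderiv ℝ (fun p => Ω p (i.succ.removeNth
      (Matrix.vecCons (0, f) fun i => (w i, (0 : F))))) (y, 0)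
      ((Matrix.vecCons (0, f) fun i => (w i, (0 : F)) : Fin (k + 2) → H × F) i.succ) =
      - ((-1 : ℤ) ^ (i : ℕ) • fderiv ℝ (fun y => vertComp (Ω (y, 0)) f (i.removeNth w)) y (w i)) := by
    intro i
    have : (Matrix.vecCons (0, f) fun i => (w i, (0 : F)) : Fin (k + 2) → H × F) i.succ =
      (w i, 0) := rfl
    rw [this, e1 i, Fin.val_succ, pow_succ, mul_neg_one, neg_smul]
  have e3 : (Matrix.vecCons (0, f) fun i => (w i, (0 : F)) : Fin (k + 2) → H × F) 0 = (0, f) := rfl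
  rw [Fin.sum_univ_succ (n := k + 1) (f := fun i => (-1 : ℤ) ^ (i : ℕ) • fderiv ℝ (fun p => Ω p
    (i.removeNth (Matrix.vecCons (0, f) fun i => (w i, (0 : F))))) (y, 0)
    ((Matrix.vecCons (0, f) fun i => (w i, (0 : F)) : Fin (k + 2) → H × F) i)),
    e3, e0, Finset.sum_congr rfl fun i _ => e2 i, Finset.sum_neg_distrib]
  simp

/-- The kernel of a linear form in terms of its components. -/
theorem IsFiberHom.curryLeft_eq_zero_iff {Ω : H × F → (H × F) [⋀^Fin (k + 2)]→L[ℝ] ℝ}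
    (h : IsFiberHom Ω y) (hd : DifferentiableAt ℝ Ω (y, 0)) (f : F) (v : H) (b : F) :
    (Ω (y, f)).curryLeft (v, b) = 0 ↔
      (∀ c, (vertComp (Ω (y, 0)) c).curryLeft v = 0) ∧
      (extDeriv (fun y => vertComp (Ω (y, 0)) f) y + vertComp (extDeriv Ω (y, 0)) f).curryLeft v
        + vertComp (Ω (y, 0)) b = 0 := by
  have hc := hd.continuousAt
  have hvb : ((v, b) : H × F) = (v, 0) + (0, b) := by simp
  have hhor : ∀ w : Fin (k + 1) → H,
      Ω (y, f) (Matrix.vecCons (v, b) fun i => (w i, 0)) =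
      (extDeriv (fun y => vertComp (Ω (y, 0)) f) y +
        vertComp (extDeriv Ω (y, 0)) f) (Matrix.vecCons v w) + vertComp (Ω (y, 0)) b w := by
    intro w
    rw [hvb, map_vecCons_add, h.one_vertical hc, ContinuousAlternatingMap.add_apply,
      ← h.horizontal_eq hd]
    congr 2
    ext i : 1
    cases i using Fin.cases <;> simp [Matrix.vecCons]
  -- The vertical part `b` of the contracted vector does not contribute here, since it would give a
  -- second vertical entry.
  have hver : ∀ (c : F) (w : Fin k → H),
      Ω (y, f) (Matrix.vecCons (0, c) (Matrix.vecCons (v, b) fun i => (w i, 0))) =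
        vertComp (Ω (y, 0)) c (Matrix.vecCons v w) := by
    intro c w
    rw [map_vecCons_swap, hvb, map_vecCons_add, map_vecCons_swap,
      h.two_vertical hc (i := 0) (j := 1) (by simp) (z := Matrix.vecCons (0, b) _) rfl rfl,
      add_zero, neg_neg, ← h.one_vertical hc f]
    congr 2
    ext i : 1
    cases i using Fin.cases <;> simp [Matrix.vecCons]
  constructor
  · intro hk
    have hk' := _root_.curryLeft_eq_zero_iff.1 hk
    refine ⟨fun c => ?_, ?_⟩
    · refine _root_.curryLeft_eq_zero_iff.2 fun w => ?_
      rw [← hver, map_vecCons_swap, hk', neg_zero]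
    · ext w
      have := hk' fun i => (w i, 0)
      rw [hhor] at this
      exact this
  · rintro ⟨h1, h2⟩
    refine alternating_prod_eq_zero (fun w => ?_) (fun i c w => ?_) fun i j z hij hi hj => ?_
    · rw [ContinuousAlternatingMap.curryLeft_apply_apply, hhor]
      exact congrArg (fun α => α w) h2
    · rw [← Fin.insertNth_self_removeNth i (update _ _ _), update_self,
        ContinuousAlternatingMap.map_insertNth, ContinuousAlternatingMap.curryLeft_apply_apply,
        map_vecCons_swap, Fin.removeNth_update]
      have := hver c (i.removeNth w)
      rw [show (i.removeNth fun i => (w i, (0 : F))) = fun j => (i.removeNth w j, 0) from rfl,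
        this, _root_.curryLeft_eq_zero_iff.1 (h1 c), neg_zero, smul_zero]
    · exact h.two_vertical hc (i := i.succ) (j := j.succ) (by simpa using hij)
        (z := Matrix.vecCons (v, b) z) hi hj f

/-- The exterior derivative of a fiberwise homogeneous form is fiberwise homogeneous. -/
theorem IsFiberHom.extDeriv {O : Set H} (hO : IsOpen O) (h : ∀ y ∈ O, IsFiberHom Ω y)
    (hd : ∀ y ∈ O, ∀ f, DifferentiableAt ℝ Ω (y, f)) (hy : y ∈ O) :
    IsFiberHom (extDeriv Ω) y := by
  intro c f
  set L : (H × F) →L[ℝ] H × F :=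
    (ContinuousLinearMap.id ℝ H).prodMap (c • ContinuousLinearMap.id ℝ F) with hL
  -- The exterior derivative commutes with pullback along the fiberwise scaling `L`.
  have h1 := extDeriv_pullback (f := L) (x := (y, f)) (hd y hy (c • f))
    (L.contDiff (n := 2)).contDiffAt (by simp)
  rw [L.fderiv] at h1
  have h2 : (fun x => (Ω (L x)).compContinuousLinearMap (fderiv ℝ L x)) =ᶠ[𝓝 (y, f)]
      fun x => c • Ω x := by
    have : ∀ᶠ x : H × F in 𝓝 (y, f), x.1 ∈ O :=
      continuous_fst.continuousAt.preimage_mem_nhds (hO.mem_nhds hy)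
    filter_upwards [this] with x hx
    rw [L.fderiv]
    exact h x.1 hx c x.2
  rw [h2.extDeriv_eq, show (fun x => c • Ω x) = c • Ω from rfl, extDeriv_smul] at h1
  exact h1.symm

/-- Contraction of `d(B(s))` with a vector in the kernel of `B^♯`. -/
theorem curryLeft_extDeriv_apply_section {B : H → F →L[ℝ] (H [⋀^Fin (k + 1)]→L[ℝ] ℝ)} {s : H → F}
    (hB : DifferentiableAt ℝ B y) (hs : DifferentiableAt ℝ s y) {v : H}
    (hv : ∀ c, (B y c).curryLeft v = 0) :
    (_root_.extDeriv (fun y => B y (s y)) y).curryLeft v =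
      (_root_.extDeriv (fun y' => B y' (s y)) y).curryLeft v + B y (fderiv ℝ s y v) := by
  have h1 : HasFDerivAt (fun y => B y (s y))
      ((B y).comp (fderiv ℝ s y) + (fderiv ℝ B y).flip (s y)) y :=
    hB.hasFDerivAt.clm_apply hs.hasFDerivAt
  have h2 : HasFDerivAt (fun y' => B y' (s y)) ((fderiv ℝ B y).flip (s y)) y := by
    simpa using hB.hasFDerivAt.clm_apply (hasFDerivAt_const (s y) y)
  rw [_root_.extDeriv, _root_.extDeriv, h1.fderiv, h2.fderiv,
    ContinuousAlternatingMap.alternatizeUncurryFin_add, ContinuousAlternatingMap.curryLeft_add,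
    add_apply]
  refine (add_comm _ _).trans (congrArg₂ _ rfl ?_)
  -- In the alternatization of B(y) ∘ Ds, only the term that differentiates along `v` survives; in
  -- every other term `v` is an entry of a form that it kills.
  ext z
  rw [ContinuousAlternatingMap.curryLeft_apply_apply,
    ContinuousAlternatingMap.alternatizeUncurryFin_apply, Fin.sum_univ_succ (n := k + 1),
    Finset.sum_eq_zero (s := Finset.univ)]
  · simp [Matrix.vecCons]
  · intro i _
    rw [removeNth_succ_vecCons]
    simp only [ContinuousLinearMap.comp_apply]
    rw [_root_.curryLeft_eq_zero_iff.1 (hv _), smul_zero]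

end LinearForms

/-! ## Pullbacks of forms along maps from vector spaces -/

section CompSmooth

variable {V V' : Type*} [NormedAddCommGroup V] [NormedSpace ℝ V]
  [NormedAddCommGroup V'] [NormedSpace ℝ V']

/-- Induction on the degree: currying off the first entry reduces to evaluation of a continuous
linear map. -/
theorem ContDiffAt.alternating_apply {V₀ : Type*} [NormedAddCommGroup V₀] [NormedSpace ℝ V₀] {k : ℕ}
    {r : WithTop ℕ∞} {α : V₀ → V [⋀^Fin k]→L[ℝ] ℝ} {z : V₀ → Fin k → V} {y : V₀}
    (hα : ContDiffAt ℝ r α y) (hz : ∀ i, ContDiffAt ℝ r (fun y => z y i) y) :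
    ContDiffAt ℝ r (fun y => α y (z y)) y := by
  induction k with
  | zero =>
    have : (fun y => α y (z y)) = fun y => ContinuousAlternatingMap.apply ℝ V ℝ 0 (α y) := by
      funext y
      exact congrArg (α y) (Subsingleton.elim _ _)
    rw [this]
    exact ContDiffAt.comp (g := ContinuousAlternatingMap.apply ℝ V ℝ 0) y
      (ContinuousLinearMap.contDiff _).contDiffAt hα
  | succ k ih =>
    have h1 : ContDiffAt ℝ r (fun y => (α y).curryLeft (z y 0)) y :=
      ContDiffAt.clm_apply (f := fun y => (α y).curryLeft)
        (ContDiffAt.comp (g := ContinuousAlternatingMap.curryLeftLI (𝕜 := ℝ) (E := V) (F := ℝ)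
          (n := k)) y (LinearIsometry.contDiff _).contDiffAt hα) (hz 0)
    have h2 := ih (z := fun y i => z y i.succ) h1 fun i => hz i.succ
    refine h2.congr_of_eventuallyEq (Eventually.of_forall fun y => ?_)
    exact congrArg (α y) (Matrix.cons_head_tail (z y)).symm

theorem contDiffAt_clm_of_apply [FiniteDimensional ℝ V] {V₀ W : Type*}
    [NormedAddCommGroup V₀] [NormedSpace ℝ V₀] [NormedAddCommGroup W] [NormedSpace ℝ W]
    {r : WithTop ℕ∞} {α : V₀ → V →L[ℝ] W} {y : V₀}
    (h : ∀ z, ContDiffAt ℝ r (fun y => α y z) y) : ContDiffAt ℝ r α y := by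
  let d := Module.finrank ℝ V
  have hd : d = Module.finrank ℝ (Fin d → ℝ) := (Module.finrank_fin_fun ℝ).symm
  let e₁ := ContinuousLinearEquiv.ofFinrankEq hd
  let e₂ := (e₁.arrowCongr (1 : W ≃L[ℝ] W)).trans (ContinuousLinearEquiv.piRing (Fin d))
  rw [← id_comp α, ← e₂.symm_comp_self]
  exact e₂.symm.contDiff.contDiffAt.comp y (contDiffAt_pi.2 fun i => h _)

theorem contDiffAt_alternating_of_apply [FiniteDimensional ℝ V] {V₀ : Type*}
    [NormedAddCommGroup V₀] [NormedSpace ℝ V₀] {k : ℕ}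
    {r : WithTop ℕ∞} {α : V₀ → V [⋀^Fin k]→L[ℝ] ℝ} {y : V₀}
    (h : ∀ z, ContDiffAt ℝ r (fun y => α y z) y) : ContDiffAt ℝ r α y := by
  induction k with
  | zero =>
    have : α = fun y => ContinuousAlternatingMap.constOfIsEmptyLIE ℝ V ℝ (Fin 0) (α y 0) := by
      funext y
      ext z
      exact congrArg (α y) (Subsingleton.elim _ _)
    rw [this]
    exact ContDiffAt.comp (g := ContinuousAlternatingMap.constOfIsEmptyLIE ℝ V ℝ (Fin 0)) y
      (LinearIsometryEquiv.contDiff _).contDiffAt (h 0)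
  | succ k ih =>
    have h1 : ContDiffAt ℝ r (fun y => (α y).curryLeft) y :=
      contDiffAt_clm_of_apply fun x => ih fun z => h (Matrix.vecCons x z)
    -- Alternatizing the curried form returns k + 1 copies of the form, so α is a fixed continuous
    -- linear image of its curried version.
    have : α = fun y => (k + 1 : ℝ)⁻¹ •
        ContinuousAlternatingMap.alternatizeUncurryFinCLM ℝ V ℝ (α y).curryLeft := by
      funext y
      rw [ContinuousAlternatingMap.alternatizeUncurryFinCLM_apply,
        ContinuousAlternatingMap.alternatizeUncurryFin_curryLeft, ← Nat.cast_succ,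
        ← Nat.cast_smul_eq_nsmul ℝ, smul_smul, inv_mul_cancel₀ (by positivity), one_smul]
    rw [this]
    exact (ContDiffAt.comp (g := ContinuousAlternatingMap.alternatizeUncurryFinCLM ℝ V ℝ) y
      (ContinuousLinearMap.contDiff _).contDiffAt h1).const_smul _

theorem ContDiffAt.alternating_comp [FiniteDimensional ℝ V] {V₀ : Type*} [NormedAddCommGroup V₀]
    [NormedSpace ℝ V₀] {k : ℕ}
    {r : WithTop ℕ∞} {α : V₀ → V' [⋀^Fin k]→L[ℝ] ℝ} {g : V₀ → V →L[ℝ] V'} {y : V₀}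
    (hα : ContDiffAt ℝ r α y) (hg : ContDiffAt ℝ r g y) :
    ContDiffAt ℝ r (fun y => (α y).compContinuousLinearMap (g y)) y :=
  contDiffAt_alternating_of_apply fun z =>
    hα.alternating_apply (z := fun y i => g y (z i)) fun _ => hg.clm_apply contDiffAt_const

end CompSmooth

/-! ### Derivatives and forms on manifolds, read in the model spaces. -/

section ModelDeriv

variable {V : Type*} [NormedAddCommGroup V] [NormedSpace ℝ V]
  {H : Type*} [TopologicalSpace H] (I : ModelWithCorners ℝ V H)
  {X : Type*} [TopologicalSpace X] [ChartedSpace H X]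
  {V' : Type*} [NormedAddCommGroup V'] [NormedSpace ℝ V']
  {H' : Type*} [TopologicalSpace H'] (I' : ModelWithCorners ℝ V' H')
  {X' : Type*} [TopologicalSpace X'] [ChartedSpace H' X']
  {V'' : Type*} [NormedAddCommGroup V''] [NormedSpace ℝ V'']
  {H'' : Type*} [TopologicalSpace H''] (I'' : ModelWithCorners ℝ V'' H'')
  {X'' : Type*} [TopologicalSpace X''] [ChartedSpace H'' X'']

/-- The derivative of a map between manifolds, as a linear map of the model spaces. -/
def modelDeriv (f : X → X') (x : X) : V →L[ℝ] V' := mfderiv I I' f x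

/-- A form at a point, on the model space. -/
def FormField.at {I : ModelWithCorners ℝ V H} {k : ℕ} (om : FormField I X k) (x : X) :
    V [⋀^Fin k]→L[ℝ] ℝ := om x

variable {I I' I''} {f : X → X'} {x : X}

theorem modelDeriv_comp {g : X' → X''} (hg : MDifferentiableAt I' I'' g (f x))
    (hf : MDifferentiableAt I I' f x) :
    modelDeriv I I'' (g ∘ f) x = (modelDeriv I' I'' g (f x)).comp (modelDeriv I I' f x) :=
  mfderiv_comp x hg hf

theorem modelDeriv_congr {g : X → X'} (h : f =ᶠ[𝓝 x] g) :
    modelDeriv I I' f x = modelDeriv I I' g x :=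
  h.mfderiv_eq

theorem modelDeriv_eq_fderiv {f : V → V'} {x : V} :
    modelDeriv 𝓘(ℝ, V) 𝓘(ℝ, V') f x = fderiv ℝ f x := mfderiv_eq_fderiv

theorem modelDeriv_eq_fderiv_written [I.Boundaryless] (hf : MDifferentiableAt I I' f x) :
    modelDeriv I I' f x = fderiv ℝ (writtenInExtChartAt I I' x f) (extChartAt I x x) := by
  have h : modelDeriv I I' f x =
      fderivWithin ℝ (writtenInExtChartAt I I' x f) (range I) (extChartAt I x x) := if_pos hf
  rw [h, I.range_eq_univ, fderivWithin_univ]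

theorem modelDeriv_extChartAt_self [IsManifold I ∞ X] :
    modelDeriv I 𝓘(ℝ, V) (extChartAt I x) x = ContinuousLinearMap.id ℝ V := by
  have : IsManifold I 1 X := IsManifold.of_le (n := ∞) (by simp)
  exact mfderiv_extChartAt_self

theorem mdifferentiableAt_extChartAt_symm [I.Boundaryless] [IsManifold I ∞ X] {y : V}
    (hy : y ∈ (extChartAt I x).target) :
    MDifferentiableAt 𝓘(ℝ, V) I (extChartAt I x).symm y := by
  have : IsManifold I 1 X := IsManifold.of_le (n := ∞) (by simp)
  have h := mdifferentiableWithinAt_extChartAt_symm hy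
  rwa [I.range_eq_univ, mdifferentiableWithinAt_univ] at h

theorem mdifferentiableAt_extChartAt' [IsManifold I ∞ X] {x' : X}
    (hy : x' ∈ (extChartAt I x).source) :
    MDifferentiableAt I 𝓘(ℝ, V) (extChartAt I x) x' := by
  have : IsManifold I 1 X := IsManifold.of_le (n := ∞) (by simp)
  exact mdifferentiableAt_extChartAt (by rwa [extChartAt_source] at hy)

theorem modelDeriv_extChartAt_comp_symm [I.Boundaryless] [IsManifold I ∞ X] {y : V}
    (hy : y ∈ (extChartAt I x).target) :
    (modelDeriv I 𝓘(ℝ, V) (extChartAt I x) ((extChartAt I x).symm y)).comp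
      (modelDeriv 𝓘(ℝ, V) I (extChartAt I x).symm y) = ContinuousLinearMap.id ℝ V := by
  have : IsManifold I 1 X := IsManifold.of_le (n := ∞) (by simp)
  have h := mfderiv_extChartAt_comp_mfderivWithin_extChartAt_symm hy
  rw [I.range_eq_univ, mfderivWithin_univ] at h
  exact h

theorem modelDeriv_symm_comp_extChartAt [I.Boundaryless] [IsManifold I ∞ X] {y : V}
    (hy : y ∈ (extChartAt I x).target) :
    (modelDeriv 𝓘(ℝ, V) I (extChartAt I x).symm y).comp
      (modelDeriv I 𝓘(ℝ, V) (extChartAt I x) ((extChartAt I x).symm y)) =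
      ContinuousLinearMap.id ℝ V := by
  have : IsManifold I 1 X := IsManifold.of_le (n := ∞) (by simp)
  have h := mfderivWithin_extChartAt_symm_comp_mfderiv_extChartAt hy
  rw [I.range_eq_univ, mfderivWithin_univ] at h
  exact h

theorem modelDeriv_extChartAt_symm_self [I.Boundaryless] [IsManifold I ∞ X] :
    modelDeriv 𝓘(ℝ, V) I (extChartAt I x).symm (extChartAt I x x) =
      ContinuousLinearMap.id ℝ V := by
  have h := modelDeriv_extChartAt_comp_symm (I := I) (mem_extChartAt_target x)
  rw [extChartAt_to_inv, modelDeriv_extChartAt_self, ContinuousLinearMap.id_comp] at h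
  exact h

theorem contMDiffAt_extChartAt_symm [I.Boundaryless] [IsManifold I ∞ X] {y : V}
    (hy : y ∈ (extChartAt I x).target) : ContMDiffAt 𝓘(ℝ, V) I ∞ (extChartAt I x).symm y :=
  (contMDiffOn_extChartAt_symm x y hy).contMDiffAt ((isOpen_extChartAt_target x).mem_nhds hy)

theorem mem_extChartAt_target_nhds [I.Boundaryless] {y : V} (hy : y ∈ (extChartAt I x).target) :
    (extChartAt I x).target ∈ 𝓝 y := (isOpen_extChartAt_target x).mem_nhds hy

theorem two_le_infty : minSmoothness ℝ 2 ≤ ∞ := by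
  rw [minSmoothness_of_isRCLikeNormedField]
  exact WithTop.coe_le_coe.2 (le_top (a := (2 : ℕ∞)))

/-! ### Pullbacks of forms to vector spaces and naturality of the exterior derivative. -/

section FormPull

variable {k : ℕ}

/-- The pullback of a form along a map from a vector space. -/
def formPull (ψ : V' → X) (om : FormField I X k) (y : V') : V' [⋀^Fin k]→L[ℝ] ℝ :=
  (om.at (ψ y)).compContinuousLinearMap (modelDeriv 𝓘(ℝ, V') I ψ y)

theorem chartRep_eq_formPull (om : FormField I X k) (x : X) :
    chartRep om x = formPull (extChartAt I x).symm om := rfl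

theorem formPull_congr {ψ ψ' : V' → X} (om : FormField I X k) {y : V'} (h : ψ =ᶠ[𝓝 y] ψ') :
    formPull ψ om y = formPull ψ' om y := by
  rw [formPull, formPull, h.eq_of_nhds, modelDeriv_congr h]

theorem formPull_comp {ψ : V' → X} {g : V'' → V'} (om : FormField I X k) {z : V''}
    (hψ : MDifferentiableAt 𝓘(ℝ, V') I ψ (g z)) (hg : DifferentiableAt ℝ g z) :
    formPull (ψ ∘ g) om z = (formPull ψ om (g z)).compContinuousLinearMap (fderiv ℝ g z) := by
  rw [formPull, modelDeriv_comp (I' := 𝓘(ℝ, V')) hψ hg.mdifferentiableAt, modelDeriv_eq_fderiv]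
  rfl

theorem formPull_pullbackForm {ψ : V'' → X} {f : X → X'} (om : FormField I' X' k) {z : V''}
    (hf : MDifferentiableAt I I' f (ψ z)) (hψ : MDifferentiableAt 𝓘(ℝ, V'') I ψ z) :
    formPull ψ (pullbackForm f om : FormField I X k) z = formPull (f ∘ ψ) om z := by
  rw [formPull, formPull, modelDeriv_comp (I' := I) hf hψ]
  rfl

variable [I.Boundaryless] [IsManifold I ∞ X]

theorem formPull_eq_chartRep {ψ : V' → X} (om : FormField I X k) {y : V'} {x : X}
    (hψ : MDifferentiableAt 𝓘(ℝ, V') I ψ y) (hx : ψ y ∈ (extChartAt I x).source) :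
    formPull ψ om y = (chartRep om x (extChartAt I x (ψ y))).compContinuousLinearMap
      (fderiv ℝ (extChartAt I x ∘ ψ) y) := by
  have h1 : ψ =ᶠ[𝓝 y] (extChartAt I x).symm ∘ (extChartAt I x ∘ ψ) := by
    have := hψ.continuousAt.preimage_mem_nhds ((isOpen_extChartAt_source (I := I) x).mem_nhds hx)
    filter_upwards [this] with z hz using ((extChartAt I x).left_inv hz).symm
  have h2 : MDifferentiableAt 𝓘(ℝ, V') 𝓘(ℝ, V) (extChartAt I x ∘ ψ) y :=
    (mdifferentiableAt_extChartAt' hx).comp y hψ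
  rw [formPull_congr om h1, formPull_comp (g := extChartAt I x ∘ ψ) om
    (mdifferentiableAt_extChartAt_symm ((extChartAt I x).map_source hx)) h2.differentiableAt]
  rfl

theorem chartRep_self (om : FormField I X k) (x : X) : chartRep om x (extChartAt I x x) = om.at x := by
  rw [chartRep_eq_formPull, formPull, modelDeriv_extChartAt_symm_self, extChartAt_to_inv]
  rfl

theorem extD_at (om : FormField I X k) (x : X) :
    (extD om).at x = extDeriv (chartRep om x) (extChartAt I x x) := by
  change (extDeriv (chartRep om x) (extChartAt I x x)).compContinuousLinearMap
    (modelDeriv I 𝓘(ℝ, V) (extChartAt I x) x) = _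
  rw [modelDeriv_extChartAt_self]
  rfl

theorem IsSmoothForm.contDiffAt_chartRep {om : FormField I X k} (h : IsSmoothForm om) {x : X} {y : V}
    (hy : y ∈ (extChartAt I x).target) : ContDiffAt ℝ ∞ (chartRep om x) y :=
  (h x).contDiffAt (mem_extChartAt_target_nhds hy)

theorem contDiffAt_extChartAt_comp {ψ : V' → X} {y : V'} {x : X}
    (hψ : ContMDiffAt 𝓘(ℝ, V') I ∞ ψ y) (hx : ψ y ∈ (extChartAt I x).source) :
    ContDiffAt ℝ ∞ (extChartAt I x ∘ ψ) y := by
  rw [extChartAt_source] at hx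
  exact ((contMDiffAt_extChartAt' hx).comp y hψ).contDiffAt

theorem eventually_contMDiffAt_vectorSpace {ψ : V' → X} {y : V'}
    (hψ : ContMDiffAt 𝓘(ℝ, V') I ∞ ψ y) :
    ∀ᶠ z in 𝓝 y, MDifferentiableAt 𝓘(ℝ, V') I ψ z := by
  have h1 : ContMDiffAt 𝓘(ℝ, V') I 1 ψ y := hψ.of_le (by simp)
  have : IsManifold I 1 X := IsManifold.of_le (n := ∞) (by simp)
  have := (contMDiffAt_iff_contMDiffAt_nhds (by simp)).1 h1
  filter_upwards [this] with z hz using hz.mdifferentiableAt (by simp)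

theorem formPull_eventuallyEq {ψ : V' → X} (om : FormField I X k) {y : V'} {x : X}
    (hψ : ContMDiffAt 𝓘(ℝ, V') I ∞ ψ y) (hx : ψ y ∈ (extChartAt I x).source) :
    formPull ψ om =ᶠ[𝓝 y] fun y => (chartRep om x ((extChartAt I x ∘ ψ) y)).compContinuousLinearMap
      (fderiv ℝ (extChartAt I x ∘ ψ) y) := by
  have := hψ.continuousAt.preimage_mem_nhds ((isOpen_extChartAt_source (I := I) x).mem_nhds hx)
  filter_upwards [this, eventually_contMDiffAt_vectorSpace hψ] with z hz hd
  exact formPull_eq_chartRep om hd hz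

theorem IsSmoothForm.contDiffAt_formPull [FiniteDimensional ℝ V'] {om : FormField I X k} (h : IsSmoothForm om)
    {ψ : V' → X} {y : V'} (hψ : ContMDiffAt 𝓘(ℝ, V') I ∞ ψ y) :
    ContDiffAt ℝ ∞ (formPull ψ om) y := by
  have hx := mem_extChartAt_source (I := I) (ψ y)
  refine ContDiffAt.congr_of_eventuallyEq ?_ (formPull_eventuallyEq om hψ hx)
  have hc := contDiffAt_extChartAt_comp hψ hx
  exact ContDiffAt.alternating_comp (α := chartRep om (ψ y) ∘ (extChartAt I (ψ y) ∘ ψ))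
    ((h.contDiffAt_chartRep (mem_extChartAt_target (ψ y))).comp y hc)
    (hc.fderiv_right (m := ∞) (by simp))

/-- Naturality of the exterior derivative. -/
theorem extDeriv_formPull {om : FormField I X k} (h : IsSmoothForm om)
    {ψ : V' → X} {y : V'} (hψ : ContMDiffAt 𝓘(ℝ, V') I ∞ ψ y) :
    extDeriv (formPull ψ om) y = formPull ψ (extD om) y := by
  have hx := mem_extChartAt_source (I := I) (ψ y)
  have hc := contDiffAt_extChartAt_comp hψ hx
  have hd : DifferentiableAt ℝ (chartRep om (ψ y)) ((extChartAt I (ψ y) ∘ ψ) y) :=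
    (h.contDiffAt_chartRep (mem_extChartAt_target (ψ y))).differentiableAt (by simp)
  rw [(formPull_eventuallyEq om hψ hx).extDeriv_eq, extDeriv_pullback hd hc two_le_infty, formPull,
    extD_at]
  have := modelDeriv_comp (I := 𝓘(ℝ, V')) (I'' := 𝓘(ℝ, V)) (mdifferentiableAt_extChartAt' hx)
    (hψ.mdifferentiableAt (by simp))
  rw [modelDeriv_eq_fderiv, modelDeriv_extChartAt_self, ContinuousLinearMap.id_comp] at this
  rw [this]
  rfl

theorem extDeriv_chartRep {om : FormField I X k} (h : IsSmoothForm om) {x : X} {y : V}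
    (hy : y ∈ (extChartAt I x).target) :
    extDeriv (chartRep om x) y = chartRep (extD om) x y :=
  extDeriv_formPull h (contMDiffAt_extChartAt_symm hy)

theorem contDiffAt_extDeriv {θ : V → V [⋀^Fin k]→L[ℝ] ℝ} {y : V} (h : ContDiffAt ℝ ∞ θ y) :
    ContDiffAt ℝ ∞ (extDeriv θ) y :=
  ContDiffAt.comp (g := ContinuousAlternatingMap.alternatizeUncurryFinCLM ℝ V ℝ) y
    (ContinuousLinearMap.contDiff _).contDiffAt (h.fderiv_right (m := ∞) (by simp))

theorem IsSmoothForm.extD {om : FormField I X k} (h : IsSmoothForm om) :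
    IsSmoothForm (extD om) := by
  intro x y hy
  refine ContDiffAt.contDiffWithinAt ?_
  refine (contDiffAt_extDeriv (h.contDiffAt_chartRep hy)).congr_of_eventuallyEq ?_
  filter_upwards [mem_extChartAt_target_nhds hy] with z hz using (extDeriv_chartRep h hz).symm

theorem extDeriv_extDeriv_chartRep {om : FormField I X k} (h : IsSmoothForm om) {x : X} {y : V}
    (hy : y ∈ (extChartAt I x).target) :
    _root_.extDeriv (_root_.extDeriv (chartRep om x)) y = 0 :=
  extDeriv_extDeriv_apply (h.contDiffAt_chartRep hy) two_le_infty

end FormPull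

end ModelDeriv

/-! ## Submersions -/

section Straightening

variable {H H' : Type*} [NormedAddCommGroup H] [NormedSpace ℝ H] [CompleteSpace H]
  [NormedAddCommGroup H'] [NormedSpace ℝ H']

/-- Local normal form of a submersion between vector spaces: after a local change of coordinates
`ψ` which is tangent to the identity, the map is affine. -/
theorem exists_straightening {h : H → H'} {U : Set H} (hU : IsOpen U) {y₀ : H} (hy₀ : y₀ ∈ U)
    (hh : ContDiffOn ℝ ∞ h U) {L : H →L[ℝ] H'} {R : H' →L[ℝ] H} (hL : HasFDerivAt h L y₀)
    (hR : L.comp R = ContinuousLinearMap.id ℝ H') :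
    ∃ (ψ : H → H) (δ : ℝ), 0 < δ ∧ ψ 0 = y₀ ∧
      (∀ u ∈ Metric.ball (0 : H) δ, ψ u ∈ U ∧ ContDiffAt ℝ ∞ ψ u ∧ h (ψ u) = h y₀ + L u) ∧
      HasFDerivAt ψ (ContinuousLinearMap.id ℝ H) 0 ∧
      ∀ᶠ y in 𝓝 y₀, ∃ u ∈ Metric.ball (0 : H) δ, ψ u = y := by
  -- This satisfies L ∘ Θ = h and has derivative the identity at y₀; ψ is its local inverse,
  -- translated so that 0 goes to y₀.
  set Θ : H → H := fun y => y - R (L y) + R (h y) with hΘ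
  have hΘs : ∀ y ∈ U, ContDiffAt ℝ ∞ Θ y := by
    intro y hy
    have h1 : ContDiffAt ℝ ∞ h y := hh.contDiffAt (hU.mem_nhds hy)
    exact (contDiffAt_id.sub ((R.comp L).contDiff.contDiffAt)).add
      (R.contDiff.contDiffAt.comp y h1)
  have hLR : ∀ z, L (R z) = z := fun z => congrArg (fun T => T z) hR
  have hLΘ : ∀ y, L (Θ y) = h y := fun y => by simp [hΘ, hLR]
  have hd0 : HasFDerivAt Θ ((ContinuousLinearEquiv.refl ℝ H : H ≃L[ℝ] H) : H →L[ℝ] H) y₀ := by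
    have := ((hasFDerivAt_id y₀).sub (R.comp L).hasFDerivAt).add (R.hasFDerivAt.comp y₀ hL)
    convert! this using 1
    ext z
    simp
  set Φ := (hΘs y₀ hy₀).toOpenPartialHomeomorph Θ hd0 (by simp) with hΦ
  have hΦc : ∀ y, Φ y = Θ y := fun y => rfl
  have hs0 : y₀ ∈ Φ.source := (hΘs y₀ hy₀).mem_toOpenPartialHomeomorph_source hd0 (by simp)
  -- On this neighborhood the derivative of Θ is invertible, so the local inverse is smooth at every
  -- nearby point and not only at the center.
  set G : Set H := U ∩ {y | fderiv ℝ Θ y ∈ range ((↑) : (H ≃L[ℝ] H) → H →L[ℝ] H)}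
  have hG : G ∈ 𝓝 y₀ := by
    refine inter_mem (hU.mem_nhds hy₀) ?_
    have hc : ContinuousAt (fderiv ℝ Θ) y₀ :=
      ((hΘs y₀ hy₀).fderiv_right (m := 0) (by simp)).continuousAt
    refine hc.preimage_mem_nhds ?_
    rw [hd0.fderiv]
    exact ContinuousLinearEquiv.nhds _
  have ht0 : Φ y₀ ∈ Φ.target := Φ.map_source hs0
  have hT : ∀ᶠ u in 𝓝 (0 : H), Φ y₀ + u ∈ Φ.target ∧ Φ.symm (Φ y₀ + u) ∈ G := by
    have hc : Tendsto (fun u : H => Φ y₀ + u) (𝓝 0) (𝓝 (Φ y₀)) := by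
      have : Continuous fun u : H => Φ y₀ + u := by fun_prop
      simpa using this.tendsto 0
    refine (hc.eventually (Φ.open_target.mem_nhds ht0)).and ?_
    refine hc.eventually ((Φ.continuousAt_symm ht0).preimage_mem_nhds ?_)
    rwa [Φ.left_inv hs0]
  obtain ⟨δ, hδ, hball⟩ := Metric.eventually_nhds_iff_ball.1 hT
  have hdsymm : ∀ u ∈ Metric.ball (0 : H) δ, ContDiffAt ℝ ∞ Φ.symm (Φ y₀ + u) := by
    intro u hu
    obtain ⟨h1, h2, e, he⟩ := hball u hu
    refine Φ.contDiffAt_symm (f₀' := e) h1 ?_ (hΘs _ h2)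
    rw [he]
    exact ((hΘs _ h2).differentiableAt (by simp)).hasFDerivAt
  refine ⟨fun u => Φ.symm (Φ y₀ + u), δ, hδ, by simp [Φ.left_inv hs0], fun u hu => ?_, ?_, ?_⟩
  · obtain ⟨h1, h2, -⟩ := hball u hu
    refine ⟨h2, ?_, ?_⟩
    · exact (hdsymm u hu).comp u (contDiffAt_const.add contDiffAt_id)
    · have := hLΘ (Φ.symm (Φ y₀ + u))
      rw [← hΦc, Φ.right_inv h1, map_add, hΦc, hLΘ] at this
      exact this.symm
  · have h1 : HasFDerivAt Φ.symm (((ContinuousLinearEquiv.refl ℝ H).symm : H ≃L[ℝ] H) : H →L[ℝ] H)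
        (Φ y₀) := by
      refine Φ.hasFDerivAt_symm ht0 ?_
      rw [Φ.left_inv hs0]
      exact hd0
    have h2 : HasFDerivAt (fun u : H => Φ y₀ + u) (ContinuousLinearMap.id ℝ H) 0 :=
      (hasFDerivAt_id _).const_add _
    have h3 := HasFDerivAt.comp (0 : H) (g := Φ.symm) (f := fun u : H => Φ y₀ + u)
      (by simpa using h1) h2
    exact h3
  · have hc : Tendsto (fun y => Φ y - Φ y₀) (𝓝 y₀) (𝓝 0) := by
      have h1 : ContinuousAt (fun y => Φ y - Φ y₀) y₀ := (Φ.continuousAt hs0).sub continuousAt_const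
      have h2 := h1.tendsto
      rwa [sub_self] at h2
    filter_upwards [hc.eventually (Metric.ball_mem_nhds 0 hδ), Φ.open_source.mem_nhds hs0]
      with y hy hys
    exact ⟨Φ y - Φ y₀, hy, by simp [Φ.left_inv hys]⟩

end Straightening

section Submersion

variable {V : Type*} [NormedAddCommGroup V] [NormedSpace ℝ V] [CompleteSpace V]
  {H : Type*} [TopologicalSpace H] {I : ModelWithCorners ℝ V H} [I.Boundaryless]
  {X : Type*} [TopologicalSpace X] [ChartedSpace H X] [IsManifold I ∞ X]
  {V' : Type*} [NormedAddCommGroup V'] [NormedSpace ℝ V']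
  {H' : Type*} [TopologicalSpace H'] {I' : ModelWithCorners ℝ V' H'} [I'.Boundaryless]
  {X' : Type*} [TopologicalSpace X'] [ChartedSpace H' X'] [IsManifold I' ∞ X']

/-- Local normal form of a submersion of manifolds. -/
theorem exists_submersion_chart {f : X → X'} (hf : ContMDiff I I' ∞ f) (x₀ : X)
    {R : V' →L[ℝ] V}
    (hR : (modelDeriv I I' f x₀).comp R = ContinuousLinearMap.id ℝ V') :
    ∃ (ψ : V → X) (δ : ℝ), 0 < δ ∧ ψ 0 = x₀ ∧
      (∀ u ∈ Metric.ball (0 : V) δ, ContMDiffAt 𝓘(ℝ, V) I ∞ ψ u ∧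
        extChartAt I' (f x₀) (f x₀) + modelDeriv I I' f x₀ u ∈ (extChartAt I' (f x₀)).target ∧
        f (ψ u) = (extChartAt I' (f x₀)).symm
          (extChartAt I' (f x₀) (f x₀) + modelDeriv I I' f x₀ u)) ∧
      modelDeriv 𝓘(ℝ, V) I ψ 0 = ContinuousLinearMap.id ℝ V ∧
      ∀ᶠ x in 𝓝 x₀, ∃ u ∈ Metric.ball (0 : V) δ, ψ u = x := by
  set φ := extChartAt I x₀ with hφ
  set φ' := extChartAt I' (f x₀) with hφ'
  have hUo : IsOpen (φ.target ∩ φ.symm ⁻¹' (f ⁻¹' φ'.source)) :=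
    (continuousOn_extChartAt_symm x₀).isOpen_inter_preimage (isOpen_extChartAt_target x₀)
      ((isOpen_extChartAt_source (f x₀)).preimage hf.continuous)
  set U := φ.target ∩ φ.symm ⁻¹' (f ⁻¹' φ'.source) with hU
  have hy₀ : φ x₀ ∈ U := ⟨mem_extChartAt_target x₀, by
    change f (φ.symm (φ x₀)) ∈ φ'.source
    rw [hφ, extChartAt_to_inv]
    exact mem_extChartAt_source _⟩
  set h : V → V' := φ' ∘ f ∘ φ.symm with hh
  have hhs : ContDiffOn ℝ ∞ h U := by
    intro y hy
    have h1 : ContMDiffAt 𝓘(ℝ, V) I' ∞ (f ∘ φ.symm) y :=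
      hf.contMDiffAt.comp y (contMDiffAt_extChartAt_symm hy.1)
    exact (contDiffAt_extChartAt_comp h1 hy.2).contDiffWithinAt
  have hL : HasFDerivAt h (modelDeriv I I' f x₀) (φ x₀) := by
    rw [modelDeriv_eq_fderiv_written (hf.mdifferentiableAt (by simp))]
    exact ((hhs.contDiffAt (hUo.mem_nhds hy₀)).differentiableAt (by simp)).hasFDerivAt
  obtain ⟨ψ, δ, hδ, h0, hb, hd, hn⟩ := exists_straightening hUo hy₀ hhs hL hR
  have hsm : ∀ u ∈ Metric.ball (0 : V) δ, ContMDiffAt 𝓘(ℝ, V) I ∞ (φ.symm ∘ ψ) u := fun u hu =>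
    (contMDiffAt_extChartAt_symm (hb u hu).1.1).comp u (hb u hu).2.1.contMDiffAt
  have hh0 : h (φ x₀) = φ' (f x₀) := by
    simp only [hh, comp_apply, hφ, extChartAt_to_inv]
  refine ⟨φ.symm ∘ ψ, δ, hδ, ?_, fun u hu => ?_, ?_, ?_⟩
  · rw [comp_apply, h0, hφ, extChartAt_to_inv]
  · obtain ⟨h1, h2, h3⟩ := hb u hu
    rw [hh0] at h3
    refine ⟨hsm u hu, ?_, ?_⟩
    · rw [← h3]
      exact φ'.map_source h1.2
    · rw [← h3]
      exact (φ'.left_inv h1.2).symm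
  · have hm : MDifferentiableAt 𝓘(ℝ, V) I φ.symm (ψ 0) :=
      mdifferentiableAt_extChartAt_symm (by rw [h0]; exact mem_extChartAt_target x₀)
    rw [modelDeriv_comp (I' := 𝓘(ℝ, V)) hm hd.differentiableAt.mdifferentiableAt,
      modelDeriv_eq_fderiv, hd.fderiv, h0, hφ, modelDeriv_extChartAt_symm_self]
    rfl
  · have hc := (continuousAt_extChartAt (I := I) x₀).eventually hn
    filter_upwards [hc, extChartAt_source_mem_nhds (I := I) x₀] with x ⟨u, hu, hux⟩ hxs
    exact ⟨u, hu, by rw [comp_apply, hux]; exact φ.left_inv hxs⟩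

theorem exists_rightInverse_of_surjective [FiniteDimensional ℝ V'] {L : V →L[ℝ] V'}
    (hL : Surjective L) : ∃ R : V' →L[ℝ] V, L.comp R = ContinuousLinearMap.id ℝ V' := by
  obtain ⟨g, hg⟩ := L.toLinearMap.exists_rightInverse_of_surjective (LinearMap.range_eq_top.2 hL)
  refine ⟨LinearMap.toContinuousLinearMap g, ?_⟩
  ext z
  exact congrArg (fun T => T z) hg

/-- A submersion has local sections through every point. -/
theorem exists_local_section [FiniteDimensional ℝ V'] {f : X → X'} (hf : ContMDiff I I' ∞ f)
    (x₀ : X) (hs : Surjective (modelDeriv I I' f x₀)) :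
    ∃ (σ : X' → X), σ (f x₀) = x₀ ∧
      ∀ᶠ b in 𝓝 (f x₀), ContMDiffAt I' I ∞ σ b ∧ f (σ b) = b := by
  obtain ⟨R, hR⟩ := exists_rightInverse_of_surjective hs
  obtain ⟨ψ, δ, hδ, h0, hb, -, -⟩ := exists_submersion_chart hf x₀ hR
  have hLR : ∀ z, modelDeriv I I' f x₀ (R z) = z := fun z => congrArg (fun T => T z) hR
  set φ' := extChartAt I' (f x₀) with hφ'
  -- In the normal form `f` is affine with linear part L, so a linear right inverse of L gives a
  -- section.
  refine ⟨fun b => ψ (R (φ' b - φ' (f x₀))), by simp [h0], ?_⟩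
  have hc : Tendsto (fun b => R (φ' b - φ' (f x₀))) (𝓝 (f x₀)) (𝓝 0) := by
    have h1 : ContinuousAt (fun b => R (φ' b - φ' (f x₀))) (f x₀) :=
      R.continuous.continuousAt.comp
        ((continuousAt_extChartAt (I := I') (f x₀)).sub continuousAt_const)
    have h2 := h1.tendsto
    rwa [sub_self, map_zero] at h2
  filter_upwards [hc.eventually (Metric.ball_mem_nhds 0 hδ),
    extChartAt_source_mem_nhds (I := I') (f x₀)] with b hb1 hb2
  obtain ⟨h1, h2, h3⟩ := hb _ hb1
  refine ⟨?_, ?_⟩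
  · refine ContMDiffAt.comp (g := ψ) (f := fun b => R (φ' b - φ' (f x₀))) (I' := 𝓘(ℝ, V)) b h1 ?_
    refine R.contDiff.contMDiff.contMDiffAt.comp b (ContMDiffAt.sub ?_ contMDiffAt_const)
    exact contMDiffAt_extChartAt' (by rwa [extChartAt_source] at hb2)
  · rw [h3, hLR, add_sub_cancel]
    exact φ'.left_inv hb2

/-- Every vector tangent to a fiber of a submersion is the velocity of a smooth curve in it. -/
theorem exists_curve_in_fiber [FiniteDimensional ℝ V'] {f : X → X'} (hf : ContMDiff I I' ∞ f)
    (x₀ : X) (hs : Surjective (modelDeriv I I' f x₀)) {v : V} (hv : modelDeriv I I' f x₀ v = 0) :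
    ∃ γ : ℝ → X, ContMDiff 𝓘(ℝ, ℝ) I ∞ γ ∧ γ 0 = x₀ ∧ (∀ t, f (γ t) = f x₀) ∧
      modelDeriv 𝓘(ℝ, ℝ) I γ 0 1 = v := by
  obtain ⟨R, hR⟩ := exists_rightInverse_of_surjective hs
  obtain ⟨ψ, δ, hδ, h0, hb, hd, -⟩ := exists_submersion_chart hf x₀ hR
  -- The sine keeps the curve in the ball of radius δ for all real times, since r‖v‖ < δ, while its
  -- velocity at 0 is v.
  set r : ℝ := δ / (‖v‖ + 1) with hr
  have hr0 : 0 < r := by positivity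
  set c : ℝ → V := fun t => (r * Real.sin (t / r)) • v with hc
  have hcb : ∀ t, c t ∈ Metric.ball (0 : V) δ := by
    intro t
    rw [mem_ball_zero_iff, hc, norm_smul, Real.norm_eq_abs, abs_mul, abs_of_pos hr0]
    calc r * |Real.sin (t / r)| * ‖v‖ ≤ r * 1 * ‖v‖ := by
          gcongr; exact Real.abs_sin_le_one _
      _ < r * (‖v‖ + 1) := by nlinarith
      _ = δ := by rw [hr]; field_simp
  have hcs : ContDiff ℝ ∞ c :=
    (contDiff_const.mul (Real.contDiff_sin.comp (contDiff_id.div_const r))).smul contDiff_const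
  have hc0 : c 0 = 0 := by simp [hc]
  have hcd : HasFDerivAt c (ContinuousLinearMap.toSpanSingleton ℝ v) 0 := by
    have h1 : HasDerivAt (fun t : ℝ => r * Real.sin (t / r)) 1 0 := by
      have := ((Real.hasDerivAt_sin (0 / r)).comp (0 : ℝ)
        ((hasDerivAt_id (0 : ℝ)).div_const r)).const_mul r
      convert! this using 1
      simp [hr0.ne']
    have := (h1.smul_const v).hasFDerivAt
    simpa using this
  refine ⟨ψ ∘ c, fun t => ?_, by simp [hc0, h0], fun t => ?_, ?_⟩
  · exact (hb _ (hcb t)).1.comp t hcs.contMDiff.contMDiffAt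
  · rw [comp_apply, (hb _ (hcb t)).2.2, hc, map_smul, hv, smul_zero, add_zero]
    exact extChartAt_to_inv _
  · have h1 : MDifferentiableAt 𝓘(ℝ, V) I ψ (c 0) := by
      rw [hc0]; exact (hb 0 (Metric.mem_ball_self hδ)).1.mdifferentiableAt (by simp)
    rw [modelDeriv_comp (I' := 𝓘(ℝ, V)) h1 hcd.differentiableAt.mdifferentiableAt,
      modelDeriv_eq_fderiv, hcd.fderiv, hc0, hd]
    simp

end Submersion

/-! ### Smooth right inverses of families of linear maps. -/

section RightInverse

variable {V : Type*} [NormedAddCommGroup V] [NormedSpace ℝ V]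
  {H : Type*} [TopologicalSpace H] {I : ModelWithCorners ℝ V H}
  {X : Type*} [TopologicalSpace X] [ChartedSpace H X]
  {F G : Type*} [NormedAddCommGroup F] [NormedSpace ℝ F] [NormedAddCommGroup G] [NormedSpace ℝ G]
  [FiniteDimensional ℝ G]

/-- A smooth family of linear maps has a smooth family of right inverses near a point where it is
surjective. -/
theorem exists_smooth_rightInverse {A : X → F →L[ℝ] G} {x₀ : X}
    (hA : ∀ᶠ x in 𝓝 x₀, ContMDiffAt I 𝓘(ℝ, F →L[ℝ] G) ∞ A x) (hs : Surjective (A x₀)) :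
    ∃ R : X → G →L[ℝ] F, ∀ᶠ x in 𝓝 x₀, ContMDiffAt I 𝓘(ℝ, G →L[ℝ] F) ∞ R x ∧
      ∀ z, A x (R x z) = z := by
  have : CompleteSpace G := FiniteDimensional.complete ℝ G
  obtain ⟨g, hg⟩ :=
    (A x₀).toLinearMap.exists_rightInverse_of_surjective (LinearMap.range_eq_top.2 hs)
  set R₀ : G →L[ℝ] F := LinearMap.toContinuousLinearMap g
  have hR₀ : (A x₀).comp R₀ = 1 := by
    ext z
    exact congrArg (fun T => T z) hg
  have hc : ContinuousAt (fun x => (A x).comp R₀) x₀ :=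
    (hA.self_of_nhds.continuousAt).clm_comp continuousAt_const
  have hu : ∀ᶠ x in 𝓝 x₀, IsUnit ((A x).comp R₀) := by
    have : {T : G →L[ℝ] G | IsUnit T} ∈ 𝓝 ((A x₀).comp R₀) := by
      rw [hR₀]; exact Units.isOpen.mem_nhds isUnit_one
    exact hc.eventually this
  -- With R₀ a right inverse at x₀, A R₀ is the identity there and hence invertible nearby; R₀ (A
  -- R₀)⁻¹ is the corrected right inverse, and inversion is smooth at units.
  refine ⟨fun x => R₀.comp (Ring.inverse ((A x).comp R₀)), ?_⟩
  filter_upwards [hA, hu] with x hx ⟨T, hT⟩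
  refine ⟨?_, fun z => ?_⟩
  · have h1 : ContMDiffAt I 𝓘(ℝ, G →L[ℝ] G) ∞ (fun x => (A x).comp R₀) x :=
      hx.clm_comp contMDiffAt_const
    have h2 : ContDiffAt ℝ ∞ (Ring.inverse : (G →L[ℝ] G) → _) ((A x).comp R₀) := by
      rw [← hT]; exact contDiffAt_ringInverse ℝ T
    exact contMDiffAt_const.clm_comp (h2.contMDiffAt.comp x h1)
  · have h1 : (A x).comp R₀ * Ring.inverse ((A x).comp R₀) = 1 :=
      Ring.mul_inverse_cancel _ ⟨T, hT⟩
    exact congrArg (fun T => T z) h1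

end RightInverse

/-! ## Local coordinates of a vector bundle -/

section BundleCoord

variable {n : ℕ} {M : Type u} [TopologicalSpace M] [ChartedSpace (EuclideanSpace ℝ (Fin n)) M]
  {F : Type w} [NormedAddCommGroup F] [NormedSpace ℝ F]
  {E : M → Type v} [∀ x, AddCommGroup (E x)] [∀ x, Module ℝ (E x)]
  [∀ x, TopologicalSpace (E x)] [TopologicalSpace (TotalSpace F E)]
  [FiberBundle F E] [VectorBundle ℝ F E]

variable (F) in
/-- The domain of the preferred trivialization at `x₀`. -/
def bundleDom (E : M → Type v) [∀ x, TopologicalSpace (E x)] [TopologicalSpace (TotalSpace F E)]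
    [FiberBundle F E] (x₀ : M) : Set M := (trivializationAt F E x₀).baseSet

variable (F) in
/-- The fiber coordinates given by the preferred trivialization at `x₀`. -/
def fibCoord (x₀ x : M) : E x →ₗ[ℝ] F := (trivializationAt F E x₀).linearMapAt ℝ x

variable (E) in
/-- The vector of `E x` with given fiber coordinates. -/
def fibVec (x₀ x : M) : F →ₗ[ℝ] E x := (trivializationAt F E x₀).symmₗ ℝ x

theorem isOpen_bundleDom (x₀ : M) : IsOpen (bundleDom F E x₀) :=
  (trivializationAt F E x₀).open_baseSet

theorem mem_bundleDom (x₀ : M) : x₀ ∈ bundleDom F E x₀ :=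
  FiberBundle.mem_baseSet_trivializationAt F E x₀

theorem bundleDom_mem_nhds (x₀ : M) : bundleDom F E x₀ ∈ 𝓝 x₀ :=
  (isOpen_bundleDom x₀).mem_nhds (mem_bundleDom x₀)

theorem fibCoord_eq {x₀ x : M} (hx : x ∈ bundleDom F E x₀) (e : E x) :
    fibCoord F x₀ x e = (trivializationAt F E x₀ ⟨x, e⟩).2 := by
  rw [fibCoord, Trivialization.coe_linearMapAt_of_mem _ hx]

theorem fibVec_eq {x₀ x : M} (hx : x ∈ bundleDom F E x₀) (f : F) :
    fibVec E x₀ x f = (trivializationAt F E x₀).symm x f :=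
  congrFun (Trivialization.coe_symmₗ _ hx) f

theorem fibVec_fibCoord {x₀ x : M} (hx : x ∈ bundleDom F E x₀) (e : E x) :
    fibVec E x₀ x (fibCoord F x₀ x e) = e := by
  rw [fibCoord_eq hx, fibVec_eq hx, Trivialization.symm_apply_apply_mk _ hx]

theorem fibCoord_fibVec {x₀ x : M} (hx : x ∈ bundleDom F E x₀) (f : F) :
    fibCoord F x₀ x (fibVec E x₀ x f) = f := by
  rw [fibCoord_eq hx, fibVec_eq hx]
  exact congrArg Prod.snd (Trivialization.apply_mk_symm _ hx f)

/-- The domain of the preferred bundle chart at `x₀`, in the base. -/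
def baseDom (F : Type w) [NormedAddCommGroup F] [NormedSpace ℝ F] (E : M → Type v)
    [∀ x, TopologicalSpace (E x)] [TopologicalSpace (TotalSpace F E)]
    [FiberBundle F E] (x₀ : M) : Set (EuclideanSpace ℝ (Fin n)) :=
  (extChartAt (𝓡 n) x₀).target ∩ (extChartAt (𝓡 n) x₀).symm ⁻¹' bundleDom F E x₀

theorem isOpen_baseDom (x₀ : M) : IsOpen (baseDom (n := n) F E x₀) :=
  (continuousOn_extChartAt_symm x₀).isOpen_inter_preimage (isOpen_extChartAt_target x₀)
    (isOpen_bundleDom x₀)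

theorem mem_baseDom (x₀ : M) : extChartAt (𝓡 n) x₀ x₀ ∈ baseDom (n := n) F E x₀ :=
  ⟨mem_extChartAt_target x₀, by
    rw [mem_preimage, extChartAt_to_inv]; exact mem_bundleDom x₀⟩

theorem extChartAt_totalSpace_target (e : TotalSpace F E) :
    (extChartAt ((𝓡 n).prod 𝓘(ℝ, F)) e).target = baseDom F E e.proj ×ˢ univ :=
  FiberBundle.extChartAt_target e

theorem extChartAt_totalSpace (e : TotalSpace F E) {e' : TotalSpace F E}
    (h : e'.proj ∈ bundleDom F E e.proj) :
    extChartAt ((𝓡 n).prod 𝓘(ℝ, F)) e e' =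
      (extChartAt (𝓡 n) e.proj e'.proj, fibCoord F e.proj e'.proj e'.2) := by
  rw [FiberBundle.extChartAt, fibCoord_eq h]
  have := (trivializationAt F E e.proj).coe_fst' h
  exact Prod.ext (congrArg (extChartAt (𝓡 n) e.proj) this) rfl

theorem extChartAt_totalSpace_symm (e : TotalSpace F E) {y : EuclideanSpace ℝ (Fin n)}
    (hy : y ∈ baseDom F E e.proj) (f : F) :
    (extChartAt ((𝓡 n).prod 𝓘(ℝ, F)) e).symm (y, f) =
      ⟨(extChartAt (𝓡 n) e.proj).symm y, fibVec E e.proj _ f⟩ := by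
  rw [FiberBundle.extChartAt, fibVec_eq hy.2, Trivialization.mk_symm _ hy.2]
  rfl

theorem extChartAt_totalSpace_self (x₀ : M) (a : E x₀) :
    extChartAt ((𝓡 n).prod 𝓘(ℝ, F)) (⟨x₀, a⟩ : TotalSpace F E) ⟨x₀, a⟩ =
      (extChartAt (𝓡 n) x₀ x₀, fibCoord F x₀ x₀ a) :=
  extChartAt_totalSpace _ (mem_bundleDom x₀)

theorem extChartAt_totalSpace_congr {e e' : TotalSpace F E} (h : e.proj = e'.proj) :
    extChartAt ((𝓡 n).prod 𝓘(ℝ, F)) e = extChartAt ((𝓡 n).prod 𝓘(ℝ, F)) e' := by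
  rw [FiberBundle.extChartAt, FiberBundle.extChartAt, h]

variable {k : ℕ}

/-- The expression of a form on the total space in the bundle chart at `x₀`. -/
def bundleRep (om : FormField ((𝓡 n).prod 𝓘(ℝ, F)) (TotalSpace F E) k) (x₀ : M) :
    EuclideanSpace ℝ (Fin n) × F → (EuclideanSpace ℝ (Fin n) × F) [⋀^Fin k]→L[ℝ] ℝ :=
  chartRep om (zeroSection F E x₀)

/-- The preferred chart at a point of E depends only on its base point, so charts centered on the
zero section are enough. -/
theorem chartRep_eq_bundleRep (om : FormField ((𝓡 n).prod 𝓘(ℝ, F)) (TotalSpace F E) k)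
    (e : TotalSpace F E) : chartRep om e = bundleRep om e.proj := by
  rw [bundleRep, chartRep_eq_formPull, chartRep_eq_formPull,
    extChartAt_totalSpace_congr (e := e) (e' := zeroSection F E e.proj) rfl]

theorem mem_target_zeroSection {x₀ : M} {y : EuclideanSpace ℝ (Fin n)} (hy : y ∈ baseDom F E x₀)
    (f : F) : (y, f) ∈ (extChartAt ((𝓡 n).prod 𝓘(ℝ, F)) (zeroSection F E x₀)).target := by
  rw [extChartAt_totalSpace_target]
  exact ⟨hy, trivial⟩

variable [IsManifold (𝓡 n) ∞ M] [ContMDiffVectorBundle ∞ F E (𝓡 n)]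

theorem FormField.at_eq_bundleRep (om : FormField ((𝓡 n).prod 𝓘(ℝ, F)) (TotalSpace F E) k) (x₀ : M)
    (a : E x₀) : om.at ⟨x₀, a⟩ = bundleRep om x₀ (extChartAt (𝓡 n) x₀ x₀, fibCoord F x₀ x₀ a) := by
  rw [← chartRep_self, chartRep_eq_bundleRep, extChartAt_totalSpace_self]

/-- Fiberwise multiplication by `c`. -/
theorem contMDiff_fiberwise_smul (c : ℝ) :
    ContMDiff ((𝓡 n).prod 𝓘(ℝ, F)) ((𝓡 n).prod 𝓘(ℝ, F)) ∞
      (fun e : TotalSpace F E => (⟨e.proj, c • e.2⟩ : TotalSpace F E)) := by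
  intro e
  rw [contMDiffAt_totalSpace]
  refine ⟨contMDiffAt_proj E, ?_⟩
  have h0 : ContMDiffAt ((𝓡 n).prod 𝓘(ℝ, F)) ((𝓡 n).prod 𝓘(ℝ, F)) ∞
    (fun e : TotalSpace F E => e) e := contMDiffAt_id
  have h1 := contMDiffAt_totalSpace.1 h0
  refine ContMDiffAt.congr_of_eventuallyEq
    (((contDiff_const_smul c).contMDiff (f := fun f : F => c • f)).contMDiffAt.comp e h1.2) ?_
  have : ∀ᶠ e' : TotalSpace F E in 𝓝 e, e'.proj ∈ bundleDom F E e.proj :=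
    (FiberBundle.continuous_proj F E).continuousAt.preimage_mem_nhds (bundleDom_mem_nhds e.proj)
  filter_upwards [this] with e' he'
  change (trivializationAt F E e.proj ⟨e'.proj, c • e'.2⟩).2 =
    c • (trivializationAt F E e.proj ⟨e'.proj, e'.2⟩).2
  rw [← fibCoord_eq he', ← fibCoord_eq he', map_smul]

/-- Fiberwise multiplication by c reads (y, f) ↦ (y, c f) in a bundle chart, so the global linearity
condition becomes the local one. -/
theorem IsLinearForm.isFiberHom {om : FormField ((𝓡 n).prod 𝓘(ℝ, F)) (TotalSpace F E) k}
    (h : IsLinearForm om) {x₀ : M} {y : EuclideanSpace ℝ (Fin n)} (hy : y ∈ baseDom F E x₀) :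
    IsFiberHom (bundleRep om x₀) y := by
  intro c f
  set Ψ := (extChartAt ((𝓡 n).prod 𝓘(ℝ, F)) (zeroSection F E x₀)).symm with hΨ
  set hc := fun e : TotalSpace F E => (⟨e.proj, c • e.2⟩ : TotalSpace F E)
  set L : (EuclideanSpace ℝ (Fin n) × F) →L[ℝ] EuclideanSpace ℝ (Fin n) × F :=
    (ContinuousLinearMap.id ℝ _).prodMap (c • ContinuousLinearMap.id ℝ F) with hL
  have hd : ∀ f, MDifferentiableAt 𝓘(ℝ, EuclideanSpace ℝ (Fin n) × F) ((𝓡 n).prod 𝓘(ℝ, F)) Ψ (y, f) := fun f =>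
    mdifferentiableAt_extChartAt_symm (mem_target_zeroSection hy f)
  have h1 : (pullbackForm (I := (𝓡 n).prod 𝓘(ℝ, F)) hc om : FormField ((𝓡 n).prod 𝓘(ℝ, F)) (TotalSpace F E) k) = fun e => c • om e :=
    funext (h c)
  have h2 := formPull_pullbackForm (I := (𝓡 n).prod 𝓘(ℝ, F)) (f := hc) om
    ((contMDiff_fiberwise_smul c).contMDiffAt.mdifferentiableAt (by simp)) (hd f)
  have h3 : hc ∘ Ψ =ᶠ[𝓝 (y, f)] Ψ ∘ L := by
    have : ∀ᶠ x : EuclideanSpace ℝ (Fin n) × F in 𝓝 (y, f), x.1 ∈ baseDom F E x₀ :=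
      continuous_fst.continuousAt.preimage_mem_nhds ((isOpen_baseDom x₀).mem_nhds hy)
    filter_upwards [this] with x hx
    have e1 := extChartAt_totalSpace_symm (zeroSection F E x₀) hx x.2
    have e2 := extChartAt_totalSpace_symm (zeroSection F E x₀) hx (c • x.2)
    change hc (Ψ (x.1, x.2)) = Ψ (x.1, c • x.2)
    rw [hΨ, e1, e2, map_smul]
  rw [formPull_congr om h3, formPull_comp (g := L) om (hd (c • f)) L.differentiableAt, L.fderiv,
    h1] at h2
  exact h2.symm

theorem differentiableAt_bundleRep {om : FormField ((𝓡 n).prod 𝓘(ℝ, F)) (TotalSpace F E) k}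
    (h : IsSmoothForm om) {x₀ : M} {y : EuclideanSpace ℝ (Fin n)} (hy : y ∈ baseDom F E x₀) (f : F) :
    DifferentiableAt ℝ (bundleRep om x₀) (y, f) :=
  (h.contDiffAt_chartRep (mem_target_zeroSection hy f)).differentiableAt (by simp)

theorem extDeriv_bundleRep {om : FormField ((𝓡 n).prod 𝓘(ℝ, F)) (TotalSpace F E) k}
    (h : IsSmoothForm om) {x₀ : M} {y : EuclideanSpace ℝ (Fin n)} (hy : y ∈ baseDom F E x₀) (f : F) :
    extDeriv (bundleRep om x₀) (y, f) = bundleRep (extD om) x₀ (y, f) :=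
  extDeriv_chartRep h (mem_target_zeroSection hy f)

/-- In bundle charts, the expression of the form is fiberwise homogeneous. -/
def IsLocallyLinear (om : FormField ((𝓡 n).prod 𝓘(ℝ, F)) (TotalSpace F E) k) : Prop :=
  ∀ x₀ : M, ∀ y ∈ baseDom F E x₀, IsFiberHom (bundleRep om x₀) y

theorem IsLocallyLinear.extD {om : FormField ((𝓡 n).prod 𝓘(ℝ, F)) (TotalSpace F E) k}
    (hl : IsLocallyLinear om) (h : IsSmoothForm om) : IsLocallyLinear (extD om) := by
  intro x₀ y hy c f
  have h1 := IsFiberHom.extDeriv (isOpen_baseDom x₀) (hl x₀)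
    (fun y hy f => differentiableAt_bundleRep h hy f) hy c f
  rwa [extDeriv_bundleRep h hy, extDeriv_bundleRep h hy] at h1

theorem extD_extD {om : FormField ((𝓡 n).prod 𝓘(ℝ, F)) (TotalSpace F E) k}
    (h : IsSmoothForm om) : extD (_root_.extD om) = 0 := by
  funext e
  change (_root_.extD (_root_.extD om)).at e = 0
  have h1 : chartRep (_root_.extD om) e =ᶠ[𝓝 (extChartAt ((𝓡 n).prod 𝓘(ℝ, F)) e e)] extDeriv (chartRep om e) := by
    filter_upwards [mem_extChartAt_target_nhds (mem_extChartAt_target e)] with y hy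
    exact (extDeriv_chartRep h hy).symm
  rw [extD_at, h1.extDeriv_eq, extDeriv_extDeriv_chartRep h (mem_extChartAt_target e)]

/-- The map `zeroComponent` on model spaces. -/
def zeroComp (β : FormField ((𝓡 n).prod 𝓘(ℝ, F)) (TotalSpace F E) (k + 1)) (x : M) :
    E x →ₗ[ℝ] (EuclideanSpace ℝ (Fin n) [⋀^Fin k]→L[ℝ] ℝ) := zeroComponent β x

/-- The form `zeroComponent β e`, for a section `e`. -/
def zeroForm (β : FormField ((𝓡 n).prod 𝓘(ℝ, F)) (TotalSpace F E) (k + 1)) (e : ∀ x, E x) :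
    FormField (𝓡 n) M k := fun x => zeroComponent β x (e x)

theorem modelDeriv_symm_vertical {x₀ : M} {y : EuclideanSpace ℝ (Fin n)} (hy : y ∈ baseDom F E x₀)
    (f : F) :
    modelDeriv 𝓘(ℝ, EuclideanSpace ℝ (Fin n) × F) ((𝓡 n).prod 𝓘(ℝ, F))
      (extChartAt ((𝓡 n).prod 𝓘(ℝ, F)) (zeroSection F E x₀)).symm (y, 0) (0, f) =
    vertLift F ((extChartAt (𝓡 n) x₀).symm y) (fibVec E x₀ _ f) := by
  set J := (𝓡 n).prod 𝓘(ℝ, F)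
  set Ψ := (extChartAt J (zeroSection F E x₀)).symm with hΨ
  have h1 := vertLift_eq (n := n) (F := F) ((extChartAt (𝓡 n) x₀).symm y) (fibVec E x₀ _ f)
  refine Eq.trans ?_ h1.symm
  set g : ℝ → EuclideanSpace ℝ (Fin n) × F := fun t => (y, t • f) with hg
  have hgd : HasFDerivAt g ((0 : ℝ →L[ℝ] EuclideanSpace ℝ (Fin n)).prod
      (ContinuousLinearMap.toSpanSingleton ℝ f)) 0 :=
    (hasFDerivAt_const y (0 : ℝ)).prodMk (ContinuousLinearMap.toSpanSingleton ℝ f).hasFDerivAt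
  have h2 : (fun t : ℝ => (⟨_, t • fibVec E x₀ ((extChartAt (𝓡 n) x₀).symm y) f⟩ : TotalSpace F E))
      = Ψ ∘ g := by
    funext t
    have := extChartAt_totalSpace_symm (zeroSection F E x₀) hy (t • f)
    rw [map_smul] at this
    exact this.symm
  have h3 : MDifferentiableAt 𝓘(ℝ, EuclideanSpace ℝ (Fin n) × F) J Ψ (g 0) :=
    mdifferentiableAt_extChartAt_symm (mem_target_zeroSection hy _)
  rw [h2]
  have h4 := modelDeriv_comp (I := 𝓘(ℝ, ℝ)) h3 hgd.differentiableAt.mdifferentiableAt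
  change _ = modelDeriv 𝓘(ℝ, ℝ) J (Ψ ∘ g) 0 1
  rw [h4, modelDeriv_eq_fderiv, hgd.fderiv]
  simp [hg]

theorem modelDeriv_symm_horizontal {x₀ : M} {y : EuclideanSpace ℝ (Fin n)}
    (hy : y ∈ baseDom F E x₀) (w : EuclideanSpace ℝ (Fin n)) :
    modelDeriv 𝓘(ℝ, EuclideanSpace ℝ (Fin n) × F) ((𝓡 n).prod 𝓘(ℝ, F))
      (extChartAt ((𝓡 n).prod 𝓘(ℝ, F)) (zeroSection F E x₀)).symm (y, 0) (w, 0) =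
    zeroLift F E ((extChartAt (𝓡 n) x₀).symm y)
      (modelDeriv 𝓘(ℝ, EuclideanSpace ℝ (Fin n)) (𝓡 n) (extChartAt (𝓡 n) x₀).symm y w) := by
  set J := (𝓡 n).prod 𝓘(ℝ, F)
  set Ψ := (extChartAt J (zeroSection F E x₀)).symm with hΨ
  set g : EuclideanSpace ℝ (Fin n) → EuclideanSpace ℝ (Fin n) × F := fun y => (y, 0) with hg
  have hgd : HasFDerivAt g ((ContinuousLinearMap.id ℝ _).prod 0) y :=
    (hasFDerivAt_id y).prodMk (hasFDerivAt_const (0 : F) y)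
  have h2 : zeroSection F E ∘ (extChartAt (𝓡 n) x₀).symm =ᶠ[𝓝 y] Ψ ∘ g := by
    filter_upwards [(isOpen_baseDom x₀).mem_nhds hy] with z hz
    have := extChartAt_totalSpace_symm (zeroSection F E x₀) hz 0
    rw [map_zero] at this
    exact this.symm
  have h3 : MDifferentiableAt 𝓘(ℝ, EuclideanSpace ℝ (Fin n) × F) J Ψ (g y) :=
    mdifferentiableAt_extChartAt_symm (mem_target_zeroSection hy _)
  have h4 := modelDeriv_comp (I := 𝓘(ℝ, _)) h3 hgd.differentiableAt.mdifferentiableAt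
  have h5 := modelDeriv_comp (I := 𝓘(ℝ, EuclideanSpace ℝ (Fin n))) (I' := 𝓡 n) (I'' := J)
    (f := (extChartAt (𝓡 n) x₀).symm) (g := zeroSection F E) (x := y)
    ((contMDiff_zeroSection ℝ E (n := ∞)).contMDiffAt.mdifferentiableAt (by simp))
    (mdifferentiableAt_extChartAt_symm hy.1)
  rw [modelDeriv_congr h2, h4, modelDeriv_eq_fderiv, hgd.fderiv] at h5
  exact (congrArg (fun L => L w) h5)

/-- The zero components in a bundle chart. -/
theorem zeroComp_comp_modelDeriv
    (β : FormField ((𝓡 n).prod 𝓘(ℝ, F)) (TotalSpace F E) (k + 1)) {x₀ : M}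
    {y : EuclideanSpace ℝ (Fin n)} (hy : y ∈ baseDom F E x₀) (f : F) :
    (zeroComp β ((extChartAt (𝓡 n) x₀).symm y) (fibVec E x₀ _ f)).compContinuousLinearMap
      (modelDeriv 𝓘(ℝ, EuclideanSpace ℝ (Fin n)) (𝓡 n) (extChartAt (𝓡 n) x₀).symm y) =
    vertComp (bundleRep β x₀ (y, 0)) f := by
  ext w
  have e0 := extChartAt_totalSpace_symm (zeroSection F E x₀) hy 0
  rw [map_zero] at e0
  rw [vertComp_apply, bundleRep, chartRep_eq_formPull, formPull, e0]
  change β.at _ (Matrix.vecCons _ _) = β.at _ _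
  congr 1
  funext i
  refine Fin.cases ?_ (fun i => ?_) i
  · exact (modelDeriv_symm_vertical hy f).symm
  · exact (modelDeriv_symm_horizontal hy (w i)).symm

theorem zeroComp_fibVec
    (β : FormField ((𝓡 n).prod 𝓘(ℝ, F)) (TotalSpace F E) (k + 1)) (x₀ : M) (f : F) :
    zeroComp β x₀ (fibVec E x₀ x₀ f) =
      vertComp (bundleRep β x₀ (extChartAt (𝓡 n) x₀ x₀, 0)) f := by
  have := zeroComp_comp_modelDeriv β (mem_baseDom x₀) f
  rw [modelDeriv_extChartAt_symm_self, extChartAt_to_inv] at this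
  exact this

theorem zeroComp_eq_vertComp
    (β : FormField ((𝓡 n).prod 𝓘(ℝ, F)) (TotalSpace F E) (k + 1)) (x₀ : M) (a : E x₀) :
    zeroComp β x₀ a =
      vertComp (bundleRep β x₀ (extChartAt (𝓡 n) x₀ x₀, 0)) (fibCoord F x₀ x₀ a) := by
  rw [← zeroComp_fibVec, fibVec_fibCoord (mem_bundleDom (F := F) x₀)]

/-- The local representative of a section. -/
def secRep (F : Type w) [NormedAddCommGroup F] [NormedSpace ℝ F] {E : M → Type v}
    [∀ x, AddCommGroup (E x)] [∀ x, Module ℝ (E x)] [∀ x, TopologicalSpace (E x)]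
    [TopologicalSpace (TotalSpace F E)] [FiberBundle F E] [VectorBundle ℝ F E] (e : ∀ x, E x)
    (x₀ : M) (y : EuclideanSpace ℝ (Fin n)) : F :=
  fibCoord F x₀ _ (e ((extChartAt (𝓡 n) x₀).symm y))

theorem secRep_self (e : ∀ x, E x) (x₀ : M) :
    secRep F e x₀ (extChartAt (𝓡 n) x₀ x₀) = fibCoord F x₀ x₀ (e x₀) := by
  simp only [secRep]
  rw [extChartAt_to_inv]

theorem chartRep_zeroForm
    (β : FormField ((𝓡 n).prod 𝓘(ℝ, F)) (TotalSpace F E) (k + 1)) (e : ∀ x, E x) {x₀ : M}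
    {y : EuclideanSpace ℝ (Fin n)} (hy : y ∈ baseDom F E x₀) :
    chartRep (zeroForm β e) x₀ y = vertComp (bundleRep β x₀ (y, 0)) (secRep F e x₀ y) := by
  rw [← zeroComp_comp_modelDeriv β hy, secRep, fibVec_fibCoord hy.2]
  rfl

theorem extD_zeroForm_at
    (β : FormField ((𝓡 n).prod 𝓘(ℝ, F)) (TotalSpace F E) (k + 1)) (e : ∀ x, E x) (x₀ : M) :
    (extD (zeroForm β e)).at x₀ = extDeriv
      (fun y => vertComp (bundleRep β x₀ (y, 0)) (secRep F e x₀ y)) (extChartAt (𝓡 n) x₀ x₀) := by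
  have : chartRep (zeroForm β e) x₀ =ᶠ[𝓝 (extChartAt (𝓡 n) x₀ x₀)]
      (fun y => vertComp (bundleRep β x₀ (y, 0)) (secRep F e x₀ y)) := by
    filter_upwards [(isOpen_baseDom (F := F) (E := E) x₀).mem_nhds (mem_baseDom x₀)] with y hy
    exact chartRep_zeroForm β e hy
  rw [extD_at, this.extDeriv_eq]

theorem contDiffAt_vertComp_bundleRep
    {β : FormField ((𝓡 n).prod 𝓘(ℝ, F)) (TotalSpace F E) (k + 1)} (h : IsSmoothForm β) {x₀ : M}
    {y : EuclideanSpace ℝ (Fin n)} (hy : y ∈ baseDom F E x₀) :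
    ContDiffAt ℝ ∞ (fun y => vertComp (bundleRep β x₀ (y, 0))) y :=
  ContDiffAt.comp (g := vertComp) y (ContinuousLinearMap.contDiff _).contDiffAt
    (ContDiffAt.comp (g := bundleRep β x₀) (f := fun y => (y, (0 : F))) y
      (h.contDiffAt_chartRep (mem_target_zeroSection hy 0)) (by fun_prop))

/-- The kernel of a linear form, in terms of its components and a section. -/
theorem curryLeft_at_eq_zero_iff
    {β : FormField ((𝓡 n).prod 𝓘(ℝ, F)) (TotalSpace F E) (k + 2)} (h : IsSmoothForm β)
    (hl : IsLocallyLinear β) {x₀ : M} {e : ∀ x, E x}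
    (he : DifferentiableAt ℝ (secRep F e x₀) (extChartAt (𝓡 n) x₀ x₀))
    (v : EuclideanSpace ℝ (Fin n)) (b : F) :
    (β.at ⟨x₀, e x₀⟩).curryLeft (v, b) = 0 ↔
      (∀ c : E x₀, (zeroComp β x₀ c).curryLeft v = 0) ∧
      ((extD (zeroForm β e)).at x₀ + zeroComp (extD β) x₀ (e x₀)).curryLeft v +
        zeroComp β x₀ (fibVec E x₀ x₀
          (b - fderiv ℝ (secRep F e x₀) (extChartAt (𝓡 n) x₀ x₀) v)) = 0 := by
  have hy := mem_baseDom (n := n) (F := F) (E := E) x₀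
  rw [FormField.at_eq_bundleRep, (hl x₀ _ hy).curryLeft_eq_zero_iff
    (differentiableAt_bundleRep h hy 0)]
  have h1 : (∀ c : F, (vertComp (bundleRep β x₀ (extChartAt (𝓡 n) x₀ x₀, 0)) c).curryLeft v = 0) ↔
      ∀ c : E x₀, (zeroComp β x₀ c).curryLeft v = 0 := by
    constructor
    · intro H c
      rw [zeroComp_eq_vertComp]
      exact H _
    · intro H c
      rw [← zeroComp_fibVec]
      exact H _
  rw [h1]
  refine and_congr_right fun hv => ?_
  rw [← h1] at hv
  -- Replacing the section with constant coordinates by `e` changes the contraction of dμ by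
  -- μ(De(v)); this is the correction b − De(v).
  have h2 := curryLeft_extDeriv_apply_section
    (B := fun y => vertComp (bundleRep β x₀ (y, 0))) (s := secRep F e x₀)
    ((contDiffAt_vertComp_bundleRep h hy).differentiableAt (by simp)) he hv
  rw [ContinuousAlternatingMap.curryLeft_add, ContinuousAlternatingMap.curryLeft_add,
    add_apply, add_apply, extD_zeroForm_at, h2, map_sub, map_sub, zeroComp_fibVec, zeroComp_fibVec,
    zeroComp_eq_vertComp, ← extDeriv_bundleRep h hy, secRep_self]
  congr! 1
  abel

end BundleCoord

/-! ## Vector fields in charts, Lie brackets and cutoffs -/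

section VectorFields

variable {V : Type*} [NormedAddCommGroup V] [NormedSpace ℝ V]
  {H : Type*} [TopologicalSpace H] {I : ModelWithCorners ℝ V H}
  {X : Type*} [TopologicalSpace X] [ChartedSpace H X] [IsManifold I ∞ X]
  {G : Type*} [NormedAddCommGroup G] [NormedSpace ℝ G]

/-- A vector field in the preferred chart at `x₀`. -/
def vfRep (I : ModelWithCorners ℝ V H) {X : Type*} [TopologicalSpace X] [ChartedSpace H X]
    (v : ∀ x : X, TangentSpace I x) (x₀ : X) (y : V) : V :=
  modelDeriv I 𝓘(ℝ, V) (extChartAt I x₀) ((extChartAt I x₀).symm y)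
    (v ((extChartAt I x₀).symm y))

/-- Smoothness of a vector field at a point. -/
def IsSmoothVFAt (I : ModelWithCorners ℝ V H) {X : Type*} [TopologicalSpace X] [ChartedSpace H X]
    [IsManifold I ∞ X] (v : ∀ x : X, TangentSpace I x) (x : X) : Prop :=
  ContMDiffAt I I.tangent ∞ (fun x => (⟨x, v x⟩ : TangentBundle I X)) x

theorem isSmoothVFAt_iff {v : ∀ x : X, TangentSpace I x} {x₀ x : X}
    (hx : x ∈ (extChartAt I x₀).source) :
    IsSmoothVFAt I v x ↔ ContMDiffAt I 𝓘(ℝ, V) ∞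
      (fun x => modelDeriv I 𝓘(ℝ, V) (extChartAt I x₀) x (v x)) x := by
  have hx' : x ∈ (trivializationAt V (TangentSpace I) x₀).baseSet := by
    rwa [extChartAt_source] at hx
  refine (Trivialization.contMDiffAt_section_iff (trivializationAt V (TangentSpace I) x₀)
    hx').trans ?_
  refine Filter.EventuallyEq.contMDiffAt_iff ?_
  filter_upwards [(isOpen_extChartAt_source (I := I) x₀).mem_nhds hx] with z hz
  rw [extChartAt_source] at hz
  have h1 := TangentBundle.continuousLinearMapAt_trivializationAt (I := I) hz
  have h2 := congrFun (Trivialization.coe_linearMapAt_of_mem (R := ℝ)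
    (trivializationAt V (TangentSpace I) x₀) (b := z) hz) (v z)
  exact h2.symm.trans (congrArg (fun L => L (v z)) h1)

variable [I.Boundaryless]

theorem contDiffAt_vfRep {v : ∀ x : X, TangentSpace I x} {x₀ : X} {y : V}
    (hy : y ∈ (extChartAt I x₀).target) (hv : IsSmoothVFAt I v ((extChartAt I x₀).symm y)) :
    ContDiffAt ℝ ∞ (vfRep I v x₀) y := by
  have h1 := (isSmoothVFAt_iff ((extChartAt I x₀).map_target hy)).1 hv
  exact (ContMDiffAt.comp y h1 (contMDiffAt_extChartAt_symm hy)).contDiffAt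

theorem modelDeriv_symm_vfRep (v : ∀ x : X, TangentSpace I x) {x₀ : X} {y : V}
    (hy : y ∈ (extChartAt I x₀).target) :
    modelDeriv 𝓘(ℝ, V) I (extChartAt I x₀).symm y (vfRep I v x₀ y) =
      v ((extChartAt I x₀).symm y) :=
  congrArg (fun L => L (v ((extChartAt I x₀).symm y))) (modelDeriv_symm_comp_extChartAt hy)

theorem vfRep_self (v : ∀ x : X, TangentSpace I x) (x₀ : X) :
    vfRep I v x₀ (extChartAt I x₀ x₀) = v x₀ := by
  have := modelDeriv_symm_vfRep v (mem_extChartAt_target (I := I) x₀)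
  rw [modelDeriv_extChartAt_symm_self] at this
  refine Eq.trans this ?_
  rw [extChartAt_to_inv]

theorem modelDeriv_apply_vf {S : X → G} (v : ∀ x : X, TangentSpace I x) {x₀ : X} {y : V}
    (hy : y ∈ (extChartAt I x₀).target)
    (hS : MDifferentiableAt I 𝓘(ℝ, G) S ((extChartAt I x₀).symm y)) :
    modelDeriv I 𝓘(ℝ, G) S ((extChartAt I x₀).symm y) (v ((extChartAt I x₀).symm y)) =
      fderiv ℝ (S ∘ (extChartAt I x₀).symm) y (vfRep I v x₀ y) := by
  have := modelDeriv_comp (I := 𝓘(ℝ, V)) (I'' := 𝓘(ℝ, G)) hS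
    (mdifferentiableAt_extChartAt_symm hy)
  rw [modelDeriv_eq_fderiv] at this
  rw [this, ContinuousLinearMap.comp_apply, modelDeriv_symm_vfRep v hy]

theorem modelDeriv_eq_fderiv_symm {S : X → G} {x₀ : X} (hS : MDifferentiableAt I 𝓘(ℝ, G) S x₀) :
    modelDeriv I 𝓘(ℝ, G) S x₀ = fderiv ℝ (S ∘ (extChartAt I x₀).symm) (extChartAt I x₀ x₀) := by
  have h := modelDeriv_comp (I := 𝓘(ℝ, V)) (I'' := 𝓘(ℝ, G)) (f := (extChartAt I x₀).symm)
    (g := S) (x := extChartAt I x₀ x₀) (by rwa [extChartAt_to_inv])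
    (mdifferentiableAt_extChartAt_symm (mem_extChartAt_target x₀))
  rw [modelDeriv_eq_fderiv, modelDeriv_extChartAt_symm_self, extChartAt_to_inv,
    ContinuousLinearMap.comp_id] at h
  exact h.symm

theorem contDiffAt_comp_symm {S : X → G} {x₀ : X} {y : V} (hy : y ∈ (extChartAt I x₀).target)
    (hS : ContMDiffAt I 𝓘(ℝ, G) ∞ S ((extChartAt I x₀).symm y)) :
    ContDiffAt ℝ ∞ (S ∘ (extChartAt I x₀).symm) y :=
  (hS.comp y (contMDiffAt_extChartAt_symm hy)).contDiffAt

theorem eventually_symm {x₀ : X} {p : X → Prop} (h : ∀ᶠ x in 𝓝 x₀, p x) :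
    ∀ᶠ y in 𝓝 (extChartAt I x₀ x₀), y ∈ (extChartAt I x₀).target ∧ p ((extChartAt I x₀).symm y) := by
  have h1 : Tendsto (extChartAt I x₀).symm (𝓝 (extChartAt I x₀ x₀)) (𝓝 x₀) := by
    have := continuousAt_extChartAt_symm (I := I) x₀
    rwa [ContinuousAt, extChartAt_to_inv] at this
  filter_upwards [mem_extChartAt_target_nhds (I := I) (mem_extChartAt_target x₀), h1.eventually h]
    with y hy hp using ⟨hy, hp⟩

/-- The derivative of a smooth function along a smooth vector field is smooth. -/
theorem contMDiffAt_modelDeriv_vf {S : X → G} {v : ∀ x : X, TangentSpace I x} {x₀ : X}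
    (hS : ∀ᶠ x in 𝓝 x₀, ContMDiffAt I 𝓘(ℝ, G) ∞ S x) (hv : IsSmoothVFAt I v x₀) :
    ContMDiffAt I 𝓘(ℝ, G) ∞ (fun x => modelDeriv I 𝓘(ℝ, G) S x (v x)) x₀ := by
  have h1 : ContDiffAt ℝ ∞ (fun y => fderiv ℝ (S ∘ (extChartAt I x₀).symm) y (vfRep I v x₀ y))
      (extChartAt I x₀ x₀) :=
    ((contDiffAt_comp_symm (mem_extChartAt_target x₀)
      (by rw [extChartAt_to_inv]; exact hS.self_of_nhds)).fderiv_right (m := ∞) (by simp)).clm_apply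
      (contDiffAt_vfRep (mem_extChartAt_target x₀) (by rwa [extChartAt_to_inv]))
  refine (h1.contMDiffAt.comp x₀ contMDiffAt_extChartAt).congr_of_eventuallyEq ?_
  filter_upwards [hS, extChartAt_source_mem_nhds (I := I) x₀] with x hx hs
  have := modelDeriv_apply_vf (S := S) v ((extChartAt I x₀).map_source hs)
    (by rw [(extChartAt I x₀).left_inv hs]; exact hx.mdifferentiableAt (by simp))
  refine Eq.trans ?_ this
  rw [(extChartAt I x₀).left_inv hs]

theorem mlieBracket_eq (v w : ∀ x : X, TangentSpace I x) (x₀ : X) :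
    VectorField.mlieBracket I v w x₀ =
      VectorField.lieBracket ℝ (vfRep I v x₀) (vfRep I w x₀) (extChartAt I x₀ x₀) := by
  have key : ∀ u : ∀ x : X, TangentSpace I x,
      VectorField.mpullbackWithin 𝓘(ℝ, V) I (extChartAt I x₀).symm u (range I)
        =ᶠ[𝓝 (extChartAt I x₀ x₀)] vfRep I u x₀ := by
    intro u
    filter_upwards [mem_extChartAt_target_nhds (I := I) (mem_extChartAt_target x₀)] with y hy
    rw [VectorField.mpullbackWithin_apply, I.range_eq_univ, mfderivWithin_univ]
    have e1 := modelDeriv_extChartAt_comp_symm hy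
    have e2 := modelDeriv_symm_comp_extChartAt hy
    have : (modelDeriv 𝓘(ℝ, V) I (extChartAt I x₀).symm y).inverse =
        modelDeriv I 𝓘(ℝ, V) (extChartAt I x₀) ((extChartAt I x₀).symm y) :=
      ContinuousLinearMap.inverse_eq e2 e1
    exact congrArg (fun L => L (u ((extChartAt I x₀).symm y))) this
  rw [← VectorField.mlieBracketWithin_univ, VectorField.mlieBracketWithin_apply]
  have h1 : (modelDeriv I 𝓘(ℝ, V) (extChartAt I x₀) x₀).inverse = ContinuousLinearMap.id ℝ V := by
    rw [modelDeriv_extChartAt_self]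
    exact ContinuousLinearMap.inverse_id
  rw [preimage_univ, I.range_eq_univ, univ_inter]
  have key' := fun u => key u
  simp only [I.range_eq_univ] at key'
  let U : (∀ x : X, TangentSpace I x) → V → V := fun u =>
    VectorField.mpullbackWithin 𝓘(ℝ, V) I (extChartAt I x₀).symm u univ
  have h2 : VectorField.lieBracketWithin ℝ (U v) (U w) univ (extChartAt I x₀ x₀) =
      VectorField.lieBracket ℝ (vfRep I v x₀) (vfRep I w x₀) (extChartAt I x₀ x₀) := by
    rw [VectorField.lieBracketWithin_univ]
    exact (key' v).lieBracket_vectorField_eq (key' w)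
  exact (congrArg (fun L : V →L[ℝ] V =>
    L (VectorField.lieBracketWithin ℝ (U v) (U w) univ (extChartAt I x₀ x₀))) h1).trans h2

/-- The derivative of a function along the Lie bracket of two vector fields. -/
theorem modelDeriv_mlieBracket {S : X → G} {v w : ∀ x : X, TangentSpace I x} {x₀ : X}
    (hS : ∀ᶠ x in 𝓝 x₀, ContMDiffAt I 𝓘(ℝ, G) ∞ S x) (hv : IsSmoothVFAt I v x₀)
    (hw : IsSmoothVFAt I w x₀) :
    modelDeriv I 𝓘(ℝ, G) S x₀ (VectorField.mlieBracket I v w x₀) =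
      modelDeriv I 𝓘(ℝ, G) (fun x => modelDeriv I 𝓘(ℝ, G) S x (w x)) x₀ (v x₀) -
      modelDeriv I 𝓘(ℝ, G) (fun x => modelDeriv I 𝓘(ℝ, G) S x (v x)) x₀ (w x₀) := by
  set S' := S ∘ (extChartAt I x₀).symm with hS'
  set y₀ := extChartAt I x₀ x₀ with hy₀
  have ht : y₀ ∈ (extChartAt I x₀).target := mem_extChartAt_target x₀
  have hS0 : ContDiffAt ℝ ∞ S' y₀ :=
    contDiffAt_comp_symm ht (by rw [extChartAt_to_inv]; exact hS.self_of_nhds)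
  have hd2 : DifferentiableAt ℝ (fderiv ℝ S') y₀ :=
    (hS0.fderiv_right (m := ∞) (by simp)).differentiableAt (by simp)
  have key : ∀ u : ∀ x : X, TangentSpace I x, IsSmoothVFAt I u x₀ →
      modelDeriv I 𝓘(ℝ, G) (fun x => modelDeriv I 𝓘(ℝ, G) S x (u x)) x₀ =
      fderiv ℝ (fun y => fderiv ℝ S' y (vfRep I u x₀ y)) y₀ := by
    intro u hu
    rw [modelDeriv_eq_fderiv_symm ((contMDiffAt_modelDeriv_vf hS hu).mdifferentiableAt (by simp))]
    refine Filter.EventuallyEq.fderiv_eq ?_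
    filter_upwards [eventually_symm (I := I) hS] with y hy
    exact modelDeriv_apply_vf u hy.1 (hy.2.mdifferentiableAt (by simp))
  have hr : ∀ u : ∀ x : X, TangentSpace I x, IsSmoothVFAt I u x₀ →
      DifferentiableAt ℝ (vfRep I u x₀) y₀ := fun u hu =>
    (contDiffAt_vfRep ht (by rwa [extChartAt_to_inv])).differentiableAt (by simp)
  -- Symmetry of the second derivative cancels the second-order terms in the commutator.
  have hsymm := (hS0.isSymmSndFDerivAt two_le_infty).eq
  rw [key v hv, key w hw, modelDeriv_eq_fderiv_symm (hS.self_of_nhds.mdifferentiableAt (by simp)),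
    mlieBracket_eq, fderiv_clm_apply hd2 (hr v hv), fderiv_clm_apply hd2 (hr w hw),
    VectorField.lieBracket]
  have e1 : vfRep I v x₀ y₀ = v x₀ := vfRep_self v x₀
  have e2 : vfRep I w x₀ y₀ = w x₀ := vfRep_self w x₀
  change fderiv ℝ S' y₀ (fderiv ℝ (vfRep I w x₀) y₀ (vfRep I v x₀ y₀)
      - fderiv ℝ (vfRep I v x₀) y₀ (vfRep I w x₀ y₀)) =
    (fderiv ℝ S' y₀ (fderiv ℝ (vfRep I w x₀) y₀ (v x₀))
      + fderiv ℝ (fderiv ℝ S') y₀ (v x₀) (vfRep I w x₀ y₀))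
    - (fderiv ℝ S' y₀ (fderiv ℝ (vfRep I v x₀) y₀ (w x₀))
      + fderiv ℝ (fderiv ℝ S') y₀ (w x₀) (vfRep I v x₀ y₀))
  rw [e1, e2, map_sub]
  have := hsymm (v x₀) (w x₀)
  rw [this]
  abel

end VectorFields

/-! ### Cutoff functions and multiplication of local sections by them. -/

section Cutoff

variable {V : Type*} [NormedAddCommGroup V] [NormedSpace ℝ V] [FiniteDimensional ℝ V]
  {H : Type*} [TopologicalSpace H] {I : ModelWithCorners ℝ V H}
  {X : Type*} [TopologicalSpace X] [T2Space X] [ChartedSpace H X] [IsManifold I ∞ X]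

theorem exists_cutoff (I : ModelWithCorners ℝ V H) [IsManifold I ∞ X] {U : Set X} {x₀ : X}
    (hU : U ∈ 𝓝 x₀) :
    ∃ c : X → ℝ, ContMDiff I 𝓘(ℝ, ℝ) ∞ c ∧ (∀ᶠ x in 𝓝 x₀, c x = 1) ∧ tsupport c ⊆ U := by
  obtain ⟨f, hf, -⟩ := (SmoothBumpFunction.nhds_basis_support (I := I) hU).mem_iff.1 hU
  exact ⟨f, f.contMDiff, f.eventuallyEq_one, hf⟩

variable {F : Type*} [NormedAddCommGroup F] [NormedSpace ℝ F]
  {E : X → Type*} [∀ x, AddCommGroup (E x)] [∀ x, Module ℝ (E x)]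
  [∀ x, TopologicalSpace (E x)] [TopologicalSpace (TotalSpace F E)]
  [FiberBundle F E] [VectorBundle ℝ F E] [ContMDiffVectorBundle ∞ F E I]

/-- Multiplication of a local section with a cutoff function. -/
theorem contMDiff_cutoff_smul {c : X → ℝ} (hc : ContMDiff I 𝓘(ℝ, ℝ) ∞ c) {U : Set X}
    (hU : IsOpen U) (hs : tsupport c ⊆ U) {e : ∀ x, E x}
    (he : ∀ x ∈ U, ContMDiffAt I (I.prod 𝓘(ℝ, F)) ∞ (fun x => (⟨x, e x⟩ : TotalSpace F E)) x) :
    ContMDiff I (I.prod 𝓘(ℝ, F)) ∞ (fun x => (⟨x, c x • e x⟩ : TotalSpace F E)) :=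
  ContMDiffOn.smul_section_of_tsupport hc.contMDiffOn hU hs
    fun x hx => (he x hx).contMDiffWithinAt

end Cutoff

/-! ## Sections, coframes and kernels -/

section Coframes

variable {n : ℕ} {M : Type u} [TopologicalSpace M] [ChartedSpace (EuclideanSpace ℝ (Fin n)) M]
  {F : Type w} [NormedAddCommGroup F] [NormedSpace ℝ F]
  {E : M → Type v} [∀ x, AddCommGroup (E x)] [∀ x, Module ℝ (E x)]
  [∀ x, TopologicalSpace (E x)] [TopologicalSpace (TotalSpace F E)]
  [FiberBundle F E] [VectorBundle ℝ F E]

/-- The derivative of a map into a manifold can be computed in the chart at the image point. -/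
theorem modelDeriv_extChartAt_comp {V : Type*} [NormedAddCommGroup V] [NormedSpace ℝ V]
    {H : Type*} [TopologicalSpace H] {I : ModelWithCorners ℝ V H}
    {X : Type*} [TopologicalSpace X] [ChartedSpace H X]
    {V' : Type*} [NormedAddCommGroup V'] [NormedSpace ℝ V']
    {H' : Type*} [TopologicalSpace H'] {I' : ModelWithCorners ℝ V' H'}
    {X' : Type*} [TopologicalSpace X'] [ChartedSpace H' X'] [IsManifold I' ∞ X']
    {f : X → X'} {x : X} (hf : MDifferentiableAt I I' f x) :
    modelDeriv I 𝓘(ℝ, V') (extChartAt I' (f x) ∘ f) x = modelDeriv I I' f x := by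
  rw [modelDeriv_comp (mdifferentiableAt_extChartAt' (mem_extChartAt_source (f x))) hf,
    modelDeriv_extChartAt_self, ContinuousLinearMap.id_comp]

theorem modelDeriv_eq_of_chart {V : Type*} [NormedAddCommGroup V] [NormedSpace ℝ V]
    {H : Type*} [TopologicalSpace H] {I : ModelWithCorners ℝ V H}
    {X : Type*} [TopologicalSpace X] [ChartedSpace H X]
    {V' : Type*} [NormedAddCommGroup V'] [NormedSpace ℝ V']
    {H' : Type*} [TopologicalSpace H'] {I' : ModelWithCorners ℝ V' H'}
    {X' : Type*} [TopologicalSpace X'] [ChartedSpace H' X'] [IsManifold I' ∞ X']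
    {f : X → X'} {x : X} (hf : MDifferentiableAt I I' f x) {g : X → V'}
    (h : extChartAt I' (f x) ∘ f =ᶠ[𝓝 x] g) :
    modelDeriv I I' f x = modelDeriv I 𝓘(ℝ, V') g x := by
  rw [← modelDeriv_extChartAt_comp hf, modelDeriv_congr h]

theorem modelDeriv_extChartAt_injective {V : Type*} [NormedAddCommGroup V] [NormedSpace ℝ V]
    {H : Type*} [TopologicalSpace H] {I : ModelWithCorners ℝ V H} [I.Boundaryless]
    {X : Type*} [TopologicalSpace X] [ChartedSpace H X] [IsManifold I ∞ X] {x₀ x : X}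
    (hx : x ∈ (extChartAt I x₀).source) :
    Injective (modelDeriv I 𝓘(ℝ, V) (extChartAt I x₀) x) := by
  have h := modelDeriv_symm_comp_extChartAt ((extChartAt I x₀).map_source hx)
  rw [(extChartAt I x₀).left_inv hx] at h
  exact LeftInverse.injective fun v => congrArg (fun L => L v) h

variable (F) in
/-- Smoothness of a section at a point. -/
def IsSmoothSecAt (e : ∀ x : M, E x) (x : M) : Prop :=
  ContMDiffAt (𝓡 n) ((𝓡 n).prod 𝓘(ℝ, F)) ∞ (fun x => (⟨x, e x⟩ : TotalSpace F E)) x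

variable (n F) in
/-- Smoothness of a family of linear maps from the fibers to a fixed vector space. -/
def IsSmoothCoframeOn {G : Type*} [NormedAddCommGroup G] [NormedSpace ℝ G]
    (P : ∀ x : M, E x →ₗ[ℝ] G) (U : Set M) : Prop :=
  ∀ e : TotalSpace F E, e.proj ∈ U →
    ContMDiffAt ((𝓡 n).prod 𝓘(ℝ, F)) 𝓘(ℝ, G) ∞ (fun e : TotalSpace F E => P e.proj e.2) e

variable [IsManifold (𝓡 n) ∞ M] [ContMDiffVectorBundle ∞ F E (𝓡 n)]

theorem isSmoothSecAt_iff {e : ∀ x : M, E x} {x₀ x : M} (hx : x ∈ bundleDom F E x₀) :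
    IsSmoothSecAt (n := n) F e x ↔
      ContMDiffAt (𝓡 n) 𝓘(ℝ, F) ∞ (fun x => fibCoord F x₀ x (e x)) x := by
  refine (Trivialization.contMDiffAt_section_iff (trivializationAt F E x₀) hx).trans ?_
  refine Filter.EventuallyEq.contMDiffAt_iff ?_
  filter_upwards [(isOpen_bundleDom x₀).mem_nhds hx] with z hz
  exact (fibCoord_eq hz _).symm

theorem isSmoothSecAt_fibVec {g : M → F} {x₀ x : M} (hx : x ∈ bundleDom F E x₀)
    (hg : ContMDiffAt (𝓡 n) 𝓘(ℝ, F) ∞ g x) :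
    IsSmoothSecAt (n := n) F (fun x => fibVec E x₀ x (g x)) x := by
  rw [isSmoothSecAt_iff hx]
  refine hg.congr_of_eventuallyEq ?_
  filter_upwards [(isOpen_bundleDom x₀).mem_nhds hx] with z hz
  exact fibCoord_fibVec hz _

theorem IsSmoothSecAt.contDiffAt_secRep {e : ∀ x : M, E x} {x₀ : M} {y : EuclideanSpace ℝ (Fin n)}
    (hy : y ∈ baseDom F E x₀) (h : IsSmoothSecAt (n := n) F e ((extChartAt (𝓡 n) x₀).symm y)) :
    ContDiffAt ℝ ∞ (secRep F e x₀) y :=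
  contDiffAt_comp_symm (S := fun x => fibCoord F x₀ x (e x)) hy.1 ((isSmoothSecAt_iff hy.2).1 h)

theorem IsSmoothSecAt.differentiableAt_secRep {e : ∀ x : M, E x} {x₀ : M}
    (h : IsSmoothSecAt (n := n) F e x₀) :
    DifferentiableAt ℝ (secRep F e x₀) (extChartAt (𝓡 n) x₀ x₀) :=
  (IsSmoothSecAt.contDiffAt_secRep (mem_baseDom x₀)
    (by rwa [extChartAt_to_inv])).differentiableAt (by simp)

/-- The derivative of the local representative of a section at the centre of the chart. -/
def secDeriv (F : Type w) [NormedAddCommGroup F] [NormedSpace ℝ F] {E : M → Type v}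
    [∀ x, AddCommGroup (E x)] [∀ x, Module ℝ (E x)] [∀ x, TopologicalSpace (E x)]
    [TopologicalSpace (TotalSpace F E)] [FiberBundle F E] [VectorBundle ℝ F E] (e : ∀ x, E x)
    (x₀ : M) : EuclideanSpace ℝ (Fin n) →L[ℝ] F :=
  fderiv ℝ (secRep F e x₀) (extChartAt (𝓡 n) x₀ x₀)

theorem eventually_proj_mem {e : TotalSpace F E} {U : Set M} (hU : IsOpen U) (h : e.proj ∈ U) :
    ∀ᶠ e' : TotalSpace F E in 𝓝 e, e'.proj ∈ U :=
  (FiberBundle.continuous_proj F E).continuousAt.preimage_mem_nhds (hU.mem_nhds h)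

/-- The tangent space at ⟨x₀, e x₀⟩ is read in the bundle chart over x₀, where the section is the
graph y ↦ (y, `secRep F e x₀ y`). -/
theorem modelDeriv_section {e : ∀ x : M, E x} {x₀ : M} (he : IsSmoothSecAt (n := n) F e x₀)
    (v : EuclideanSpace ℝ (Fin n)) :
    modelDeriv (𝓡 n) ((𝓡 n).prod 𝓘(ℝ, F)) (fun x => (⟨x, e x⟩ : TotalSpace F E)) x₀ v =
      (v, secDeriv F e x₀ v) := by
  have hd : MDifferentiableAt (𝓡 n) ((𝓡 n).prod 𝓘(ℝ, F))
    (fun x => (⟨x, e x⟩ : TotalSpace F E)) x₀ := ContMDiffAt.mdifferentiableAt he (by simp)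
  have hg : ContMDiffAt (𝓡 n) 𝓘(ℝ, EuclideanSpace ℝ (Fin n) × F) ∞
      (fun x => (extChartAt (𝓡 n) x₀ x, fibCoord F x₀ x (e x))) x₀ :=
    contMDiffAt_extChartAt.prodMk_space ((isSmoothSecAt_iff (mem_bundleDom x₀)).1 he)
  have h0 : (extChartAt ((𝓡 n).prod 𝓘(ℝ, F)) (⟨x₀, e x₀⟩ : TotalSpace F E) ∘
      fun x => (⟨x, e x⟩ : TotalSpace F E)) =ᶠ[𝓝 x₀]
      fun x => (extChartAt (𝓡 n) x₀ x, fibCoord F x₀ x (e x)) := by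
    filter_upwards [bundleDom_mem_nhds (F := F) (E := E) x₀] with x hx
    exact extChartAt_totalSpace (⟨x₀, e x₀⟩ : TotalSpace F E) (e' := ⟨x, e x⟩) hx
  have h1 : (fun x => (extChartAt (𝓡 n) x₀ x, fibCoord F x₀ x (e x))) ∘ (extChartAt (𝓡 n) x₀).symm
      =ᶠ[𝓝 (extChartAt (𝓡 n) x₀ x₀)] fun y => (y, secRep F e x₀ y) := by
    filter_upwards [(isOpen_baseDom (F := F) (E := E) x₀).mem_nhds (mem_baseDom x₀)] with y hy
    exact Prod.ext ((extChartAt (𝓡 n) x₀).right_inv hy.1) rfl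
  have h2 : HasFDerivAt (fun y => (y, secRep F e x₀ y))
      ((ContinuousLinearMap.id ℝ _).prod (secDeriv F e x₀)) (extChartAt (𝓡 n) x₀ x₀) :=
    (hasFDerivAt_id _).prodMk he.differentiableAt_secRep.hasFDerivAt
  rw [modelDeriv_eq_of_chart hd h0,
    modelDeriv_eq_fderiv_symm (hg.mdifferentiableAt (by simp)), h1.fderiv_eq, h2.fderiv]
  exact ContinuousLinearMap.prod_apply _ _ _

theorem contMDiff_fiber_inclusion (x₀ : M) :
    ContMDiff 𝓘(ℝ, F) ((𝓡 n).prod 𝓘(ℝ, F)) ∞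
      (fun f : F => (⟨x₀, fibVec E x₀ x₀ f⟩ : TotalSpace F E)) := by
  intro f
  rw [contMDiffAt_totalSpace]
  refine ⟨contMDiffAt_const, ?_⟩
  refine contMDiffAt_id.congr_of_eventuallyEq (Eventually.of_forall fun f' => ?_)
  exact (fibCoord_eq (mem_bundleDom x₀) _).symm.trans (fibCoord_fibVec (mem_bundleDom x₀) f')

theorem modelDeriv_fiber_inclusion (x₀ : M) (f b : F) :
    modelDeriv 𝓘(ℝ, F) ((𝓡 n).prod 𝓘(ℝ, F))
      (fun f : F => (⟨x₀, fibVec E x₀ x₀ f⟩ : TotalSpace F E)) f b = (0, b) := by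
  have hd := ((contMDiff_fiber_inclusion (n := n) (E := E) x₀).contMDiffAt (x := f)).mdifferentiableAt
    (by simp)
  have h1 : (extChartAt ((𝓡 n).prod 𝓘(ℝ, F)) (⟨x₀, fibVec E x₀ x₀ f⟩ : TotalSpace F E) ∘
      (fun f : F => (⟨x₀, fibVec E x₀ x₀ f⟩ : TotalSpace F E))) =
      fun f => (extChartAt (𝓡 n) x₀ x₀, f) := by
    funext f'
    refine (extChartAt_totalSpace (⟨x₀, fibVec E x₀ x₀ f⟩ : TotalSpace F E)
      (e' := ⟨x₀, fibVec E x₀ x₀ f'⟩) (mem_bundleDom x₀)).trans ?_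
    exact congrArg (Prod.mk _) (fibCoord_fibVec (mem_bundleDom x₀) f')
  have h2 : HasFDerivAt (fun f : F => (extChartAt (𝓡 n) x₀ x₀, f))
      ((0 : F →L[ℝ] EuclideanSpace ℝ (Fin n)).prod (ContinuousLinearMap.id ℝ F)) f :=
    (hasFDerivAt_const _ f).prodMk (hasFDerivAt_id f)
  rw [← modelDeriv_extChartAt_comp hd, h1, modelDeriv_eq_fderiv, h2.fderiv]
  exact ContinuousLinearMap.prod_apply _ _ _

theorem modelDeriv_proj (e : TotalSpace F E) (w : EuclideanSpace ℝ (Fin n) × F) :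
    modelDeriv ((𝓡 n).prod 𝓘(ℝ, F)) (𝓡 n) (TotalSpace.proj : TotalSpace F E → M) e w = w.1 := by
  have hd := (contMDiffAt_proj (n := ∞) (IB := 𝓡 n) E (p := e)).mdifferentiableAt (by simp)
  have h1 : extChartAt (𝓡 n) e.proj ∘ (TotalSpace.proj : TotalSpace F E → M) =ᶠ[𝓝 e]
      (ContinuousLinearMap.fst ℝ (EuclideanSpace ℝ (Fin n)) F) ∘
        extChartAt ((𝓡 n).prod 𝓘(ℝ, F)) e := by
    filter_upwards [eventually_proj_mem (isOpen_bundleDom (F := F) (E := E) e.proj)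
      (mem_bundleDom e.proj)] with e' he'
    rw [comp_apply, comp_apply, extChartAt_totalSpace _ he']
    rfl
  rw [← modelDeriv_extChartAt_comp hd, modelDeriv_congr h1,
    modelDeriv_comp (I' := 𝓘(ℝ, EuclideanSpace ℝ (Fin n) × F))
      (ContinuousLinearMap.differentiableAt _).mdifferentiableAt
      (mdifferentiableAt_extChartAt' (mem_extChartAt_source e)), modelDeriv_extChartAt_self,
    modelDeriv_eq_fderiv, ContinuousLinearMap.fderiv]
  rfl

variable {G : Type*} [NormedAddCommGroup G] [NormedSpace ℝ G]

theorem IsSmoothCoframeOn.apply {P : ∀ x : M, E x →ₗ[ℝ] G} {U : Set M}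
    (hP : IsSmoothCoframeOn n F P U) {x : M} (hx : x ∈ U) {e : ∀ x : M, E x}
    (he : IsSmoothSecAt (n := n) F e x) :
    ContMDiffAt (𝓡 n) 𝓘(ℝ, G) ∞ (fun x => P x (e x)) x :=
  ContMDiffAt.comp x (g := fun e : TotalSpace F E => P e.proj e.2) (hP ⟨x, e x⟩ hx) he

/-- The derivative of a coframe, as a function on the total space, in terms of a section. -/
theorem IsSmoothCoframeOn.modelDeriv_apply {P : ∀ x : M, E x →ₗ[ℝ] G} {U : Set M}
    (hP : IsSmoothCoframeOn n F P U) {x : M} (hx : x ∈ U) {e : ∀ x : M, E x}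
    (he : IsSmoothSecAt (n := n) F e x) (v : EuclideanSpace ℝ (Fin n)) (b : F) :
    modelDeriv ((𝓡 n).prod 𝓘(ℝ, F)) 𝓘(ℝ, G) (fun e : TotalSpace F E => P e.proj e.2) ⟨x, e x⟩ (v, b)
      = modelDeriv (𝓡 n) 𝓘(ℝ, G) (fun x => P x (e x)) x v +
        P x (fibVec E x x (b - secDeriv F e x v)) := by
  have hPd := (hP ⟨x, e x⟩ hx).mdifferentiableAt (by simp)
  have h1 := modelDeriv_comp (I := 𝓡 n) (f := fun x => (⟨x, e x⟩ : TotalSpace F E)) hPd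
    (ContMDiffAt.mdifferentiableAt he (by simp))
  have h1' := congrArg (fun L => L v) h1
  simp only [ContinuousLinearMap.comp_apply, modelDeriv_section he] at h1'
  have hv : fibVec E x x (fibCoord F x x (e x)) = e x := fibVec_fibCoord (mem_bundleDom x) _
  have h2 := modelDeriv_comp (I := 𝓘(ℝ, F)) (I' := (𝓡 n).prod 𝓘(ℝ, F)) (I'' := 𝓘(ℝ, G))
    (f := fun f => (⟨x, fibVec E x x f⟩ : TotalSpace F E)) (x := fibCoord F x x (e x))
    (g := fun e : TotalSpace F E => P e.proj e.2) (by rw [hv]; exact hPd)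
    ((contMDiff_fiber_inclusion x).contMDiffAt.mdifferentiableAt (by simp))
  have h2' := congrArg (fun L => L (b - secDeriv F e x v)) h2
  simp only [ContinuousLinearMap.comp_apply, modelDeriv_fiber_inclusion, hv] at h2'
  have h3 : DifferentiableAt ℝ (P x ∘ fibVec E x x) (fibCoord F x x (e x)) := by
    have := (hPd.comp_of_eq (f := fun f => (⟨x, fibVec E x x f⟩ : TotalSpace F E))
      (x := fibCoord F x x (e x)) ((contMDiff_fiber_inclusion (n := n) (E := E)
        x).contMDiffAt.mdifferentiableAt (by simp)) (by rw [hv]))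
    exact this.differentiableAt
  have h4 : modelDeriv 𝓘(ℝ, F) 𝓘(ℝ, G) (P x ∘ fibVec E x x) (fibCoord F x x (e x))
      (b - secDeriv F e x v) = P x (fibVec E x x (b - secDeriv F e x v)) := by
    rw [modelDeriv_eq_fderiv]
    -- The composite is linear and differentiable, so its derivative can be read off along lines.
    have := h3.hasFDerivAt.hasLineDerivAt (b - secDeriv F e x v)
    refine this.unique ?_
    refine HasLineDerivAt.congr_of_eventuallyEq (f := fun f => P x (fibVec E x x f)) ?_
      (Eventually.of_forall fun _ => rfl)
    simp only [HasLineDerivAt, map_add, map_smul]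
    simpa using ((hasDerivAt_id (0 : ℝ)).smul_const
      (P x (fibVec E x x (b - secDeriv F e x v)))).const_add (P x (fibVec E x x (fibCoord F x x (e x))))
  -- A tangent vector of E is split into a tangent vector of the section and a vertical vector; on
  -- the latter the derivative of P is P itself, by linearity on fibers.
  have h5 : (v, b) = (v, secDeriv F e x v) + ((0 : EuclideanSpace ℝ (Fin n)),
    b - secDeriv F e x v) := by simp
  rw [h5, map_add]
  exact congrArg₂ _ h1'.symm (h2'.symm.trans h4)

variable [FiniteDimensional ℝ F]

variable (F) in
/-- The matrix of a coframe in the bundle coordinates at `x₀`. -/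
def coframeMatrix (P : ∀ x : M, E x →ₗ[ℝ] G) (x₀ x : M) : F →L[ℝ] G :=
  LinearMap.toContinuousLinearMap (P x ∘ₗ fibVec E x₀ x)

theorem contMDiffAt_clm_of_apply {V : Type*} [NormedAddCommGroup V] [NormedSpace ℝ V]
    {H : Type*} [TopologicalSpace H] {I : ModelWithCorners ℝ V H} [I.Boundaryless]
    {X : Type*} [TopologicalSpace X] [ChartedSpace H X] [IsManifold I ∞ X]
    {A : X → F →L[ℝ] G} {x : X} (h : ∀ f, ContMDiffAt I 𝓘(ℝ, G) ∞ (fun x => A x f) x) :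
    ContMDiffAt I 𝓘(ℝ, F →L[ℝ] G) ∞ A x := by
  have h1 : ContDiffAt ℝ ∞ (A ∘ (extChartAt I x).symm) (extChartAt I x x) :=
    contDiffAt_clm_of_apply fun f => contDiffAt_comp_symm (S := fun x => A x f)
      (mem_extChartAt_target x) (by rw [extChartAt_to_inv]; exact h f)
  refine (h1.contMDiffAt.comp x contMDiffAt_extChartAt).congr_of_eventuallyEq ?_
  filter_upwards [extChartAt_source_mem_nhds (I := I) x] with z hz
  simp only [comp_apply, (extChartAt I x).left_inv hz]

theorem IsSmoothCoframeOn.contMDiffAt_matrix {P : ∀ x : M, E x →ₗ[ℝ] G} {U : Set M}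
    (hP : IsSmoothCoframeOn n F P U) {x₀ x : M} (hx : x ∈ U) (hx₀ : x ∈ bundleDom F E x₀) :
    ContMDiffAt (𝓡 n) 𝓘(ℝ, F →L[ℝ] G) ∞ (coframeMatrix F P x₀) x :=
  contMDiffAt_clm_of_apply fun f =>
    hP.apply hx (isSmoothSecAt_fibVec hx₀ (contMDiffAt_const (c := f)))

/-- Smooth lifts through a surjective coframe. -/
theorem IsSmoothCoframeOn.exists_lift [FiniteDimensional ℝ G] {P : ∀ x : M, E x →ₗ[ℝ] G} {U : Set M}
    (hU : IsOpen U) (hP : IsSmoothCoframeOn n F P U) {x₀ : M} (hx : x₀ ∈ U)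
    (hs : Surjective (P x₀)) :
    ∃ R : M → G →L[ℝ] F, ∀ᶠ x in 𝓝 x₀, x ∈ U ∧ x ∈ bundleDom F E x₀ ∧
      ContMDiffAt (𝓡 n) 𝓘(ℝ, G →L[ℝ] F) ∞ R x ∧
      ∀ z, P x (fibVec E x₀ x (R x z)) = z := by
  have h1 : ∀ᶠ x in 𝓝 x₀, x ∈ U ∧ x ∈ bundleDom F E x₀ :=
    Filter.Eventually.and (hU.mem_nhds hx) (bundleDom_mem_nhds x₀)
  obtain ⟨R, hR⟩ := exists_smooth_rightInverse (I := 𝓡 n) (A := coframeMatrix F P x₀) (x₀ := x₀)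
    (h1.mono fun x hx => hP.contMDiffAt_matrix hx.1 hx.2) (by
      intro z
      obtain ⟨a, rfl⟩ := hs z
      refine ⟨fibCoord F x₀ x₀ a, ?_⟩
      exact congrArg (P x₀) (fibVec_fibCoord (mem_bundleDom x₀) a))
  exact ⟨R, (h1.and hR).mono fun x hx => ⟨hx.1.1, hx.1.2, hx.2.1, hx.2.2⟩⟩

end Coframes

/-! ## Coframes of simple quotients and their kernels -/

section QuotientCoframe

theorem modelDeriv_prodMk_space {V : Type*} [NormedAddCommGroup V] [NormedSpace ℝ V]
    {H : Type*} [TopologicalSpace H] {I : ModelWithCorners ℝ V H}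
    {X : Type*} [TopologicalSpace X] [ChartedSpace H X]
    {A B : Type*} [NormedAddCommGroup A] [NormedSpace ℝ A] [NormedAddCommGroup B] [NormedSpace ℝ B]
    {f : X → A} {g : X → B} {x : X} (hf : MDifferentiableAt I 𝓘(ℝ, A) f x)
    (hg : MDifferentiableAt I 𝓘(ℝ, B) g x) :
    modelDeriv I 𝓘(ℝ, A × B) (fun x => (f x, g x)) x =
      (modelDeriv I 𝓘(ℝ, A) f x).prod (modelDeriv I 𝓘(ℝ, B) g x) :=
  HasMFDerivAt.mfderiv ⟨hf.continuousAt.prodMk hg.continuousAt,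
    hf.hasMFDerivAt.2.prodMk hg.hasMFDerivAt.2⟩

variable {n : ℕ} {M : Type u} [TopologicalSpace M] [ChartedSpace (EuclideanSpace ℝ (Fin n)) M]
  {F : Type w} [NormedAddCommGroup F] [NormedSpace ℝ F]
  {E : M → Type v} [∀ x, AddCommGroup (E x)] [∀ x, Module ℝ (E x)]
  [∀ x, TopologicalSpace (E x)] [TopologicalSpace (TotalSpace F E)]
  [FiberBundle F E] [VectorBundle ℝ F E]

theorem fibCoord_injective {x₀ x : M} (hx : x ∈ bundleDom F E x₀) :
    Injective (fibCoord F x₀ x : E x → F) := LeftInverse.injective (fibVec_fibCoord hx)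

theorem fibCoord_surjective {x₀ x : M} (hx : x ∈ bundleDom F E x₀) :
    Surjective (fibCoord F x₀ x : E x → F) := RightInverse.surjective (fibCoord_fibVec hx)

variable (Q : BundleSimpleQuotient (n := n) F E)

/-- The coframe of `E` given by a quotient map followed by bundle coordinates at `b₀`. -/
def BundleSimpleQuotient.coframe (b₀ : Q.qM.base) (x : M) :
    E x →ₗ[ℝ] EuclideanSpace ℝ (Fin Q.rk) :=
  fibCoord (EuclideanSpace ℝ (Fin Q.rk)) b₀ (Q.qM.map x) ∘ₗ Q.fibMap x

/-- The domain of the coframe. -/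
def BundleSimpleQuotient.coframeDom (b₀ : Q.qM.base) : Set M :=
  Q.qM.map ⁻¹' (bundleDom (EuclideanSpace ℝ (Fin Q.rk)) Q.fib b₀ ∩
    (extChartAt (𝓡 Q.qM.dim) b₀).source)

theorem BundleSimpleQuotient.isOpen_coframeDom (b₀ : Q.qM.base) : IsOpen (Q.coframeDom b₀) :=
  ((isOpen_bundleDom b₀).inter (isOpen_extChartAt_source b₀)).preimage Q.qM.smooth.continuous

theorem BundleSimpleQuotient.mem_coframeDom (x : M) : x ∈ Q.coframeDom (Q.qM.map x) :=
  ⟨mem_bundleDom _, mem_extChartAt_source _⟩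

theorem BundleSimpleQuotient.coframe_surjective {b₀ : Q.qM.base} {x : M}
    (hx : x ∈ Q.coframeDom b₀) : Surjective (Q.coframe b₀ x) :=
  (fibCoord_surjective hx.1).comp (Q.fib_surjective x)

theorem BundleSimpleQuotient.coframe_eq_iff {b₀ : Q.qM.base} {x : M}
    (hx : x ∈ Q.coframeDom b₀) {a b : E x} :
    Q.coframe b₀ x a = Q.coframe b₀ x b ↔ Q.fibMap x a = Q.fibMap x b :=
  (fibCoord_injective hx.1).eq_iff

theorem BundleSimpleQuotient.contMDiff_map : ContMDiff ((𝓡 n).prod 𝓘(ℝ, F)) Q.model ∞ Q.map :=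
  Q.smooth

variable [IsManifold (𝓡 n) ∞ M] [ContMDiffVectorBundle ∞ F E (𝓡 n)]

theorem BundleSimpleQuotient.isSmoothCoframeOn (b₀ : Q.qM.base) :
    IsSmoothCoframeOn n F (Q.coframe b₀) (Q.coframeDom b₀) := by
  intro e he
  have hmem : Q.map e ∈
      (trivializationAt (EuclideanSpace ℝ (Fin Q.rk)) Q.fib b₀).source := by
    rw [Trivialization.mem_source]
    exact he.1
  have h1 := ((Trivialization.contMDiffAt_iff
    (e := trivializationAt (EuclideanSpace ℝ (Fin Q.rk)) Q.fib b₀) hmem).1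
    (Q.contMDiff_map e)).2
  refine h1.congr_of_eventuallyEq ?_
  filter_upwards [eventually_proj_mem (Q.isOpen_coframeDom b₀) he] with e' he'
  exact fibCoord_eq he'.1 _

/-- In the bundle chart of the quotient at b₀, the map q is the pair of q_M in base coordinates and
the coframe P, whence Tq = (Tq_M, dP). This is what translates Ker Tq into a condition on coframes.
-/
theorem BundleSimpleQuotient.modelDeriv_chart_map {b₀ : Q.qM.base} {e : TotalSpace F E}
    (he : e.proj ∈ Q.coframeDom b₀) (w : EuclideanSpace ℝ (Fin n) × F) :
    modelDeriv Q.model 𝓘(ℝ, EuclideanSpace ℝ (Fin Q.qM.dim) × EuclideanSpace ℝ (Fin Q.rk))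
      (extChartAt Q.model (zeroSection (EuclideanSpace ℝ (Fin Q.rk)) Q.fib b₀)) (Q.map e)
      (modelDeriv ((𝓡 n).prod 𝓘(ℝ, F)) Q.model Q.map e w) =
    (modelDeriv (𝓡 Q.qM.dim) 𝓘(ℝ, EuclideanSpace ℝ (Fin Q.qM.dim)) (extChartAt (𝓡 Q.qM.dim) b₀)
      (Q.qM.map e.proj) (modelDeriv (𝓡 n) (𝓡 Q.qM.dim) Q.qM.map e.proj w.1),
    modelDeriv ((𝓡 n).prod 𝓘(ℝ, F)) 𝓘(ℝ, EuclideanSpace ℝ (Fin Q.rk))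
      (fun e : TotalSpace F E => Q.coframe b₀ e.proj e.2) e w) := by
  have hsrc : Q.map e ∈
      (extChartAt Q.model (zeroSection (EuclideanSpace ℝ (Fin Q.rk)) Q.fib b₀)).source := by
    rw [FiberBundle.extChartAt]
    refine ⟨?_, ?_⟩
    · exact (Trivialization.mem_source _).2 he.1
    · refine ⟨?_, trivial⟩
      have := (trivializationAt (EuclideanSpace ℝ (Fin Q.rk)) Q.fib b₀).coe_fst' (x := Q.map e) he.1
      exact (congrArg (fun b => b ∈ (extChartAt (𝓡 Q.qM.dim) b₀).source) this).mpr he.2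
  have hQ : MDifferentiableAt ((𝓡 n).prod 𝓘(ℝ, F)) Q.model Q.map e :=
    (Q.contMDiff_map e).mdifferentiableAt (by simp)
  have hφ : MDifferentiableAt (𝓡 Q.qM.dim) 𝓘(ℝ, EuclideanSpace ℝ (Fin Q.qM.dim))
      (extChartAt (𝓡 Q.qM.dim) b₀) (Q.qM.map e.proj) := mdifferentiableAt_extChartAt' he.2
  have hq : MDifferentiableAt (𝓡 n) (𝓡 Q.qM.dim) Q.qM.map e.proj :=
    (Q.qM.smooth e.proj).mdifferentiableAt (by simp)
  have hπ : MDifferentiableAt ((𝓡 n).prod 𝓘(ℝ, F)) (𝓡 n) (TotalSpace.proj : TotalSpace F E → M) e :=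
    (contMDiffAt_proj (n := ∞) (IB := 𝓡 n) E (p := e)).mdifferentiableAt (by simp)
  have h1 : extChartAt Q.model (zeroSection (EuclideanSpace ℝ (Fin Q.rk)) Q.fib b₀) ∘ Q.map =ᶠ[𝓝 e]
      fun e => ((extChartAt (𝓡 Q.qM.dim) b₀ ∘ Q.qM.map ∘ TotalSpace.proj) e,
        Q.coframe b₀ e.proj e.2) := by
    filter_upwards [eventually_proj_mem (Q.isOpen_coframeDom b₀) he] with e' he'
    exact extChartAt_totalSpace (zeroSection (EuclideanSpace ℝ (Fin Q.rk)) Q.fib b₀)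
      (e' := Q.map e') he'.1
  have h2 := modelDeriv_comp (I := (𝓡 n).prod 𝓘(ℝ, F)) (mdifferentiableAt_extChartAt' hsrc) hQ
  have h3 := modelDeriv_comp (I := (𝓡 n).prod 𝓘(ℝ, F)) (f := Q.qM.map ∘ TotalSpace.proj) (x := e) hφ
    (hq.comp e hπ)
  have h4 := modelDeriv_comp (I := (𝓡 n).prod 𝓘(ℝ, F)) hq hπ
  rw [← ContinuousLinearMap.comp_apply, ← h2, modelDeriv_congr h1,
    modelDeriv_prodMk_space (hφ.comp e (hq.comp e hπ))
      ((Q.isSmoothCoframeOn b₀ e he).mdifferentiableAt (by simp)),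
    ContinuousLinearMap.prod_apply, h3, h4, ContinuousLinearMap.comp_apply,
    ContinuousLinearMap.comp_apply, modelDeriv_proj]
  rfl

theorem BundleSimpleQuotient.modelDeriv_map_eq_zero_iff {b₀ : Q.qM.base} {e : TotalSpace F E}
    (he : e.proj ∈ Q.coframeDom b₀) (w : EuclideanSpace ℝ (Fin n) × F) :
    modelDeriv ((𝓡 n).prod 𝓘(ℝ, F)) Q.model Q.map e w = 0 ↔
      modelDeriv (𝓡 n) (𝓡 Q.qM.dim) Q.qM.map e.proj w.1 = 0 ∧
      modelDeriv ((𝓡 n).prod 𝓘(ℝ, F)) 𝓘(ℝ, EuclideanSpace ℝ (Fin Q.rk))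
        (fun e : TotalSpace F E => Q.coframe b₀ e.proj e.2) e w = 0 := by
  have h := Q.modelDeriv_chart_map he w
  have hsrc : Q.map e ∈
      (extChartAt Q.model (zeroSection (EuclideanSpace ℝ (Fin Q.rk)) Q.fib b₀)).source := by
    rw [FiberBundle.extChartAt]
    refine ⟨?_, ?_⟩
    · exact (Trivialization.mem_source _).2 he.1
    · refine ⟨?_, trivial⟩
      have := (trivializationAt (EuclideanSpace ℝ (Fin Q.rk)) Q.fib b₀).coe_fst' (x := Q.map e) he.1
      exact (congrArg (fun b => b ∈ (extChartAt (𝓡 Q.qM.dim) b₀).source) this).mpr he.2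
  rw [← map_eq_zero_iff _ (modelDeriv_extChartAt_injective hsrc), h, Prod.mk_eq_zero,
    map_eq_zero_iff _ (modelDeriv_extChartAt_injective he.2)]

theorem BundleSimpleQuotient.modelDeriv_map_surjective (e : TotalSpace F E) :
    Surjective (modelDeriv ((𝓡 n).prod 𝓘(ℝ, F)) Q.model Q.map e) := by
  rintro ⟨c, g⟩
  obtain ⟨v, hv⟩ : ∃ v : EuclideanSpace ℝ (Fin n),
      modelDeriv (𝓡 n) (𝓡 Q.qM.dim) Q.qM.map e.proj v = c := Q.qM.submersion e.proj c
  have he := Q.mem_coframeDom e.proj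
  set P := Q.coframe (Q.qM.map e.proj)
  set D := modelDeriv ((𝓡 n).prod 𝓘(ℝ, F)) 𝓘(ℝ, EuclideanSpace ℝ (Fin Q.rk))
        (fun e : TotalSpace F E => P e.proj e.2) e with hD
  -- The lift `v` of the base component already moves the fiber coordinates by D(v, 0); a vertical
  -- vector supplies the remainder.
  obtain ⟨a, ha⟩ := Q.coframe_surjective he (g - D (v, 0))
  have hsec : IsSmoothSecAt (n := n) F
      (fun x => fibVec E e.proj x (fibCoord F e.proj e.proj e.2)) e.proj :=
    isSmoothSecAt_fibVec (mem_bundleDom _) contMDiffAt_const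
  have h1 := fun v b => (Q.isSmoothCoframeOn (Q.qM.map e.proj)).modelDeriv_apply he hsec v b
  have h0 : (fibVec E e.proj e.proj (fibCoord F e.proj e.proj e.2)) = e.2 :=
    fibVec_fibCoord (mem_bundleDom _) _
  rw [h0] at h1
  have h2 : D (0, fibCoord F e.proj e.proj a) = g - D (v, 0) := by
    refine (h1 0 _).trans ?_
    rw [map_zero, map_zero, zero_add, sub_zero, fibVec_fibCoord (mem_bundleDom _)]
    exact ha
  refine ⟨(v, fibCoord F e.proj e.proj a), ?_⟩
  have h3 := Q.modelDeriv_chart_map he (v, fibCoord F e.proj e.proj a)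
  have h4 := extChartAt_totalSpace_congr (n := Q.qM.dim)
    (e := zeroSection (EuclideanSpace ℝ (Fin Q.rk)) Q.fib (Q.qM.map e.proj)) (e' := Q.map e) rfl
  rw [h4, modelDeriv_extChartAt_self, modelDeriv_extChartAt_self] at h3
  refine h3.trans (Prod.ext hv ?_)
  have h5 : (v, fibCoord F e.proj e.proj a) = (v, (0 : F)) +
    ((0 : EuclideanSpace ℝ (Fin n)), fibCoord F e.proj e.proj a) := by simp
  change D _ = g
  rw [h5, map_add, h2]
  abel

end QuotientCoframe

/-! ## Adapted coframes -/

section Adapted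

variable {n m : ℕ} {M : Type u} [TopologicalSpace M] [ChartedSpace (EuclideanSpace ℝ (Fin n)) M]
  {F : Type w} [NormedAddCommGroup F] [NormedSpace ℝ F]
  {E : M → Type v} [∀ x, AddCommGroup (E x)] [∀ x, Module ℝ (E x)]
  [∀ x, TopologicalSpace (E x)] [TopologicalSpace (TotalSpace F E)]
  [FiberBundle F E] [VectorBundle ℝ F E]
  [IsManifold (𝓡 n) ∞ M] [ContMDiffVectorBundle ∞ F E (𝓡 n)]
  {om : FormField ((𝓡 n).prod 𝓘(ℝ, F)) (TotalSpace F E) (m + 2)}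

theorem mem_kerMu_iff {x : M} {a : E x} : a ∈ kerMu om x ↔ zeroComp om x a = 0 := Iff.rfl

theorem mem_ker_sharp_iff {k : ℕ} {x : M}
    {φ : E x →ₗ[ℝ] (TangentSpace (𝓡 n) x [⋀^Fin (k + 1)]→L[ℝ] ℝ)} {v : TangentSpace (𝓡 n) x} :
    v ∈ LinearMap.ker (sharp φ) ↔ ∀ c, iprod (φ c) v = 0 := by
  rw [LinearMap.mem_ker, LinearMap.ext_iff]
  rfl

theorem mem_kerMuSharp_iff {x : M} {v : EuclideanSpace ℝ (Fin n)} :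
    v ∈ kerMuSharp om x ↔ ∀ c : E x, (zeroComp om x c).curryLeft v = 0 :=
  mem_ker_sharp_iff.trans (forall_congr' fun c => by rw [← iprod_eq_curryLeft]; rfl)

theorem mem_ker_sharp_etaC_iff {x : M} {v : EuclideanSpace ℝ (Fin n)} :
    v ∈ LinearMap.ker (sharp (etaC om x)) ↔
      ∀ c : E x, (zeroComp (extD om) x c).curryLeft v = 0 :=
  mem_ker_sharp_iff.trans (forall_congr' fun c => by rw [← iprod_eq_curryLeft]; rfl)

theorem mem_kerForm_iff (hs : IsSmoothForm om) (hl : IsLocallyLinear om) {x : M} {e : ∀ x, E x}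
    (he : IsSmoothSecAt (n := n) F e x) (v : EuclideanSpace ℝ (Fin n)) (b : F) :
    (v, b) ∈ kerForm om ⟨x, e x⟩ ↔ v ∈ kerMuSharp om x ∧
      ((extD (muForm om e)).at x + zeroComp (extD om) x (e x)).curryLeft v +
        zeroComp om x (fibVec E x x (b - secDeriv F e x v)) = 0 := by
  rw [mem_kerMuSharp_iff]
  refine Iff.trans ?_ (curryLeft_at_eq_zero_iff hs hl he.differentiableAt_secRep v b)
  rw [← iprod_eq_curryLeft]
  rfl

/-- The form dω is again linear. Its first component is η and, as d² = 0, its second component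
vanishes, so the description of Ker ω applies with these components. -/
theorem mem_kerForm_extD_iff (hs : IsSmoothForm om) (hl : IsLocallyLinear om) {x : M}
    {e : ∀ x, E x} (he : IsSmoothSecAt (n := n) F e x) (v : EuclideanSpace ℝ (Fin n)) (b : F) :
    (v, b) ∈ kerForm (extD om) ⟨x, e x⟩ ↔ v ∈ LinearMap.ker (sharp (etaC om x)) ∧
      ((extD (etaForm om e)).at x).curryLeft v +
        zeroComp (extD om) x (fibVec E x x (b - secDeriv F e x v)) = 0 := by
  rw [mem_ker_sharp_etaC_iff]
  have h := curryLeft_at_eq_zero_iff (k := m + 1) hs.extD (hl.extD hs) he.differentiableAt_secRep v b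
  have h0 : zeroComp (extD (extD om)) x = 0 := by
    rw [extD_extD hs]
    ext c z
    rfl
  rw [h0, LinearMap.zero_apply, add_zero] at h
  refine Iff.trans ?_ h
  rw [← iprod_eq_curryLeft]
  rfl

/-- The covariant derivative is determined by `μ`. -/
theorem nablaBar_eq {x : M} {v : EuclideanSpace ℝ (Fin n)} {s : ∀ x : M, E x ⧸ kerMu om x}
    {e : ∀ x, E x} (hse : ∀ᶠ z in 𝓝 x, s z = (kerMu om z).mkQ (e z)) {a : E x}
    (ha : ((extD (muForm om e)).at x).curryLeft v = zeroComp om x a) :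
    nablaBar om (x := x) v s = (kerMu om x).mkQ a := by
  have hinj : Injective (muBar om x) := by
    rw [← LinearMap.ker_eq_bot]
    exact Submodule.ker_liftQ_eq_bot' _ _ rfl
  have h1 : (extD (muBarForm om s)).at x = (extD (muForm om e)).at x := by
    have : chartRep (muBarForm om s) x =ᶠ[𝓝 (extChartAt (𝓡 n) x x)] chartRep (muForm om e) x := by
      filter_upwards [eventually_symm (I := 𝓡 n) hse] with y hy
      have h2 : muBarForm om s ((extChartAt (𝓡 n) x).symm y) =
          muForm om e ((extChartAt (𝓡 n) x).symm y) := by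
        rw [muBarForm, hy.2]
        rfl
      rw [chartRep, chartRep, h2]
    rw [extD_at, extD_at, this.extDeriv_eq]
  have h2 : iprod (extD (muBarForm om s) x) v = muBar om x ((kerMu om x).mkQ a) := by
    refine Eq.trans ?_ (ha.trans rfl)
    rw [← h1, ← iprod_eq_curryLeft]
    rfl
  change invFun (muBar om x) (iprod (extD (muBarForm om s) x) v) = _
  rw [h2]
  exact leftInverse_invFun hinj _

variable {G : Type*} [NormedAddCommGroup G] [NormedSpace ℝ G]

/-- A smooth surjective coframe of `E / Ker μ` which determines the partial connection: the
coframe of `∇_v s` is the derivative along `v` of the coframe of `s`. -/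
structure IsAdaptedCoframe (om : FormField ((𝓡 n).prod 𝓘(ℝ, F)) (TotalSpace F E) (m + 2))
    (P : ∀ x : M, E x →ₗ[ℝ] G) (U : Set M) : Prop where
  isOpen : IsOpen U
  smooth : IsSmoothCoframeOn n F P U
  surj : ∀ x ∈ U, Surjective (P x)
  ker : ∀ x ∈ U, ∀ a, P x a = 0 ↔ a ∈ kerMu om x
  deriv : ∀ x ∈ U, ∀ e : ∀ x, E x, IsSmoothSecAt (n := n) F e x →
    ∀ v : EuclideanSpace ℝ (Fin n), v ∈ kerMuSharp om x → ∀ a : E x,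
      P x a = modelDeriv (𝓡 n) 𝓘(ℝ, G) (fun x => P x (e x)) x v →
      ((extD (muForm om e)).at x).curryLeft v = zeroComp om x a

/-- The kernels of `μ` and `μ^♯` are contained in those of `η` and `η^♯`. -/
def KerMuLeKerEta (om : FormField ((𝓡 n).prod 𝓘(ℝ, F)) (TotalSpace F E) (m + 2)) : Prop :=
  (∀ x : M, kerMu om x ≤ LinearMap.ker (etaC om x)) ∧
  ∀ x : M, kerMuSharp om x ≤ LinearMap.ker (sharp (etaC om x))

theorem KerMuLeKerEta.curryLeft_eq_zero (h : KerMuLeKerEta om) {x : M}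
    {v : EuclideanSpace ℝ (Fin n)} (hv : v ∈ kerMuSharp om x) (c : E x) :
    (zeroComp (extD om) x c).curryLeft v = 0 :=
  mem_ker_sharp_etaC_iff.1 (h.2 x hv) c

theorem IsAdaptedCoframe.apply_eq_iff {P : ∀ x : M, E x →ₗ[ℝ] G} {U : Set M}
    (h : IsAdaptedCoframe om P U) {x : M} (hx : x ∈ U) {a b : E x} :
    P x a = P x b ↔ (kerMu om x).mkQ a = (kerMu om x).mkQ b := by
  rw [← sub_eq_zero, ← map_sub, h.ker x hx, Submodule.mkQ_apply, Submodule.mkQ_apply,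
    Submodule.Quotient.eq]

theorem IsAdaptedCoframe.nablaBar_eq {P : ∀ x : M, E x →ₗ[ℝ] G} {U : Set M}
    (h : IsAdaptedCoframe om P U) {x : M} (hx : x ∈ U) {v : EuclideanSpace ℝ (Fin n)}
    (hv : v ∈ kerMuSharp om x) {s : ∀ x : M, E x ⧸ kerMu om x}
    {e : ∀ x, E x} (he : IsSmoothSecAt (n := n) F e x)
    (hse : ∀ᶠ z in 𝓝 x, s z = (kerMu om z).mkQ (e z)) {a : E x}
    (ha : P x a = modelDeriv (𝓡 n) 𝓘(ℝ, G) (fun x => P x (e x)) x v) :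
    nablaBar om (x := x) v s = (kerMu om x).mkQ a :=
  _root_.nablaBar_eq hse (h.deriv x hx e he v hv a ha)

/-- The kernel of the form, in terms of a coframe which determines the derivatives of sections with
constant coefficients. -/
theorem mem_kerForm_iff_of_coframe {P : ∀ x : M, E x →ₗ[ℝ] G} {U : Set M}
    (hP : IsSmoothCoframeOn n F P U) (hs : IsSmoothForm om) (hl : IsLocallyLinear om)
    (hη : KerMuLeKerEta om) {x : M} (hx : x ∈ U) (hsurj : Surjective (P x))
    (hker : ∀ a, P x a = 0 ↔ a ∈ kerMu om x) (a : E x)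
    (hd : ∀ v : EuclideanSpace ℝ (Fin n), v ∈ kerMuSharp om x → ∀ c : E x,
      P x c = modelDeriv (𝓡 n) 𝓘(ℝ, G) (fun z => P z (fibVec E x z (fibCoord F x x a))) x v →
      ((extD (muForm om fun z => fibVec E x z (fibCoord F x x a))).at x).curryLeft v =
        zeroComp om x c)
    (w : EuclideanSpace ℝ (Fin n) × F) :
    w ∈ kerForm om ⟨x, a⟩ ↔ w.1 ∈ kerMuSharp om x ∧
      modelDeriv ((𝓡 n).prod 𝓘(ℝ, F)) 𝓘(ℝ, G) (fun e : TotalSpace F E => P e.proj e.2) ⟨x, a⟩ w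
        = 0 := by
  obtain ⟨v, b⟩ := w
  set e : ∀ z, E z := fun z => fibVec E x z (fibCoord F x x a) with he
  have hes : IsSmoothSecAt (n := n) F e x := isSmoothSecAt_fibVec (mem_bundleDom x) contMDiffAt_const
  have hex : e x = a := fibVec_fibCoord (mem_bundleDom x) a
  have h1 := mem_kerForm_iff hs hl hes v b
  have h2 := hP.modelDeriv_apply hx hes v b
  rw [hex] at h1 h2
  rw [h1, h2]
  refine and_congr_right fun hv => ?_
  -- Here `c` represents ∇̄_v e; both conditions now say that c + (b − De(v)) lies in Ker μ.
  obtain ⟨c, hc⟩ := hsurj (modelDeriv (𝓡 n) 𝓘(ℝ, G) (fun x => P x (e x)) x v)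
  rw [ContinuousAlternatingMap.curryLeft_add, add_apply, hη.curryLeft_eq_zero hv, add_zero,
    hd v hv c hc, ← map_add, ← hc, ← map_add, hker, mem_kerMu_iff]

/-- The kernel of the form, in terms of an adapted coframe. -/
theorem IsAdaptedCoframe.mem_kerForm_iff {P : ∀ x : M, E x →ₗ[ℝ] G} {U : Set M}
    (h : IsAdaptedCoframe om P U) (hs : IsSmoothForm om) (hl : IsLocallyLinear om)
    (hη : KerMuLeKerEta om) {x : M} (hx : x ∈ U) (a : E x) (w : EuclideanSpace ℝ (Fin n) × F) :
    w ∈ kerForm om ⟨x, a⟩ ↔ w.1 ∈ kerMuSharp om x ∧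
      modelDeriv ((𝓡 n).prod 𝓘(ℝ, F)) 𝓘(ℝ, G) (fun e : TotalSpace F E => P e.proj e.2) ⟨x, a⟩ w
        = 0 :=
  mem_kerForm_iff_of_coframe h.smooth hs hl hη hx (h.surj x hx) (h.ker x hx) a
    (h.deriv x hx _ (isSmoothSecAt_fibVec (mem_bundleDom x) contMDiffAt_const)) w

theorem isSmoothSecAt_zero (x : M) : IsSmoothSecAt (n := n) F (fun z => (0 : E z)) x := by
  rw [isSmoothSecAt_iff (mem_bundleDom x)]
  simp only [map_zero]
  exact contMDiffAt_const

theorem secDeriv_zero (x : M) :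
    secDeriv F (fun z => (0 : E z)) x = (0 : EuclideanSpace ℝ (Fin n) →L[ℝ] F) := by
  have : secRep F (fun z => (0 : E z)) x = fun _ : EuclideanSpace ℝ (Fin n) => (0 : F) := by
    funext y
    exact map_zero _
  rw [secDeriv, this, fderiv_fun_const]
  rfl

theorem muForm_zero : muForm om (fun z => (0 : E z)) = 0 := funext fun x => map_zero (muC om x)

theorem extD_zero_at (k : ℕ) (x : M) : (extD (0 : FormField (𝓡 n) M k)).at x = 0 := by
  have : chartRep (0 : FormField (𝓡 n) M k) x = fun _ => 0 := by
    funext y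
    ext z
    rfl
  rw [extD_at, this, extDeriv, fderiv_fun_const]
  exact map_zero (ContinuousAlternatingMap.alternatizeUncurryFinCLM ℝ (EuclideanSpace ℝ (Fin n)) ℝ)

/-- Along the zero section all derivative terms vanish, so Ker ω splits there into horizontal
vectors from Ker μ^♯ and vertical vectors from Ker μ. This recovers both kernels from Ker ω. -/
theorem mem_kerMuSharp_iff_kerForm (hs : IsSmoothForm om) (hl : IsLocallyLinear om) {x : M}
    {v : EuclideanSpace ℝ (Fin n)} :
    v ∈ kerMuSharp om x ↔ ((v, 0) : EuclideanSpace ℝ (Fin n) × F) ∈ kerForm om ⟨x, (0 : E x)⟩ := by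
  rw [mem_kerForm_iff hs hl (isSmoothSecAt_zero x), muForm_zero, extD_zero_at, secDeriv_zero]
  simp only [map_zero, zero_add, ContinuousAlternatingMap.curryLeft_zero, zero_apply, sub_zero,
    and_true]

theorem mem_kerMu_iff_kerForm (hs : IsSmoothForm om) (hl : IsLocallyLinear om) {x : M} {a : E x} :
    a ∈ kerMu om x ↔ ((0, fibCoord F x x a) : EuclideanSpace ℝ (Fin n) × F) ∈
      kerForm om ⟨x, (0 : E x)⟩ := by
  rw [mem_kerForm_iff hs hl (isSmoothSecAt_zero x)]
  simp only [map_zero, sub_zero, zero_add, fibVec_fibCoord (mem_bundleDom (F := F) (E := E) x)]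
  exact ⟨fun h => ⟨Submodule.zero_mem _, h⟩, fun h => h.2⟩

/-- An adapted coframe is obtained from any coframe which describes the kernel of the form. -/
theorem isAdaptedCoframe_of_mem_kerForm_iff {P : ∀ x : M, E x →ₗ[ℝ] G} {U : Set M} (hU : IsOpen U)
    (hP : IsSmoothCoframeOn n F P U) (hsurj : ∀ x ∈ U, Surjective (P x)) (hs : IsSmoothForm om)
    (hl : IsLocallyLinear om) (hη : KerMuLeKerEta om)
    (hker : ∀ x ∈ U, ∀ (a : E x) (w : EuclideanSpace ℝ (Fin n) × F),
      w ∈ kerForm om ⟨x, a⟩ ↔ w.1 ∈ kerMuSharp om x ∧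
      modelDeriv ((𝓡 n).prod 𝓘(ℝ, F)) 𝓘(ℝ, G) (fun e : TotalSpace F E => P e.proj e.2) ⟨x, a⟩ w
        = 0) : IsAdaptedCoframe om P U where
  isOpen := hU
  smooth := hP
  surj := hsurj
  ker x hx a := by
    have hes := isSmoothSecAt_zero (n := n) (F := F) (E := E) x
    have h1 := hker x hx 0 (0, fibCoord F x x a)
    rw [← mem_kerMu_iff_kerForm hs hl, hP.modelDeriv_apply hx hes] at h1
    simp only [map_zero, sub_zero, zero_add, fibVec_fibCoord (mem_bundleDom (F := F) (E := E) x)]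
      at h1
    exact ⟨fun h => h1.2 ⟨Submodule.zero_mem _, h⟩, fun h => (h1.1 h).2⟩
  deriv x hx e he v hv a ha := by
    -- The fiber component is De(v) − a, for which dP(v, ·) = v(P e) − P(a) = 0, so this vector is
    -- in the kernel and yields i_v dμ(e) = μ(a).
    have h1 := _root_.mem_kerForm_iff hs hl he v (secDeriv F e x v - fibCoord F x x a)
    rw [hker x hx, hP.modelDeriv_apply hx he, ← ha] at h1
    simp only [hv, true_and, sub_sub_cancel_left, map_neg, fibVec_fibCoord (mem_bundleDom x),
      add_neg_cancel, true_iff, ContinuousAlternatingMap.curryLeft_add, add_apply,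
      hη.curryLeft_eq_zero hv, add_zero] at h1
    exact add_neg_eq_zero.1 h1

/-- Compare the kernels of ω and dω along the zero section, where they are given by the components
alone. -/
theorem kerMuLeKerEta_of_kerForm_le (hs : IsSmoothForm om) (hl : IsLocallyLinear om)
    (h : ∀ e : TotalSpace F E, kerForm om e ≤ kerForm (extD om) e) : KerMuLeKerEta om := by
  refine ⟨fun x a ha => ?_, fun x v hv => ?_⟩
  · have h1 := h _ ((mem_kerMu_iff_kerForm hs hl).1 ha)
    have h2 := (mem_kerForm_extD_iff hs hl (isSmoothSecAt_zero x) 0 (fibCoord F x x a)).1 h1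
    simp only [map_zero, sub_zero, zero_add, fibVec_fibCoord (mem_bundleDom (F := F) (E := E) x)]
      at h2
    exact h2.2
  · exact ((mem_kerForm_extD_iff hs hl (isSmoothSecAt_zero x) v 0).1
      (h _ ((mem_kerMuSharp_iff_kerForm hs hl).1 hv))).1

end Adapted

/-! ## From kernel-reducibility to the infinitesimal conditions -/

section Forward

variable {n m : ℕ} {M : Type u} [TopologicalSpace M] [ChartedSpace (EuclideanSpace ℝ (Fin n)) M]
  {F : Type w} [NormedAddCommGroup F] [NormedSpace ℝ F] [FiniteDimensional ℝ F]
  {E : M → Type v} [∀ x, AddCommGroup (E x)] [∀ x, Module ℝ (E x)]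
  [∀ x, TopologicalSpace (E x)] [TopologicalSpace (TotalSpace F E)]
  [FiberBundle F E] [VectorBundle ℝ F E]
  [IsManifold (𝓡 n) ∞ M] [ContMDiffVectorBundle ∞ F E (𝓡 n)]
  {om : FormField ((𝓡 n).prod 𝓘(ℝ, F)) (TotalSpace F E) (m + 2)}
  {G : Type*} [NormedAddCommGroup G] [NormedSpace ℝ G]

section Adapted

variable {P : ∀ x : M, E x →ₗ[ℝ] G} {U : Set M}

/-- The term i_v η(e) vanishes, and i_v dμ(e) is μ of any vector whose coframe value is v(P e). -/
theorem IsAdaptedCoframe.contraction_mem (h : IsAdaptedCoframe om P U) (hη : KerMuLeKerEta om)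
    {x : M} (hx : x ∈ U) {e : ∀ x, E x} (he : IsSmoothSecAt (n := n) F e x)
    {v : EuclideanSpace ℝ (Fin n)} (hv : v ∈ kerMuSharp om x) :
    iprod (extD (muForm om e) x + etaForm om e x) v ∈ LinearMap.range (muC om x) := by
  obtain ⟨a, ha⟩ := h.surj x hx (modelDeriv (𝓡 n) 𝓘(ℝ, G) (fun x => P x (e x)) x v)
  refine ⟨a, ?_⟩
  have h1 : ((extD (muForm om e)).at x + zeroComp (extD om) x (e x)).curryLeft v =
      zeroComp om x a := by
    rw [ContinuousAlternatingMap.curryLeft_add, add_apply, hη.curryLeft_eq_zero hv, add_zero,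
      h.deriv x hx e he v hv a ha]
  refine h1.symm.trans ?_
  rw [← iprod_eq_curryLeft]
  rfl

/-- If ∇̄_v e = 0, the tangent vector (v, De(v)) of the section is in Ker ω, hence in Ker dω; the
kernel formula for dω at this vector reduces to i_v dη(e) = 0. -/
theorem IsAdaptedCoframe.contraction_eta (h : IsAdaptedCoframe om P U) (hs : IsSmoothForm om)
    (hl : IsLocallyLinear om) (hη : KerMuLeKerEta om)
    (hd : ∀ e : TotalSpace F E, kerForm om e ≤ kerForm (extD om) e)
    {x : M} (hx : x ∈ U) {e : ∀ x, E x} (he : IsSmoothSecAt (n := n) F e x)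
    {v : EuclideanSpace ℝ (Fin n)} (hv : v ∈ kerMuSharp om x)
    (h0 : nablaBar om (x := x) v (fun y => (kerMu om y).mkQ (e y)) = 0) :
    iprod (extD (etaForm om e) x) v = 0 := by
  obtain ⟨a, ha⟩ := h.surj x hx (modelDeriv (𝓡 n) 𝓘(ℝ, G) (fun x => P x (e x)) x v)
  rw [h.nablaBar_eq hx hv he (Eventually.of_forall fun _ => rfl) ha, Submodule.mkQ_apply,
    Submodule.Quotient.mk_eq_zero] at h0
  have h1 := h.deriv x hx e he v hv a ha
  rw [mem_kerMu_iff.1 h0] at h1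
  have h2 : (v, secDeriv F e x v) ∈ kerForm om ⟨x, e x⟩ := by
    rw [_root_.mem_kerForm_iff hs hl he, ContinuousAlternatingMap.curryLeft_add, add_apply,
      hη.curryLeft_eq_zero hv, h1]
    exact ⟨hv, by simp⟩
  have h3 := ((mem_kerForm_extD_iff hs hl he _ _).1 (hd _ h2)).2
  rw [sub_self, map_zero, map_zero, add_zero, ← iprod_eq_curryLeft] at h3
  exact h3

/-- Through the coframe ∇̄ acts as directional differentiation of vector-valued functions, so the
curvature becomes v(w S) − w(v S) − [v, w] S = 0. -/
theorem IsAdaptedCoframe.flat [FiniteDimensional ℝ G] (h : IsAdaptedCoframe om P U)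
    {v w : ∀ x : M, TangentSpace (𝓡 n) x} (hv : IsSmoothVFIn (𝓡 n) (kerMuSharp om) v)
    (hw : IsSmoothVFIn (𝓡 n) (kerMuSharp om) w) {e : ∀ x, E x} (he : IsSmoothSec n F e)
    {s : ∀ x : M, E x ⧸ kerMu om x} (hse : ∀ x, s x = (kerMu om x).mkQ (e x)) {x : M} (hx : x ∈ U)
    (hbr : VectorField.mlieBracket (𝓡 n) v w x ∈ kerMuSharp om x) :
    nablaBar om (v x) (fun y => nablaBar om (w y) s)
      - nablaBar om (w x) (fun y => nablaBar om (v y) s)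
      - nablaBar om (VectorField.mlieBracket (𝓡 n) v w x) s = 0 := by
  have hes : ∀ z, IsSmoothSecAt (n := n) F e z := fun z => he z
  set S : M → G := fun z => P z (e z) with hS
  have hSs : ∀ᶠ z in 𝓝 x, ContMDiffAt (𝓡 n) 𝓘(ℝ, G) ∞ S z := by
    filter_upwards [h.isOpen.mem_nhds hx] with z hz using h.smooth.apply hz (hes z)
  obtain ⟨R, hR⟩ := h.smooth.exists_lift h.isOpen hx (h.surj x hx)
  have key : ∀ u w : ∀ x : M, TangentSpace (𝓡 n) x, IsSmoothVFIn (𝓡 n) (kerMuSharp om) u →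
      IsSmoothVFIn (𝓡 n) (kerMuSharp om) w → ∀ a : E x,
      P x a = modelDeriv (𝓡 n) 𝓘(ℝ, G) (fun z => modelDeriv (𝓡 n) 𝓘(ℝ, G) S z (w z)) x (u x) →
      nablaBar om (u x) (fun y => nablaBar om (w y) s) = (kerMu om x).mkQ a := by
    intro u w hu hw a ha
    -- A smooth local representative of ∇̄_w s, found by lifting w(P e) through the coframe, so that
    -- the connection can be applied a second time.
    set ew : ∀ z, E z := fun z => fibVec E x z (R z (modelDeriv (𝓡 n) 𝓘(ℝ, G) S z (w z))) with hew
    have hews : IsSmoothSecAt (n := n) F ew x :=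
      isSmoothSecAt_fibVec (mem_bundleDom x)
        (hR.self_of_nhds.2.2.1.clm_apply (contMDiffAt_modelDeriv_vf hSs (hw.1 x)))
    have h1 : ∀ᶠ z in 𝓝 x, nablaBar om (w z) s = (kerMu om z).mkQ (ew z) := by
      filter_upwards [hR] with z hz
      exact h.nablaBar_eq hz.1 (hw.2 z) (hes z) (Eventually.of_forall hse) (hz.2.2.2 _)
    have h2 : (fun z => P z (ew z)) =ᶠ[𝓝 x] fun z => modelDeriv (𝓡 n) 𝓘(ℝ, G) S z (w z) := by
      filter_upwards [hR] with z hz using hz.2.2.2 _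
    refine h.nablaBar_eq hx (hu.2 x) hews h1 (ha.trans ?_)
    rw [modelDeriv_congr h2]
  obtain ⟨a, ha⟩ := h.surj x hx
    (modelDeriv (𝓡 n) 𝓘(ℝ, G) (fun z => modelDeriv (𝓡 n) 𝓘(ℝ, G) S z (w z)) x (v x))
  obtain ⟨b, hb⟩ := h.surj x hx
    (modelDeriv (𝓡 n) 𝓘(ℝ, G) (fun z => modelDeriv (𝓡 n) 𝓘(ℝ, G) S z (v z)) x (w x))
  obtain ⟨c, hc⟩ := h.surj x hx
    (modelDeriv (𝓡 n) 𝓘(ℝ, G) S x (VectorField.mlieBracket (𝓡 n) v w x))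
  rw [key v w hv hw a ha, key w v hw hv b hb,
    h.nablaBar_eq hx hbr (hes x) (Eventually.of_forall hse) hc, ← map_sub, ← map_sub,
    Submodule.mkQ_apply, Submodule.Quotient.mk_eq_zero, ← h.ker x hx, map_sub, map_sub, ha, hb, hc,
    modelDeriv_mlieBracket hSs (hv.1 x) (hw.1 x), sub_self]

end Adapted

/-- Sections of `D` are the vector fields annihilating local coordinates of the quotient pulled back
by q_M, and the bracket of two such fields annihilates them as well. -/
theorem SimpleQuotient.Integrates.isInvolutive {Q : SimpleQuotient n M}
    {D : ∀ x : M, Submodule ℝ (TangentSpace (𝓡 n) x)} (h : Q.Integrates D) :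
    IsInvolutive (𝓡 n) D := by
  intro v w hv hw x
  have hmem : ∀ (z : M) (u : EuclideanSpace ℝ (Fin n)),
      u ∈ D z ↔ modelDeriv (𝓡 n) (𝓡 Q.dim) Q.map z u = 0 := fun z u => by rw [← h z]; rfl
  set S := extChartAt (𝓡 Q.dim) (Q.map x) ∘ Q.map with hS
  have hnear : ∀ᶠ z in 𝓝 x, Q.map z ∈ (extChartAt (𝓡 Q.dim) (Q.map x)).source :=
    Q.smooth.continuous.continuousAt.preimage_mem_nhds (extChartAt_source_mem_nhds _)
  have hSs : ∀ᶠ z in 𝓝 x, ContMDiffAt (𝓡 n) 𝓘(ℝ, EuclideanSpace ℝ (Fin Q.dim)) ∞ S z := by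
    filter_upwards [hnear] with z hz
    rw [extChartAt_source] at hz
    exact (contMDiffAt_extChartAt' hz).comp z (Q.smooth z)
  have hzero : ∀ u : ∀ x : M, TangentSpace (𝓡 n) x, IsSmoothVFIn (𝓡 n) D u →
      (fun z => modelDeriv (𝓡 n) 𝓘(ℝ, EuclideanSpace ℝ (Fin Q.dim)) S z (u z)) =ᶠ[𝓝 x]
      fun _ => 0 := by
    intro u hu
    filter_upwards [hnear] with z hz
    have h1 := modelDeriv_comp (I := 𝓡 n) (I' := 𝓡 Q.dim) (mdifferentiableAt_extChartAt' hz)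
      ((Q.smooth z).mdifferentiableAt (by simp))
    rw [h1]
    have h2 : ∀ w, modelDeriv (𝓡 n) (𝓡 Q.dim) Q.map z w = 0 →
        ((modelDeriv (𝓡 Q.dim) 𝓘(ℝ, EuclideanSpace ℝ (Fin Q.dim))
          (extChartAt (𝓡 Q.dim) (Q.map x)) (Q.map z)).comp
          (modelDeriv (𝓡 n) (𝓡 Q.dim) Q.map z)) w = 0 := fun w hw => by
      rw [ContinuousLinearMap.comp_apply, hw, map_zero]
    exact h2 _ ((hmem z (u z)).1 (hu.2 z))
  have h1 := modelDeriv_mlieBracket hSs (hv.1 x) (hw.1 x)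
  have hconst : modelDeriv (𝓡 n) 𝓘(ℝ, EuclideanSpace ℝ (Fin Q.dim))
      (fun _ : M => (0 : EuclideanSpace ℝ (Fin Q.dim))) x = 0 := mfderiv_const
  rw [modelDeriv_congr (hzero v hv), modelDeriv_congr (hzero w hw), hconst,
    modelDeriv_extChartAt_comp ((Q.smooth x).mdifferentiableAt (by simp))] at h1
  refine (hmem x _).2 (h1.trans ?_)
  exact sub_self (0 : EuclideanSpace ℝ (Fin Q.dim))

theorem BundleSimpleQuotient.Integrates.mem_iff {Q : BundleSimpleQuotient (n := n) F E}
    (h : Q.Integrates (kerForm om)) (e : TotalSpace F E) (w : EuclideanSpace ℝ (Fin n) × F) :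
    w ∈ kerForm om e ↔ modelDeriv ((𝓡 n).prod 𝓘(ℝ, F)) Q.model Q.map e w = 0 := by
  rw [← h e]
  rfl

theorem BundleSimpleQuotient.Integrates.mem_kerMuSharp_iff
    {Q : BundleSimpleQuotient (n := n) F E} (h : Q.Integrates (kerForm om)) (hs : IsSmoothForm om)
    (hl : IsLocallyLinear om) {x : M} (v : EuclideanSpace ℝ (Fin n)) :
    v ∈ kerMuSharp om x ↔ modelDeriv (𝓡 n) (𝓡 Q.qM.dim) Q.qM.map x v = 0 := by
  have hx := Q.mem_coframeDom x
  have hP := Q.isSmoothCoframeOn (Q.qM.map x)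
  rw [mem_kerMuSharp_iff_kerForm hs hl, h.mem_iff,
    Q.modelDeriv_map_eq_zero_iff (e := ⟨x, (0 : E x)⟩) hx,
    hP.modelDeriv_apply hx (isSmoothSecAt_zero x), secDeriv_zero]
  simp only [map_zero, zero_apply, sub_zero, add_zero, and_iff_left_iff_imp]
  intro _
  have : modelDeriv (𝓡 n) 𝓘(ℝ, EuclideanSpace ℝ (Fin Q.rk))
    (fun _ : M => (0 : EuclideanSpace ℝ (Fin Q.rk))) x = 0 := mfderiv_const
  rw [this]
  rfl

theorem BundleSimpleQuotient.Integrates.integrates_qM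
    {Q : BundleSimpleQuotient (n := n) F E} (h : Q.Integrates (kerForm om)) (hs : IsSmoothForm om)
    (hl : IsLocallyLinear om) : Q.qM.Integrates (kerMuSharp om) := fun _ =>
  Submodule.ext fun v => (h.mem_kerMuSharp_iff hs hl v).symm

/-- Since Ker ω = Ker Tq and Tq = (Tq_M, dP) in charts, the coframe describes Ker ω in the way that
forces it to be adapted. -/
theorem BundleSimpleQuotient.Integrates.isAdaptedCoframe
    {Q : BundleSimpleQuotient (n := n) F E} (h : Q.Integrates (kerForm om)) (hs : IsSmoothForm om)
    (hl : IsLocallyLinear om) (hη : KerMuLeKerEta om) (b₀ : Q.qM.base) :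
    IsAdaptedCoframe om (Q.coframe b₀) (Q.coframeDom b₀) :=
  isAdaptedCoframe_of_mem_kerForm_iff (Q.isOpen_coframeDom b₀) (Q.isSmoothCoframeOn b₀)
    (fun _ hx => Q.coframe_surjective hx) hs hl hη fun _ hx a w => by
      rw [h.mem_iff, Q.modelDeriv_map_eq_zero_iff (e := ⟨_, a⟩) hx, h.mem_kerMuSharp_iff hs hl]

theorem finrank_range_eq {V W G : Type*} [AddCommGroup V] [Module ℝ V] [AddCommGroup W]
    [Module ℝ W] [AddCommGroup G] [Module ℝ G] (f : V →ₗ[ℝ] W) (g : V →ₗ[ℝ] G)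
    (hg : Surjective g) (h : ∀ v, g v = 0 ↔ f v = 0) :
    Module.finrank ℝ (LinearMap.range f) = Module.finrank ℝ G := by
  have hk : LinearMap.ker f = LinearMap.ker g := by
    ext v
    exact (h v).symm
  exact ((f.quotKerEquivRange.symm.trans (Submodule.quotEquivOfEq _ _ hk)).trans
    (g.quotKerEquivOfSurjective hg)).finrank_eq

/-- The map `μ^♯` on model spaces. -/
def sharpComp (om : FormField ((𝓡 n).prod 𝓘(ℝ, F)) (TotalSpace F E) (m + 2)) (x : M) :
    EuclideanSpace ℝ (Fin n) →ₗ[ℝ] E x →ₗ[ℝ] (EuclideanSpace ℝ (Fin n) [⋀^Fin m]→L[ℝ] ℝ) :=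
  sharp (muC om x)

theorem BundleSimpleQuotient.Integrates.isInfKernelReducible
    {Q : BundleSimpleQuotient (n := n) F E} (h : Q.Integrates (kerForm om)) (hs : IsSmoothForm om)
    (hl : IsLocallyLinear om)
    (hd : ∀ e : TotalSpace F E, kerForm om e ≤ kerForm (extD om) e) :
    IsInfKernelReducible om := by
  have hη := kerMuLeKerEta_of_kerForm_le hs hl hd
  have hP := fun x : M => h.isAdaptedCoframe hs hl hη (Q.qM.map x)
  have hinv := (h.integrates_qM hs hl).isInvolutive
  refine ⟨⟨Q.rk, fun x => ?_⟩, ⟨Q.qM.dim, fun x => ?_⟩, ?_, hη.1, hη.2, hinv, ?_, ?_⟩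
  · have := finrank_range_eq (muC om x) (Q.coframe (Q.qM.map x) x)
      (Q.coframe_surjective (Q.mem_coframeDom x)) fun a => (hP x).ker x (Q.mem_coframeDom x) a
    rw [this, finrank_euclideanSpace_fin]
  · have h1 := LinearMap.finrank_range_add_finrank_ker (K := ℝ) (V := EuclideanSpace ℝ (Fin n))
      (V₂ := E x →ₗ[ℝ] (EuclideanSpace ℝ (Fin n) [⋀^Fin m]→L[ℝ] ℝ)) (sharpComp om x)
    have h2 := (modelDeriv (𝓡 n) (𝓡 Q.qM.dim) Q.qM.map x).toLinearMap.finrank_range_add_finrank_ker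
    have hk : LinearMap.ker (sharpComp om x) =
        LinearMap.ker (modelDeriv (𝓡 n) (𝓡 Q.qM.dim) Q.qM.map x).toLinearMap :=
      Submodule.ext fun v => h.mem_kerMuSharp_iff hs hl v
    have hr : LinearMap.range (modelDeriv (𝓡 n) (𝓡 Q.qM.dim) Q.qM.map x).toLinearMap = ⊤ :=
      LinearMap.range_eq_top.2 (Q.qM.submersion x)
    rw [hr, finrank_top, finrank_euclideanSpace_fin] at h2
    rw [hk] at h1
    have h3 : Module.finrank ℝ (LinearMap.range (sharpComp om x)) = Q.qM.dim := by omega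
    exact h3
  · intro v e hv he x
    exact (hP x).contraction_mem hη (Q.mem_coframeDom x) (he x) (hv.2 x)
  · intro v w s hv hw ⟨e, he, hse⟩ x
    exact (hP x).flat hv hw he hse (Q.mem_coframeDom x) (hinv v w hv hw x)
  · intro v e hv he h0 x
    exact (hP x).contraction_eta hs hl hη hd (Q.mem_coframeDom x) (he x) (hv.2 x) (h0 x)

end Forward

/-! ## The representation of the submersion groupoid -/

section Transport

variable {n m : ℕ} {M : Type u} [TopologicalSpace M] [ChartedSpace (EuclideanSpace ℝ (Fin n)) M]
  {F : Type w} [NormedAddCommGroup F] [NormedSpace ℝ F]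
  {E : M → Type v} [∀ x, AddCommGroup (E x)] [∀ x, Module ℝ (E x)]
  [∀ x, TopologicalSpace (E x)] [TopologicalSpace (TotalSpace F E)]
  [FiberBundle F E] [VectorBundle ℝ F E]
  (Q : BundleSimpleQuotient (n := n) F E)

/-- The quotient fibers over q(x) and q(y) are different types even when q(x) = q(y), so their
vectors are compared either as points of the total space or by their coordinates in a common
trivialization. -/
theorem BundleSimpleQuotient.coframe_eq_coframe_iff {b₀ : Q.qM.base} {x y : M}
    (hx : x ∈ Q.coframeDom b₀) (hxy : Q.qM.map x = Q.qM.map y) {a : E x} {c : E y} :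
    Q.coframe b₀ x a = Q.coframe b₀ y c ↔ Q.map ⟨x, a⟩ = Q.map ⟨y, c⟩ := by
  have hy : y ∈ Q.coframeDom b₀ := by
    rw [coframeDom, mem_preimage, ← hxy]
    exact hx
  set t := trivializationAt (EuclideanSpace ℝ (Fin Q.rk)) Q.fib b₀ with ht
  have hmx : Q.map ⟨x, a⟩ ∈ t.source := t.mem_source.2 hx.1
  have hmy : Q.map ⟨y, c⟩ ∈ t.source := t.mem_source.2 hy.1
  have h1 : t (Q.map ⟨x, a⟩) = (Q.qM.map x, Q.coframe b₀ x a) :=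
    Prod.ext (t.coe_fst hmx) (fibCoord_eq hx.1 _).symm
  have h2 : t (Q.map ⟨y, c⟩) = (Q.qM.map y, Q.coframe b₀ y c) :=
    Prod.ext (t.coe_fst hmy) (fibCoord_eq hy.1 _).symm
  refine Iff.trans ?_ (t.injOn.eq_iff hmx hmy)
  refine Iff.trans ?_ (iff_of_eq (congrArg₂ (· = ·) h1 h2)).symm
  rw [Prod.mk.injEq, and_iff_right hxy]

/-- Both E_x/K_x and E_y/K_y are isomorphic to the fiber of the quotient bundle over the common base
point; Δ is the composite of one isomorphism with the inverse of the other. -/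
theorem BundleSimpleQuotient.exists_transport {K : ∀ x : M, Submodule ℝ (E x)}
    (hK : ∀ x a, a ∈ K x ↔ Q.fibMap x a = 0) :
    ∃ Δ : ∀ x y : M, (E y ⧸ K y) →ₗ[ℝ] (E x ⧸ K x), ∀ x y, Q.qM.map x = Q.qM.map y →
      ∀ a c, Δ x y ((K y).mkQ c) = (K x).mkQ a ↔ Q.map ⟨x, a⟩ = Q.map ⟨y, c⟩ := by
  have h : ∀ x y : M, ∃ L : (E y ⧸ K y) →ₗ[ℝ] (E x ⧸ K x), Q.qM.map x = Q.qM.map y →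
      ∀ a c, L ((K y).mkQ c) = (K x).mkQ a ↔ Q.map ⟨x, a⟩ = Q.map ⟨y, c⟩ := by
    intro x y
    by_cases hxy : Q.qM.map x = Q.qM.map y
    · have hx := Q.mem_coframeDom x
      have hy : y ∈ Q.coframeDom (Q.qM.map x) := by
        rw [hxy]
        exact Q.mem_coframeDom y
      have hker : ∀ z ∈ Q.coframeDom (Q.qM.map x), K z = LinearMap.ker (Q.coframe (Q.qM.map x) z) := by
        intro z hz
        ext a
        rw [hK, LinearMap.mem_ker, ← map_zero (Q.coframe (Q.qM.map x) z), Q.coframe_eq_iff hz,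
          map_zero]
      let β := (Submodule.quotEquivOfEq _ _ (hker x hx)).trans
        ((Q.coframe (Q.qM.map x) x).quotKerEquivOfSurjective (Q.coframe_surjective hx))
      have hβ : ∀ a, β ((K x).mkQ a) = Q.coframe (Q.qM.map x) x a := fun a => rfl
      refine ⟨β.symm.toLinearMap ∘ₗ (K y).liftQ (Q.coframe (Q.qM.map x) y) (hker y hy).le,
        fun _ a c => ?_⟩
      rw [← Q.coframe_eq_coframe_iff hx hxy, LinearMap.comp_apply, Submodule.mkQ_apply,
        Submodule.liftQ_apply, LinearEquiv.coe_coe, LinearEquiv.symm_apply_eq, hβ, eq_comm]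
    -- Off the submersion groupoid the value is irrelevant.
    · exact ⟨0, fun h => absurd h hxy⟩
  choose Δ hΔ using h
  exact ⟨Δ, hΔ⟩

variable [IsManifold (𝓡 n) ∞ M] [ContMDiffVectorBundle ∞ F E (𝓡 n)] [FiniteDimensional ℝ F]

variable {Q} in
theorem BundleSimpleQuotient.isSubmersionGroupoidRep {K : ∀ x : M, Submodule ℝ (E x)}
    {Δ : ∀ x y : M, (E y ⧸ K y) →ₗ[ℝ] (E x ⧸ K x)}
    (hΔ : ∀ x y, Q.qM.map x = Q.qM.map y →
      ∀ a c, Δ x y ((K y).mkQ c) = (K x).mkQ a ↔ Q.map ⟨x, a⟩ = Q.map ⟨y, c⟩) :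
    IsSubmersionGroupoidRep n F Q.qM.map K Δ where
  id_law x := by
    refine LinearMap.ext fun z => ?_
    obtain ⟨a, rfl⟩ := (K x).mkQ_surjective z
    exact (hΔ x x rfl a a).2 rfl
  comp_law x y z hxy hyz := by
    refine LinearMap.ext fun c => ?_
    obtain ⟨c, rfl⟩ := (K z).mkQ_surjective c
    obtain ⟨b, hb⟩ := (K y).mkQ_surjective (Δ y z ((K z).mkQ c))
    obtain ⟨a, ha⟩ := (K x).mkQ_surjective (Δ x y ((K y).mkQ b))
    rw [LinearMap.comp_apply, ← hb, ← ha]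
    exact ((hΔ x z (hxy.trans hyz) a c).2 (((hΔ x y hxy a b).1 ha.symm).trans
      ((hΔ y z hyz b c).1 hb.symm))).symm
  smooth x₀ e₀ h0 := by
    have hP := Q.isSmoothCoframeOn (Q.qM.map x₀)
    set P := Q.coframe (Q.qM.map x₀)
    obtain ⟨R, hR⟩ := hP.exists_lift (Q.isOpen_coframeDom _) (Q.mem_coframeDom x₀)
      (Q.coframe_surjective (Q.mem_coframeDom x₀))
    obtain ⟨V, hV, hVo, hxV⟩ := eventually_nhds_iff.1 hR
    have he₀ : e₀.proj ∈ Q.coframeDom (Q.qM.map x₀) := by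
      rw [h0]
      exact Q.mem_coframeDom _
    -- The representative of the action takes the coframe value of e and lifts it to E_x by the
    -- smooth right inverse `R`; it is defined also for q(x) ≠ q(y).
    refine ⟨V ×ˢ (TotalSpace.proj ⁻¹' Q.coframeDom (Q.qM.map x₀)),
      fun p => ⟨p.1, fibVec E x₀ p.1 (R p.1 (P p.2.proj p.2.2))⟩,
      hVo.prod ((Q.isOpen_coframeDom _).preimage (FiberBundle.continuous_proj F E)),
      ⟨hxV, he₀⟩, ?_, ?_⟩
    · rintro ⟨x, e⟩ ⟨hx, he⟩
      refine ContMDiffAt.contMDiffWithinAt ?_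
      have hmem : (⟨x, fibVec E x₀ x (R x (P e.proj e.2))⟩ : TotalSpace F E) ∈
          (trivializationAt F E x₀).source := (Trivialization.mem_source _).2 (hV x hx).2.1
      refine (Trivialization.contMDiffAt_iff (e := trivializationAt F E x₀)
        (f := fun p : M × TotalSpace F E => (⟨p.1, fibVec E x₀ p.1 (R p.1 (P p.2.proj p.2.2))⟩ :
          TotalSpace F E)) (x₀ := (x, e)) hmem).2 ⟨contMDiffAt_fst, ?_⟩
      have h1 : ContMDiffAt ((𝓡 n).prod ((𝓡 n).prod 𝓘(ℝ, F)))
          𝓘(ℝ, EuclideanSpace ℝ (Fin Q.rk) →L[ℝ] F) ∞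
          (fun p : M × TotalSpace F E => R p.1) (x, e) :=
        (hV x hx).2.2.1.comp (x, e) contMDiffAt_fst
      have h2 : ContMDiffAt ((𝓡 n).prod ((𝓡 n).prod 𝓘(ℝ, F)))
          𝓘(ℝ, EuclideanSpace ℝ (Fin Q.rk)) ∞
          (fun p : M × TotalSpace F E => P p.2.proj p.2.2) (x, e) :=
        ContMDiffAt.comp (x, e) (g := fun e : TotalSpace F E => P e.proj e.2) (hP e he)
          contMDiffAt_snd
      refine (h1.clm_apply h2).congr_of_eventuallyEq ?_
      filter_upwards [continuousAt_fst.preimage_mem_nhds (hVo.mem_nhds hx)] with p hp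
      exact (fibCoord_eq (hV p.1 hp).2.1 _).symm.trans (fibCoord_fibVec (hV p.1 hp).2.1 _)
    · rintro ⟨x, e⟩ ⟨hx, he⟩ hq
      refine ⟨_, rfl, ?_⟩
      exact ((hΔ x e.proj hq _ e.2).2 ((Q.coframe_eq_coframe_iff (hV x hx).1 hq).1
        ((hV x hx).2.2.2 _))).symm

theorem continuous_fibVec (x₀ x : M) : Continuous (fibVec E x₀ x : F → E x) := by
  by_cases hx : x ∈ bundleDom F E x₀
  · have : (fibVec E x₀ x : F → E x) = (trivializationAt F E x₀).symmL ℝ x := by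
      funext f
      rw [fibVec_eq hx, Trivialization.symmL_apply _ hx]
    rw [this]
    exact ContinuousLinearMap.continuous _
  · have : (fibVec E x₀ x : F → E x) = fun _ => 0 := by
      funext f
      exact Trivialization.symmₗ_apply_of_notMem _ hx f
    rw [this]
    exact continuous_const

variable {om : FormField ((𝓡 n).prod 𝓘(ℝ, F)) (TotalSpace F E) (m + 2)} {Q}

theorem hasDerivAt_comp_curve {G : Type*} [NormedAddCommGroup G] [NormedSpace ℝ G] {γ : ℝ → M}
    (hγ : ContMDiff 𝓘(ℝ, ℝ) (𝓡 n) ∞ γ) {S : M → G} (hS : MDifferentiableAt (𝓡 n) 𝓘(ℝ, G) S (γ 0)) :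
    HasDerivAt (S ∘ γ) (modelDeriv (𝓡 n) 𝓘(ℝ, G) S (γ 0)
      (modelDeriv 𝓘(ℝ, ℝ) (𝓡 n) γ 0 1)) 0 := by
  have hγd : MDifferentiableAt 𝓘(ℝ, ℝ) (𝓡 n) γ 0 := (hγ 0).mdifferentiableAt (by simp)
  have h1 : DifferentiableAt ℝ (S ∘ γ) 0 := (hS.comp (0 : ℝ) hγd).differentiableAt
  have h2 := congrArg (fun L => L 1) (modelDeriv_comp hS hγd)
  simp only [modelDeriv_eq_fderiv, ContinuousLinearMap.comp_apply] at h2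
  rw [← h2]
  exact h1.hasDerivAt

/-- In the coframe, Δ leaves the coordinates unchanged, so the difference quotient of transported
values is that of the vector-valued function S = P e along γ, with limit γ'(0) S = P(∇̄ s). -/
theorem BundleSimpleQuotient.Integrates.integratesNablaBar
    (h : Q.Integrates (kerForm om)) (hs : IsSmoothForm om)
    (hl : IsLocallyLinear om) (hη : KerMuLeKerEta om)
    {Δ : ∀ x y : M, (E y ⧸ kerMu om y) →ₗ[ℝ] (E x ⧸ kerMu om x)}
    (hΔ : ∀ x y, Q.qM.map x = Q.qM.map y →
      ∀ a c, Δ x y ((kerMu om y).mkQ c) = (kerMu om x).mkQ a ↔ Q.map ⟨x, a⟩ = Q.map ⟨y, c⟩) :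
    IntegratesNablaBar om Q.qM.map Δ := by
  intro γ s hγ hγq ⟨e, he, hse⟩
  have hP := h.isAdaptedCoframe hs hl hη (Q.qM.map (γ 0))
  have hx := Q.mem_coframeDom (γ 0)
  set P := Q.coframe (Q.qM.map (γ 0))
  obtain ⟨R, hR⟩ := hP.smooth.exists_lift hP.isOpen hx (hP.surj _ hx)
  have hRP := hR.self_of_nhds.2.2.2
  set S : M → EuclideanSpace ℝ (Fin Q.rk) := fun z => P z (e z) with hS
  have hSs := hP.smooth.apply hx (he (γ 0))
  -- This map reconstructs a class in E/Ker μ from its coframe value; its continuity transfers the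
  -- limit from coordinates to the quotient.
  let r : EuclideanSpace ℝ (Fin Q.rk) →ₗ[ℝ] E (γ 0) ⧸ kerMu om (γ 0) :=
    (kerMu om (γ 0)).mkQ ∘ₗ fibVec E (γ 0) (γ 0) ∘ₗ (R (γ 0)).toLinearMap
  have hr : Continuous r :=
    continuous_quot_mk.comp ((continuous_fibVec (γ 0) (γ 0)).comp (R (γ 0)).continuous)
  set v : EuclideanSpace ℝ (Fin n) := modelDeriv 𝓘(ℝ, ℝ) (𝓡 n) γ 0 1 with hv
  have hd := hasDerivAt_comp_curve hγ (S := S) (hSs.mdifferentiableAt (by simp))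
  have hvk : v ∈ kerMuSharp om (γ 0) := by
    rw [h.mem_kerMuSharp_iff hs hl]
    have h1 := modelDeriv_comp (I := 𝓘(ℝ, ℝ)) (f := γ) (x := (0 : ℝ))
      ((Q.qM.smooth (γ 0)).mdifferentiableAt (by simp)) ((hγ 0).mdifferentiableAt (by simp))
    have h2 : Q.qM.map ∘ γ = fun _ => Q.qM.map (γ 0) := funext hγq
    have h3 : modelDeriv 𝓘(ℝ, ℝ) (𝓡 Q.qM.dim) (fun _ : ℝ => Q.qM.map (γ 0)) 0 = 0 := mfderiv_const
    rw [h2, h3] at h1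
    exact (congrArg (fun L => L 1) h1).symm
  have hn : nablaBar om (x := γ 0) v s =
      r (modelDeriv (𝓡 n) 𝓘(ℝ, EuclideanSpace ℝ (Fin Q.rk)) S (γ 0) v) :=
    hP.nablaBar_eq hx hvk (he (γ 0)) (Eventually.of_forall hse) (hRP _)
  have hrS : ∀ ε, Δ (γ 0) (γ ε) (s (γ ε)) = r (S (γ ε)) := by
    intro ε
    rw [hse]
    exact (hΔ _ _ (hγq ε).symm _ _).2 ((Q.coframe_eq_coframe_iff hx (hγq ε).symm).1 (hRP _))
  have hr0 : s (γ 0) = r (S (γ 0)) := by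
    rw [hse]
    exact (hP.apply_eq_iff hx).1 (hRP _).symm
  have ht := (hr.tendsto _).comp hd.tendsto_slope_zero
  refine (hn ▸ ht).congr fun ε => ?_
  rw [hrS, hr0, comp_apply, map_smul, map_sub, zero_add]
  rfl

end Transport

/-! ## Basic forms of a submersion -/

section BasicForms

/-! ### Forms on a vector space that are killed by the kernel of a linear map. -/

section Linear

variable {V : Type*} [NormedAddCommGroup V] [NormedSpace ℝ V]

/-- Exchange the entries one at a time; each exchange alters the value by the form on a tuple
containing a kernel vector. -/
theorem map_eq_of_curryLeft_sub_eq_zero {k : ℕ} {α : V [⋀^Fin (k + 1)]→L[ℝ] ℝ}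
    {z z' : Fin (k + 1) → V} (h : ∀ i, α.curryLeft (z i - z' i) = 0) : α z = α z' := by
  classical
  have key : ∀ s : Finset (Fin (k + 1)), α (s.piecewise z z') = α z' := by
    intro s
    induction s using Finset.induction_on with
    | empty => rw [Finset.piecewise_empty]
    | insert i s hi ih =>
      have h1 := α.map_update_add (s.piecewise z z') i (z i - z' i) (z' i)
      have h2 : update (s.piecewise z z') i (z' i) = s.piecewise z z' := by
        rw [update_eq_self_iff, Finset.piecewise_eq_of_notMem _ _ _ hi]
      rw [sub_add_cancel, h2, ih,
        map_eq_zero_of_curryLeft_eq_zero (h i) (i := i) (update_self _ _ _), zero_add] at h1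
      rw [Finset.piecewise_insert, h1]
  rw [← key Finset.univ, Finset.piecewise_univ]

theorem curryLeft_comp_eq_zero {V' : Type*} [NormedAddCommGroup V'] [NormedSpace ℝ V'] {k : ℕ}
    {α : V' [⋀^Fin (k + 1)]→L[ℝ] ℝ} {T : V →L[ℝ] V'} {z : V} (h : α.curryLeft (T z) = 0) :
    (α.compContinuousLinearMap T).curryLeft z = 0 := by
  ext w
  refine Eq.trans (congrArg α ?_) (curryLeft_eq_zero_iff.1 h fun i => T (w i))
  ext i
  cases i using Fin.cases <;> rfl

/-- This is Cartan's formula for the constant field z: the derivative of β along z is i_z dβ + d(i_z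
β), and both terms vanish. -/
theorem fderiv_apply_eq_zero_of_curryLeft {k : ℕ} {β : V → V [⋀^Fin (k + 1)]→L[ℝ] ℝ} {y z : V}
    (hβ : DifferentiableAt ℝ β y) (h0 : ∀ᶠ y' in 𝓝 y, (β y').curryLeft z = 0)
    (h1 : (extDeriv β y).curryLeft z = 0) : fderiv ℝ β y z = 0 := by
  ext w
  have h2 : extDeriv β y (Matrix.vecCons z w) = 0 := curryLeft_eq_zero_iff.1 h1 w
  have h3 : ∀ i : Fin (k + 1), fderiv ℝ β y (w i) (Matrix.vecCons z (i.removeNth w)) = 0 := by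
    intro i
    have h4 : HasFDerivAt (fun y' => (β y').curryLeft z)
        (((ContinuousLinearMap.apply ℝ _ z).comp
          (ContinuousAlternatingMap.curryLeftLI (𝕜 := ℝ) (E := V) (F := ℝ)
            (n := k)).toContinuousLinearMap).comp (fderiv ℝ β y)) y :=
      ((ContinuousLinearMap.apply ℝ _ z).comp (ContinuousAlternatingMap.curryLeftLI (𝕜 := ℝ)
        (E := V) (F := ℝ) (n := k)).toContinuousLinearMap).hasFDerivAt.comp y hβ.hasFDerivAt
    have h5 := (h4.congr_of_eventuallyEq (h0.mono fun y' hy' => hy'.symm)).unique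
      (hasFDerivAt_const 0 y)
    exact congrArg (fun L => L (w i) (i.removeNth w)) h5
  rw [extDeriv, ContinuousAlternatingMap.alternatizeUncurryFin_apply, Fin.sum_univ_succ] at h2
  simp only [Fin.val_zero, pow_zero, one_smul, Matrix.cons_val_zero, Matrix.cons_val_succ,
    removeNth_succ_vecCons, h3, smul_zero, Finset.sum_const_zero, add_zero] at h2
  exact h2

/-- A form which is killed by the vectors in `Ker L`, and whose exterior derivative is too, is
constant along `Ker L`. -/
theorem eq_at_zero_of_curryLeft {V' : Type*} [NormedAddCommGroup V'] [NormedSpace ℝ V'] {k : ℕ}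
    {β : V → V [⋀^Fin (k + 1)]→L[ℝ] ℝ} {L : V →L[ℝ] V'} {δ : ℝ}
    (hβ : ∀ y ∈ Metric.ball (0 : V) δ, DifferentiableAt ℝ β y)
    (h0 : ∀ y ∈ Metric.ball (0 : V) δ, ∀ z, L z = 0 → (β y).curryLeft z = 0)
    (h1 : ∀ y ∈ Metric.ball (0 : V) δ, ∀ z, L z = 0 → (extDeriv β y).curryLeft z = 0)
    {u : V} (hu : u ∈ Metric.ball (0 : V) δ) (hLu : L u = 0) : β u = β 0 := by
  have hmem : ∀ t ∈ Icc (0 : ℝ) 1, t • u ∈ Metric.ball (0 : V) δ := by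
    intro t ht
    rw [mem_ball_zero_iff] at hu ⊢
    rw [norm_smul, Real.norm_of_nonneg ht.1]
    exact (mul_le_of_le_one_left (norm_nonneg u) ht.2).trans_lt hu
  have hd : ∀ t ∈ Icc (0 : ℝ) 1, HasDerivAt (fun t : ℝ => β (t • u)) 0 t := by
    intro t ht
    have h2 := (hβ _ (hmem t ht)).hasFDerivAt.comp_hasDerivAt t
      ((hasDerivAt_id t).smul_const u)
    rw [one_smul, fderiv_apply_eq_zero_of_curryLeft (hβ _ (hmem t ht)) ?_
      (h1 _ (hmem t ht) u hLu)] at h2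
    · exact h2
    · filter_upwards [Metric.isOpen_ball.mem_nhds (hmem t ht)] with y hy using h0 y hy u hLu
  have h3 := constant_of_has_deriv_right_zero
    (fun t ht => (hd t ht).continuousAt.continuousWithinAt)
    (fun t ht => (hd t ⟨ht.1, ht.2.le⟩).hasDerivWithinAt) 1 ⟨zero_le_one, le_rfl⟩
  simpa using h3

end Linear

variable {V : Type*} [NormedAddCommGroup V] [NormedSpace ℝ V] [FiniteDimensional ℝ V]
  {H : Type*} [TopologicalSpace H] {I : ModelWithCorners ℝ V H} [I.Boundaryless]
  {X : Type*} [TopologicalSpace X] [ChartedSpace H X] [IsManifold I ∞ X]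
  {V' : Type*} [NormedAddCommGroup V'] [NormedSpace ℝ V'] [FiniteDimensional ℝ V']
  {H' : Type*} [TopologicalSpace H'] {I' : ModelWithCorners ℝ V' H'} [I'.Boundaryless]
  {X' : Type*} [TopologicalSpace X'] [ChartedSpace H' X'] [IsManifold I' ∞ X']
  {f : X → X'} {k : ℕ} {β : FormField I X (k + 1)}

/-- The induced forms on the tangent spaces of the target are locally constant along the fibers. -/
theorem exists_fiberwise_pushforward (hf : ContMDiff I I' ∞ f)
    (hsub : ∀ x, Surjective (modelDeriv I I' f x)) (hβ : IsSmoothForm β)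
    (h0 : ∀ x v, modelDeriv I I' f x v = 0 → (β.at x).curryLeft v = 0)
    (h1 : ∀ x v, modelDeriv I I' f x v = 0 → ((extD β).at x).curryLeft v = 0) :
    ∃ W : X → V' [⋀^Fin (k + 1)]→L[ℝ] ℝ,
      (∀ x, (W x).compContinuousLinearMap (modelDeriv I I' f x) = β.at x) ∧
      ∀ x₀, ∀ᶠ x in 𝓝 x₀, f x = f x₀ → W x = W x₀ := by
  have : CompleteSpace V := FiniteDimensional.complete ℝ V
  choose S hS using fun x => exists_rightInverse_of_surjective (hsub x)
  have hS' : ∀ x z, modelDeriv I I' f x (S x z) = z := fun x z => congrArg (fun T => T z) (hS x)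
  set W : X → V' [⋀^Fin (k + 1)]→L[ℝ] ℝ := fun x => (β.at x).compContinuousLinearMap (S x) with hW
  have hWβ : ∀ x, (W x).compContinuousLinearMap (modelDeriv I I' f x) = β.at x := by
    intro x
    ext z
    refine map_eq_of_curryLeft_sub_eq_zero (z := fun i => S x (modelDeriv I I' f x (z i)))
      fun i => h0 x _ ?_
    rw [map_sub, hS', sub_self]
  refine ⟨W, hWβ, fun x₀ => ?_⟩
  obtain ⟨ψ, δ, hδ, hψ0, hψ, hψd, hψn⟩ := exists_submersion_chart hf x₀ (hS x₀)
  set L := modelDeriv I I' f x₀ with hL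
  have hsymm : ∀ u ∈ Metric.ball (0 : V) δ,
      (modelDeriv I I' f (ψ u)).comp (modelDeriv 𝓘(ℝ, V) I ψ u) =
        (modelDeriv 𝓘(ℝ, V') I' (extChartAt I' (f x₀)).symm
          (extChartAt I' (f x₀) (f x₀) + L u)).comp L := by
    intro u hu
    have h2 : f ∘ ψ =ᶠ[𝓝 u] (extChartAt I' (f x₀)).symm ∘
        fun u => extChartAt I' (f x₀) (f x₀) + L u := by
      filter_upwards [Metric.isOpen_ball.mem_nhds hu] with u' hu' using (hψ u' hu').2.2
    have h3 : HasFDerivAt (fun u => extChartAt I' (f x₀) (f x₀) + L u) L u :=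
      L.hasFDerivAt.const_add _
    rw [← modelDeriv_comp ((hf _).mdifferentiableAt (by simp))
      ((hψ u hu).1.mdifferentiableAt (by simp)), modelDeriv_congr h2,
      modelDeriv_comp (I := 𝓘(ℝ, V)) (I' := 𝓘(ℝ, V')) (x := u)
        (f := fun u => extChartAt I' (f x₀) (f x₀) + L u) (mdifferentiableAt_extChartAt_symm (hψ u hu).2.1)
        h3.differentiableAt.mdifferentiableAt, modelDeriv_eq_fderiv, h3.fderiv]
  have hker : ∀ u ∈ Metric.ball (0 : V) δ, ∀ z, L z = 0 →
      modelDeriv I I' f (ψ u) (modelDeriv 𝓘(ℝ, V) I ψ u z) = 0 := by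
    intro u hu z hz
    rw [← ContinuousLinearMap.comp_apply, hsymm u hu, ContinuousLinearMap.comp_apply, hz, map_zero]
  have hconst : ∀ u ∈ Metric.ball (0 : V) δ, L u = 0 → formPull ψ β u = formPull ψ β 0 := by
    intro u hu hLu
    refine eq_at_zero_of_curryLeft (L := L)
      (fun y hy => (hβ.contDiffAt_formPull (hψ y hy).1).differentiableAt (by simp))
      (fun y hy z hz => curryLeft_comp_eq_zero (h0 _ _ (hker y hy z hz))) (fun y hy z hz => ?_) hu hLu
    rw [extDeriv_formPull hβ (hψ y hy).1]
    exact curryLeft_comp_eq_zero (h1 _ _ (hker y hy z hz))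
  filter_upwards [hψn] with x hx hfx
  obtain ⟨u, hu, rfl⟩ := hx
  have hLu : L u = 0 := by
    rw [(hψ u hu).2.2] at hfx
    have := congrArg (extChartAt I' (f x₀)) hfx
    rw [(extChartAt I' (f x₀)).right_inv (hψ u hu).2.1] at this
    simpa using this
  -- On the slice L u = 0 the point f(ψ u) stays at the center of its chart, so the derivative of f
  -- ∘ ψ is L itself and the pullback of β determines W(ψ u).
  have hWL : ∀ u ∈ Metric.ball (0 : V) δ, L u = 0 →
      formPull ψ β u = (W (ψ u)).compContinuousLinearMap L := by
    intro u hu hLu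
    have h4 := hsymm u hu
    rw [hLu, add_zero, modelDeriv_extChartAt_symm_self, ContinuousLinearMap.id_comp] at h4
    rw [formPull, ← hWβ, ← h4]
    rfl
  have h5 := hconst u hu hLu
  rw [hWL u hu hLu, hWL 0 (Metric.mem_ball_self hδ) (map_zero L), hψ0] at h5
  ext z
  have h6 := congrArg (fun α => α fun i => S x₀ (z i)) h5
  have h7 : (fun i => L (S x₀ (z i))) = z := funext fun i => hS' x₀ (z i)
  exact h7 ▸ h6

/-- A form which is killed by the vertical vectors of a submersion, together with its exterior
derivative, is basic when locally constant functions on the fibers are constant. -/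
theorem exists_pushforward (hf : ContMDiff I I' ∞ f) (hfs : Surjective f)
    (hsub : ∀ x, Surjective (modelDeriv I I' f x)) (hβ : IsSmoothForm β)
    (h0 : ∀ x v, modelDeriv I I' f x v = 0 → (β.at x).curryLeft v = 0)
    (h1 : ∀ x v, modelDeriv I I' f x v = 0 → ((extD β).at x).curryLeft v = 0)
    (hc : ∀ g : X → V' [⋀^Fin (k + 1)]→L[ℝ] ℝ,
      (∀ x₀, ∀ᶠ x in 𝓝 x₀, f x = f x₀ → g x = g x₀) → ∀ x y, f x = f y → g x = g y) :
    ∃ β' : FormField I' X' (k + 1), IsSmoothForm β' ∧ pullbackForm f β' = β := by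
  obtain ⟨W, hWβ, hW⟩ := exists_fiberwise_pushforward hf hsub hβ h0 h1
  have hWc := hc W hW
  -- A set-theoretic choice of preimages suffices, since W is constant on the fibers.
  let β' : FormField I' X' (k + 1) := fun x' => W (surjInv hfs x')
  have hβ' : ∀ x, β'.at (f x) = W x := fun x => hWc _ _ (surjInv_eq hfs (f x))
  have hpull : pullbackForm f β' = β := by
    funext x
    refine Eq.trans ?_ (hWβ x)
    rw [← hβ']
    rfl
  refine ⟨β', fun x₀' y hy => ContDiffAt.contDiffWithinAt ?_, hpull⟩
  set φ' := extChartAt I' x₀'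
  obtain ⟨x, hx⟩ := hfs (φ'.symm y)
  -- The chart expression of β' is locally the pullback of β along a local section of `f`, hence
  -- smooth.
  obtain ⟨σ, hσx, hσ⟩ := exists_local_section hf x (hsub x)
  rw [hx] at hσ
  have hφs := contMDiffAt_extChartAt_symm hy
  have h2 : ContMDiffAt 𝓘(ℝ, V') I ∞ (σ ∘ φ'.symm) y := (hσ.self_of_nhds.1).comp y hφs
  refine (hβ.contDiffAt_formPull h2).congr_of_eventuallyEq ?_
  filter_upwards [(hφs.continuousAt.tendsto.eventually hσ.eventually_nhds),
    mem_extChartAt_target_nhds hy, eventually_contMDiffAt_vectorSpace h2] with z hz hzt hzd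
  have h3 : f ∘ (σ ∘ φ'.symm) =ᶠ[𝓝 z] φ'.symm := by
    filter_upwards [(contMDiffAt_extChartAt_symm hzt).continuousAt.tendsto.eventually hz]
      with z' hz' using hz'.2
  rw [chartRep_eq_formPull, ← formPull_congr β' h3, ← hpull,
    formPull_pullbackForm β' ((hf _).mdifferentiableAt (by simp)) hzd]

/-- A kernel vector downstairs lifts to a kernel vector of β; such a vector is vertical, so its
image is zero. -/
theorem kerForm_eq_bot_of_pullbackForm (hfs : Surjective f)
    (hsub : ∀ x, Surjective (modelDeriv I I' f x)) {β' : FormField I' X' (k + 1)}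
    (hpull : pullbackForm f β' = β)
    (hker : ∀ x (v : V), v ∈ kerForm β x → modelDeriv I I' f x v = 0) (x' : X') :
    kerForm β' x' = ⊥ := by
  obtain ⟨x, rfl⟩ := hfs x'
  rw [eq_bot_iff]
  intro v' hv'
  obtain ⟨v, hv⟩ := hsub x v'
  have hv0 : (β'.at (f x)).curryLeft (modelDeriv I I' f x v) = 0 := by
    have h2 : iprod (β'.at (f x)) (modelDeriv I I' f x v) = 0 :=
      (congrArg (iprod (β'.at (f x))) hv).trans hv'
    rwa [iprod_eq_curryLeft] at h2
  have h1 : v ∈ kerForm β x := by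
    have h2 := curryLeft_comp_eq_zero hv0
    rw [← iprod_eq_curryLeft] at h2
    rw [← hpull]
    exact h2
  exact hv.symm.trans (hker x v h1)

end BasicForms

/-! ## The quotient form -/

section QuotientForm

variable {n m : ℕ} {M : Type u} [TopologicalSpace M] [ChartedSpace (EuclideanSpace ℝ (Fin n)) M]
  {F : Type w} [NormedAddCommGroup F] [NormedSpace ℝ F] [FiniteDimensional ℝ F]
  {E : M → Type v} [∀ x, AddCommGroup (E x)] [∀ x, Module ℝ (E x)]
  [∀ x, TopologicalSpace (E x)] [TopologicalSpace (TotalSpace F E)]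
  [FiberBundle F E] [VectorBundle ℝ F E]
  [IsManifold (𝓡 n) ∞ M] [ContMDiffVectorBundle ∞ F E (𝓡 n)]
  (Q : BundleSimpleQuotient (n := n) F E)

theorem BundleSimpleQuotient.map_mk_eq_iff {x : M} {a b : E x} :
    Q.map ⟨x, a⟩ = Q.map ⟨x, b⟩ ↔ Q.fibMap x a = Q.fibMap x b := by
  rw [← Q.coframe_eq_coframe_iff (Q.mem_coframeDom x) rfl, Q.coframe_eq_iff (Q.mem_coframeDom x)]

theorem BundleSimpleQuotient.map_surjective : Surjective Q.map := by
  rintro ⟨b, c⟩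
  obtain ⟨x, rfl⟩ := Q.qM.surjective b
  obtain ⟨a, rfl⟩ := Q.fib_surjective x c
  exact ⟨⟨x, a⟩, rfl⟩

/-- Locally constant functions on the fibers of the quotient map are constant. -/
theorem BundleSimpleQuotient.eq_of_locally_eq {Z : Type*} {g : TotalSpace F E → Z}
    (hg : ∀ e₀, ∀ᶠ e in 𝓝 e₀, Q.map e = Q.map e₀ → g e = g e₀) {e e' : TotalSpace F E}
    (h : Q.map e = Q.map e') : g e = g e' := by
  -- Inside one E_x the points with a given image form an affine subspace, so two of them are joined
  -- by a segment on which `g` is locally constant.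
  have hfib : ∀ (x : M) (a b : E x), Q.map ⟨x, a⟩ = Q.map ⟨x, b⟩ → g ⟨x, a⟩ = g ⟨x, b⟩ := by
    intro x a b hab
    rw [Q.map_mk_eq_iff] at hab
    set c : ℝ → TotalSpace F E := fun t =>
      ⟨x, fibVec E x x (fibCoord F x x a + t • fibCoord F x x (b - a))⟩ with hc
    have hct : ∀ t, c t = ⟨x, a + t • (b - a)⟩ := by
      intro t
      simp only [hc, ← map_smul, ← map_add]
      exact congrArg (TotalSpace.mk x) (fibVec_fibCoord (mem_bundleDom x) _)
    have hcc : Continuous c :=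
      (contMDiff_fiber_inclusion (n := n) (E := E) (F := F) x).continuous.comp (by fun_prop)
    have hcQ : ∀ t, Q.map (c t) = Q.map ⟨x, a⟩ := by
      intro t
      rw [hct, Q.map_mk_eq_iff, map_add, map_smul, map_sub, hab, sub_self, smul_zero, add_zero]
    have hl : IsLocallyConstant fun t => g (c t) := by
      rw [IsLocallyConstant.iff_eventually_eq]
      intro t
      filter_upwards [hcc.continuousAt.tendsto.eventually (hg (c t))] with t' ht'
      exact ht' ((hcQ t').trans (hcQ t).symm)
    have h1 := hl.apply_eq_of_preconnectedSpace 0 1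
    simpa only [hct, zero_smul, one_smul, add_zero, add_sub_cancel] using h1
  have hex : ∀ x : {x // Q.qM.map x = Q.qM.map e.proj}, ∃ a : E x, Q.map ⟨x, a⟩ = Q.map e := by
    rintro ⟨x, hx⟩
    have hxd : x ∈ Q.coframeDom (Q.qM.map e.proj) := by
      rw [coframeDom, mem_preimage, hx]
      exact Q.mem_coframeDom e.proj
    obtain ⟨a, ha⟩ := Q.coframe_surjective hxd (Q.coframe (Q.qM.map e.proj) e.proj e.2)
    exact ⟨a, (Q.coframe_eq_coframe_iff hxd hx).1 ha⟩
  choose a ha using hex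
  -- By `hfib` the value of `g` is independent of the chosen lift `a x`, which may therefore be
  -- replaced near each point by a continuous lift `s` with constant coframe value. Connectedness of
  -- the fiber of q_M then concludes.
  have hl : IsLocallyConstant fun x : {x // Q.qM.map x = Q.qM.map e.proj} =>
      g ⟨x, a x⟩ := by
    rw [IsLocallyConstant.iff_eventually_eq]
    intro x₀
    have hx₀ := Q.mem_coframeDom x₀.1
    obtain ⟨R, hR⟩ := (Q.isSmoothCoframeOn (Q.qM.map x₀.1)).exists_lift
      (Q.isOpen_coframeDom _) hx₀ (Q.coframe_surjective hx₀)
    set z := Q.coframe (Q.qM.map x₀.1) x₀ (a x₀)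
    set s : ∀ x, E x := fun x => fibVec E x₀.1 x (R x z) with hs
    have hss : ContinuousAt (fun x => (⟨x, s x⟩ : TotalSpace F E)) x₀.1 :=
      ContMDiffAt.continuousAt (isSmoothSecAt_fibVec (mem_bundleDom _)
        (hR.self_of_nhds.2.2.1.clm_apply contMDiffAt_const))
    have hQs : ∀ᶠ x in 𝓝 x₀.1, Q.qM.map x = Q.qM.map x₀.1 → Q.map ⟨x, s x⟩ = Q.map ⟨x₀, a x₀⟩ := by
      filter_upwards [hR] with x hx hq
      exact (Q.coframe_eq_coframe_iff hx.1 hq).1 (hx.2.2.2 z)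
    filter_upwards [continuousAt_subtype_val.tendsto.eventually hQs,
      continuousAt_subtype_val.tendsto.eventually (hss.tendsto.eventually (hg _))] with x hx hx'
    have h1 := hx (x.2.trans x₀.2.symm)
    have h2 := hQs.self_of_nhds rfl
    rw [hfib x (a x) (s x) (by rw [h1, ha, ha]), hx' (h1.trans h2.symm), hfib x₀ _ _ h2]
  have : PreconnectedSpace {x // Q.qM.map x = Q.qM.map e.proj} :=
    isPreconnected_iff_preconnectedSpace.1 (Q.qM.connected (Q.qM.map e.proj)).isPreconnected
  have hq : Q.qM.map e'.proj = Q.qM.map e.proj := congrArg TotalSpace.proj h.symm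
  have h1 := hl.apply_eq_of_preconnectedSpace ⟨e.proj, rfl⟩ ⟨e'.proj, hq⟩
  rw [hfib e.proj _ e.2 (ha ⟨e.proj, rfl⟩),
    hfib e'.proj _ e'.2 ((ha ⟨e'.proj, hq⟩).trans h)] at h1
  exact h1

variable {om : FormField ((𝓡 n).prod 𝓘(ℝ, F)) (TotalSpace F E) (m + 2)} {Q}

theorem BundleSimpleQuotient.Integrates.exists_quotientForm (h : Q.Integrates (kerForm om))
    (hs : IsSmoothForm om) (hd : ∀ e : TotalSpace F E, kerForm om e ≤ kerForm (extD om) e) :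
    ∃ om' : FormField Q.model Q.Total (m + 2), IsSmoothForm om' ∧ pullbackForm Q.map om' = om :=
  exists_pushforward Q.contMDiff_map Q.map_surjective Q.modelDeriv_map_surjective hs
    (fun e w hw => (iprod_eq_curryLeft (om.at e) w).symm.trans ((h.mem_iff e w).2 hw))
    (fun e w hw => (iprod_eq_curryLeft ((extD om).at e) w).symm.trans (hd e ((h.mem_iff e w).2 hw)))
    fun _ hg _ _ hxy => Q.eq_of_locally_eq hg hxy

theorem BundleSimpleQuotient.Integrates.kerForm_quotientForm (h : Q.Integrates (kerForm om))
    {om' : FormField Q.model Q.Total (m + 2)} (hpull : pullbackForm Q.map om' = om) (e : Q.Total) :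
    kerForm om' e = ⊥ :=
  kerForm_eq_bot_of_pullbackForm Q.map_surjective Q.modelDeriv_map_surjective hpull
    (fun e w hw => (h.mem_iff e w).1 hw) e

end QuotientForm

/-! ## Extension of vectors and local coframes of constant rank -/

section Extension

/-! ### Extension of a vertical vector to a vertical vector field. -/

section VerticalFields

variable {V : Type*} [NormedAddCommGroup V] [NormedSpace ℝ V] [FiniteDimensional ℝ V]
  {H : Type*} [TopologicalSpace H] {I : ModelWithCorners ℝ V H} [I.Boundaryless]
  {X : Type*} [TopologicalSpace X] [T2Space X] [ChartedSpace H X] [IsManifold I ∞ X]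
  {V' : Type*} [NormedAddCommGroup V'] [NormedSpace ℝ V'] [FiniteDimensional ℝ V']
  {H' : Type*} [TopologicalSpace H'] {I' : ModelWithCorners ℝ V' H'} [I'.Boundaryless]
  {X' : Type*} [TopologicalSpace X'] [ChartedSpace H' X'] [IsManifold I' ∞ X']

/-- A vertical vector of a submersion extends to a vertical vector field, supported in a given
neighbourhood. -/
theorem exists_vertical_extension {q : X → X'} (hq : ContMDiff I I' ∞ q) {x : X}
    (hs : Surjective (modelDeriv I I' q x)) {D : ∀ x : X, Submodule ℝ (TangentSpace I x)}
    (hD : ∀ x (v : V), v ∈ D x ↔ modelDeriv I I' q x v = 0) {v : V} (hv : v ∈ D x) {N : Set X}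
    (hN : N ∈ 𝓝 x) :
    ∃ W : ∀ x : X, TangentSpace I x, IsSmoothVFIn I D W ∧ W x = v ∧ ∀ z, z ∉ N → W z = 0 := by
  set φ := extChartAt I x with hφ
  set φ' := extChartAt I' (q x) with hφ'
  have hnear : ∀ᶠ z in 𝓝 x, q z ∈ φ'.source ∧ z ∈ φ.source :=
    Filter.Eventually.and
      (hq.continuous.continuousAt.preimage_mem_nhds (extChartAt_source_mem_nhds _))
      (extChartAt_source_mem_nhds x)
  set h : X → V' := φ' ∘ q with hh
  have hhs : ∀ z, q z ∈ φ'.source → ContMDiffAt I 𝓘(ℝ, V') ∞ h z := by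
    intro z hz
    rw [hφ', extChartAt_source] at hz
    exact (contMDiffAt_extChartAt' hz).comp z (hq z)
  have hhD : ∀ z, q z ∈ φ'.source → ∀ u : V, modelDeriv I 𝓘(ℝ, V') h z u = 0 ↔ u ∈ D z := by
    intro z hz u
    rw [hD, hh, modelDeriv_comp (mdifferentiableAt_extChartAt' hz)
      ((hq z).mdifferentiableAt (by simp)), ContinuousLinearMap.comp_apply,
      map_eq_zero_iff _ (modelDeriv_extChartAt_injective hz)]
  set A : X → V →L[ℝ] V' := fun z =>
    (modelDeriv I 𝓘(ℝ, V') h z).comp (modelDeriv 𝓘(ℝ, V) I φ.symm (φ z)) with hA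
  have hAs : ∀ᶠ z in 𝓝 x, ContMDiffAt I 𝓘(ℝ, V →L[ℝ] V') ∞ A z := by
    filter_upwards [hnear.eventually_nhds] with z hz
    have h1 : ContDiffAt ℝ ∞ (h ∘ φ.symm) (φ z) := by
      refine contDiffAt_comp_symm (φ.map_source hz.self_of_nhds.2) ?_
      rw [φ.left_inv hz.self_of_nhds.2]
      exact hhs z hz.self_of_nhds.1
    have h2 : ContMDiffAt I 𝓘(ℝ, V →L[ℝ] V') ∞ (fun z => fderiv ℝ (h ∘ φ.symm) (φ z)) z := by
      have h3 := hz.self_of_nhds.2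
      rw [hφ, extChartAt_source] at h3
      exact (h1.fderiv_right (m := ∞) (by simp)).contMDiffAt.comp z (contMDiffAt_extChartAt' h3)
    refine h2.congr_of_eventuallyEq ?_
    filter_upwards [hz] with z' hz'
    have h4 := modelDeriv_comp (I := 𝓘(ℝ, V)) (I' := I) (I'' := 𝓘(ℝ, V')) (f := φ.symm) (x := φ z')
      (g := h) (by rw [φ.left_inv hz'.2]; exact (hhs z' hz'.1).mdifferentiableAt (by simp))
      (mdifferentiableAt_extChartAt_symm (φ.map_source hz'.2))
    rw [φ.left_inv hz'.2, modelDeriv_eq_fderiv] at h4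
    exact h4.symm
  have hAx : A x = modelDeriv I I' q x := by
    rw [hA, hφ]
    simp only [modelDeriv_extChartAt_symm_self, ContinuousLinearMap.comp_id]
    exact modelDeriv_extChartAt_comp ((hq x).mdifferentiableAt (by simp))
  obtain ⟨R, hR⟩ := exists_smooth_rightInverse hAs (by rw [hAx]; exact hs)
  -- Subtracting R A v projects v into the kernel of A z, that is, into the vertical vectors; at x
  -- nothing is subtracted, as v is already vertical.
  set u : X → V := fun z => v - R z (A z v) with hu
  let W : ∀ z : X, TangentSpace I z := fun z => modelDeriv 𝓘(ℝ, V) I φ.symm (φ z) (u z)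
  have hgood : ∀ᶠ z in 𝓝 x, z ∈ N ∧ IsSmoothVFAt I W z ∧ W z ∈ D z := by
    filter_upwards [hN, hnear.eventually_nhds, hR, hAs] with z hzN hz hRz hAz
    refine ⟨hzN, ?_, ?_⟩
    · rw [isSmoothVFAt_iff hz.self_of_nhds.2]
      have h1 : ContMDiffAt I 𝓘(ℝ, V) ∞ u z :=
        contMDiffAt_const.sub (hRz.1.clm_apply (hAz.clm_apply contMDiffAt_const))
      refine h1.congr_of_eventuallyEq ?_
      filter_upwards [hz] with z' hz'
      have h2 := modelDeriv_extChartAt_comp_symm (I := I) (φ.map_source hz'.2)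
      rw [φ.left_inv hz'.2] at h2
      exact congrArg (fun L => L (u z')) h2
    · refine (hhD z hz.self_of_nhds.1 _).1 ?_
      change A z (v - R z (A z v)) = 0
      rw [map_sub, hRz.2, sub_self]
  obtain ⟨N', hN', hN'o, hxN'⟩ := eventually_nhds_iff.1 hgood
  obtain ⟨c, hc, hc1, hcs⟩ := exists_cutoff I (hN'o.mem_nhds hxN')
  have hWx : W x = v := by
    change modelDeriv 𝓘(ℝ, V) I (extChartAt I x).symm (extChartAt I x x) (u x) = v
    rw [modelDeriv_extChartAt_symm_self, hu]
    simp only [ContinuousLinearMap.id_apply]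
    rw [hAx, (hD x v).1 hv, map_zero, sub_zero]
  have hc0 : ∀ z, z ∉ N' → c z = 0 := fun z hz =>
    image_eq_zero_of_notMem_tsupport fun h => hz (hcs h)
  refine ⟨fun z => c z • W z, ⟨?_, fun z => ?_⟩, ?_, fun z hz => ?_⟩
  · exact contMDiff_cutoff_smul (F := V) (E := TangentSpace I) hc hN'o hcs
      fun z hz => (hN' z hz).2.1
  · by_cases hz : z ∈ N'
    · exact (D z).smul_mem _ (hN' z hz).2.2
    · simp only [hc0 z hz, zero_smul]
      exact (D z).zero_mem
  · simp only [hc1.self_of_nhds, one_smul]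
    exact hWx
  · simp only [hc0 z fun h => hz (hN' z h).1, zero_smul]

end VerticalFields

variable {n m : ℕ} {M : Type u} [TopologicalSpace M] [ChartedSpace (EuclideanSpace ℝ (Fin n)) M]
  {F : Type w} [NormedAddCommGroup F] [NormedSpace ℝ F]
  {E : M → Type v} [∀ x, AddCommGroup (E x)] [∀ x, Module ℝ (E x)]
  [∀ x, TopologicalSpace (E x)] [TopologicalSpace (TotalSpace F E)]
  [FiberBundle F E] [VectorBundle ℝ F E]
  [IsManifold (𝓡 n) ∞ M] [ContMDiffVectorBundle ∞ F E (𝓡 n)]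
  {om : FormField ((𝓡 n).prod 𝓘(ℝ, F)) (TotalSpace F E) (m + 2)}

/-- A local section agrees near the point with a global one. -/
theorem exists_global_section [T2Space M] {e : ∀ x : M, E x} {x : M}
    (he : ∀ᶠ z in 𝓝 x, IsSmoothSecAt (n := n) F e z) :
    ∃ e' : ∀ x : M, E x, IsSmoothSec n F e' ∧ ∀ᶠ z in 𝓝 x, e' z = e z := by
  obtain ⟨U, hU, hUo, hx⟩ := eventually_nhds_iff.1 he
  obtain ⟨c, hc, hc1, hcs⟩ := exists_cutoff (𝓡 n) (hUo.mem_nhds hx)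
  refine ⟨fun z => c z • e z, contMDiff_cutoff_smul hc hUo hcs hU, ?_⟩
  filter_upwards [hc1] with z hz
  rw [hz, one_smul]

theorem extD_at_congr {k : ℕ} {β γ : FormField (𝓡 n) M k} {x : M} (h : ∀ᶠ z in 𝓝 x, β z = γ z) :
    (extD β).at x = (extD γ).at x := by
  have : chartRep β x =ᶠ[𝓝 (extChartAt (𝓡 n) x x)] chartRep γ x := by
    filter_upwards [eventually_symm (I := 𝓡 n) h] with y hy
    rw [chartRep, chartRep, hy.2]
  rw [extD_at, extD_at, this.extDeriv_eq]

/-- The map `μ`, read in the base chart at `x₀`. -/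
def muChart (om : FormField ((𝓡 n).prod 𝓘(ℝ, F)) (TotalSpace F E) (m + 2)) (x₀ x : M) :
    E x →ₗ[ℝ] (EuclideanSpace ℝ (Fin n) [⋀^Fin (m + 1)]→L[ℝ] ℝ) :=
  (ContinuousAlternatingMap.compContinuousLinearMapₗ
    (modelDeriv 𝓘(ℝ, EuclideanSpace ℝ (Fin n)) (𝓡 n) (extChartAt (𝓡 n) x₀).symm
      (extChartAt (𝓡 n) x₀ x))).comp (zeroComp om x)

theorem muChart_self (x₀ : M) (a : E x₀) : muChart om x₀ x₀ a = zeroComp om x₀ a := by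
  change (zeroComp om x₀ a).compContinuousLinearMap _ = _
  rw [modelDeriv_extChartAt_symm_self]
  rfl

theorem muChart_eq {x₀ x : M} (hx : x ∈ bundleDom F E x₀ ∩ (extChartAt (𝓡 n) x₀).source)
    (a : E x) : muChart om x₀ x a =
      vertComp (bundleRep om x₀ (extChartAt (𝓡 n) x₀ x, 0)) (fibCoord F x₀ x a) := by
  have hy : extChartAt (𝓡 n) x₀ x ∈ baseDom (n := n) F E x₀ :=
    ⟨(extChartAt (𝓡 n) x₀).map_source hx.2, by
      rw [mem_preimage, (extChartAt (𝓡 n) x₀).left_inv hx.2]; exact hx.1⟩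
  have h := zeroComp_comp_modelDeriv om hy (fibCoord F x₀ x a)
  rw [(extChartAt (𝓡 n) x₀).left_inv hx.2, fibVec_fibCoord hx.1] at h
  exact h

theorem isSmoothCoframeOn_muChart (hs : IsSmoothForm om) (x₀ : M) :
    IsSmoothCoframeOn n F (muChart om x₀) (bundleDom F E x₀ ∩ (extChartAt (𝓡 n) x₀).source) := by
  intro e he
  have hy : extChartAt (𝓡 n) x₀ e.proj ∈ baseDom (n := n) F E x₀ :=
    ⟨(extChartAt (𝓡 n) x₀).map_source he.2, by
      rw [mem_preimage, (extChartAt (𝓡 n) x₀).left_inv he.2]; exact he.1⟩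
  have hπ : ContMDiffAt ((𝓡 n).prod 𝓘(ℝ, F)) (𝓡 n) ∞ (TotalSpace.proj : TotalSpace F E → M) e :=
    contMDiffAt_proj E
  have he2 := he.2
  rw [extChartAt_source] at he2
  have h1 : ContMDiffAt ((𝓡 n).prod 𝓘(ℝ, F))
      𝓘(ℝ, F →L[ℝ] (EuclideanSpace ℝ (Fin n) [⋀^Fin (m + 1)]→L[ℝ] ℝ)) ∞
      (fun e : TotalSpace F E => vertComp (bundleRep om x₀ (extChartAt (𝓡 n) x₀ e.proj, 0))) e :=
    ContMDiffAt.comp e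
      (g := fun y : EuclideanSpace ℝ (Fin n) => vertComp (bundleRep om x₀ (y, (0 : F))))
      (contDiffAt_vertComp_bundleRep hs hy).contMDiffAt ((contMDiffAt_extChartAt' he2).comp e hπ)
  have h2 : ContMDiffAt ((𝓡 n).prod 𝓘(ℝ, F)) 𝓘(ℝ, F) ∞
      (fun e : TotalSpace F E => fibCoord F x₀ e.proj e.2) e := by
    have h3 := ((Trivialization.contMDiffAt_iff (e := trivializationAt F E x₀) (IM := (𝓡 n).prod 𝓘(ℝ, F))
      (IB := 𝓡 n) (n := ∞) (f := id) (x₀ := e) ((Trivialization.mem_source _).2 he.1)).1 contMDiffAt_id).2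
    refine h3.congr_of_eventuallyEq ?_
    filter_upwards [eventually_proj_mem (isOpen_bundleDom x₀) he.1] with e' he'
    exact fibCoord_eq he' _
  refine (h1.clm_apply h2).congr_of_eventuallyEq ?_
  filter_upwards [eventually_proj_mem
    ((isOpen_bundleDom (F := F) (E := E) x₀).inter (isOpen_extChartAt_source (I := 𝓡 n) x₀)) he]
    with e' he'
  exact muChart_eq he' e'.2

/-- A continuous projection onto K is followed by a linear identification of K with ℝ^r. -/
theorem exists_surjective_on_submodule {V : Type*} [NormedAddCommGroup V] [NormedSpace ℝ V]
    (K : Submodule ℝ V) [FiniteDimensional ℝ K] {r : ℕ} (hr : Module.finrank ℝ K = r) :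
    ∃ p : V →L[ℝ] EuclideanSpace ℝ (Fin r), ∀ z, ∃ a ∈ K, p a = z := by
  obtain ⟨p, hp⟩ := Submodule.ClosedComplemented.of_finiteDimensional K
  let ι : K ≃ₗ[ℝ] EuclideanSpace ℝ (Fin r) :=
    LinearEquiv.ofFinrankEq _ _ (by rw [hr, finrank_euclideanSpace_fin])
  refine ⟨(LinearMap.toContinuousLinearMap ι.toLinearMap).comp p, fun z =>
    ⟨ι.symm z, (ι.symm z).2, ?_⟩⟩
  change ι (p (ι.symm z)) = z
  rw [hp, LinearEquiv.apply_symm_apply]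

/-- A morphism of constant rank is locally described by a coframe. -/
theorem exists_coframe_of_constRank [FiniteDimensional ℝ F] (hs : IsSmoothForm om) {r : ℕ}
    (hr : ∀ x : M, Module.finrank ℝ (LinearMap.range (muC om x)) = r) (x₀ : M) :
    ∃ P : ∀ x : M, E x →ₗ[ℝ] EuclideanSpace ℝ (Fin r),
      (∀ x, kerMu om x ≤ LinearMap.ker (P x)) ∧ ∃ U : Set M, IsOpen U ∧ x₀ ∈ U ∧
      IsSmoothCoframeOn n F P U ∧ ∀ x ∈ U, Surjective (P x) ∧ ∀ a, P x a = 0 ↔ a ∈ kerMu om x := by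
  have hfin : ∀ x : M, FiniteDimensional ℝ (E x) := fun x =>
    FiniteDimensional.of_injective (fibCoord F x x) (fibCoord_injective (mem_bundleDom x))
  set K := LinearMap.range (zeroComp om x₀) with hK
  have hKr : Module.finrank ℝ K = r := hr x₀
  have hKf : FiniteDimensional ℝ K := LinearMap.finiteDimensional_range _
  obtain ⟨pr, hpr⟩ := exists_surjective_on_submodule K hKr
  -- The coframe is μ in a base chart, projected onto the image of μ at x₀; the chart gives all
  -- values of μ a fixed target space.
  let P : ∀ x : M, E x →ₗ[ℝ] EuclideanSpace ℝ (Fin r) := fun x => pr.toLinearMap ∘ₗ muChart om x₀ x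
  have hPk : ∀ x, kerMu om x ≤ LinearMap.ker (P x) := by
    intro x a ha
    have h1 : muChart om x₀ x a = 0 := by
      change ContinuousAlternatingMap.compContinuousLinearMapₗ _ (zeroComp om x a) = 0
      rw [mem_kerMu_iff.1 ha, map_zero]
    exact (congrArg pr h1).trans (map_zero pr)
  have hPs : IsSmoothCoframeOn n F P (bundleDom F E x₀ ∩ (extChartAt (𝓡 n) x₀).source) :=
    fun e he => pr.contMDiffAt.comp e (isSmoothCoframeOn_muChart hs x₀ e he)
  have hdom : IsOpen (bundleDom F E x₀ ∩ (extChartAt (𝓡 n) x₀).source) :=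
    (isOpen_bundleDom x₀).inter (isOpen_extChartAt_source x₀)
  have hP0 : Surjective (P x₀) := by
    intro z
    obtain ⟨_, ⟨a, rfl⟩, ha⟩ := hpr z
    exact ⟨a, (congrArg pr (muChart_self x₀ a)).trans ha⟩
  obtain ⟨R, hR⟩ := hPs.exists_lift hdom ⟨mem_bundleDom x₀, mem_extChartAt_source x₀⟩ hP0
  obtain ⟨U, hU, hUo, hxU⟩ := eventually_nhds_iff.1 hR
  refine ⟨P, hPk, U, hUo, hxU, fun e he => hPs e (hU _ he).1, fun x hx => ?_⟩
  have hsurj : Surjective (P x) := fun z => ⟨_, (hU x hx).2.2.2 z⟩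
  have := hfin x
  have h1 : Module.finrank ℝ (LinearMap.range (P x)) = r := by
    rw [LinearMap.range_eq_top.2 hsurj, finrank_top, finrank_euclideanSpace_fin]
  have h2 := (P x).finrank_range_add_finrank_ker
  have h3 := (muC om x).finrank_range_add_finrank_ker
  -- Near x₀ the map P is onto ℝ^r, so by constancy of the rank of μ its kernel has the dimension of
  -- Ker μ, which it contains.
  have h4 : kerMu om x = LinearMap.ker (P x) := by
    refine Submodule.eq_of_le_of_finrank_eq (hPk x) ?_
    change Module.finrank ℝ (LinearMap.ker (muC om x)) = _
    have h5 := hr x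
    omega
  exact ⟨hsurj, fun a => by rw [h4]; exact LinearMap.mem_ker.symm⟩

end Extension

/-! ## Vector bundles from local frames -/

section FrameBundle

variable {V : Type*} [NormedAddCommGroup V] [NormedSpace ℝ V]
  {H : Type*} [TopologicalSpace H] {I : ModelWithCorners ℝ V H}
  {B : Type u} [TopologicalSpace B] [ChartedSpace H B]
  {G : Type w} [NormedAddCommGroup G] [NormedSpace ℝ G]
  {fib : B → Type v} [∀ b, AddCommGroup (fib b)] [∀ b, Module ℝ (fib b)]

open scoped Classical in
/-- The pretrivialization over an open set given by fiberwise linear isomorphisms. -/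
def framePretrivialization {U : Set B} (hU : IsOpen U) (φ : ∀ b, fib b →ₗ[ℝ] G)
    (hφ : ∀ b ∈ U, Bijective (φ b)) :
    Pretrivialization G (TotalSpace.proj : TotalSpace G fib → B) where
  toFun z := (z.proj, φ z.proj z.2)
  invFun p := ⟨p.1, invFun (φ p.1) p.2⟩
  source := TotalSpace.proj ⁻¹' U
  target := U ×ˢ univ
  map_source' _ hz := ⟨hz, trivial⟩
  map_target' _ hp := hp.1
  left_inv' z hz := congrArg (TotalSpace.mk z.proj) (leftInverse_invFun (hφ _ hz).1 z.2)
  right_inv' p hp := Prod.ext rfl (rightInverse_invFun (hφ _ hp.1).2 p.2)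
  open_target := hU.prod isOpen_univ
  baseSet := U
  open_baseSet := hU
  source_eq := rfl
  target_eq := rfl
  proj_toFun _ _ := rfl

variable [FiniteDimensional ℝ G]

/-- Local frames with smooth transition functions define a smooth vector bundle. -/
theorem exists_vectorBundle_of_frames {U : B → Set B} (hU : ∀ b₀, IsOpen (U b₀))
    (hmem : ∀ b₀, b₀ ∈ U b₀) {φ : ∀ (_ : B) (b : B), fib b →ₗ[ℝ] G}
    (hφ : ∀ b₀, ∀ b ∈ U b₀, Bijective (φ b₀ b)) {T : B → B → B → G →L[ℝ] G}
    (hT : ∀ b₀ b₁, ContMDiffOn I 𝓘(ℝ, G →L[ℝ] G) ∞ (T b₀ b₁) (U b₀ ∩ U b₁))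
    (hTφ : ∀ b₀ b₁, ∀ b ∈ U b₀ ∩ U b₁, ∀ z, T b₀ b₁ b (φ b₀ b z) = φ b₁ b z) :
    ∃ (_ : ∀ b, TopologicalSpace (fib b)) (_ : TopologicalSpace (TotalSpace G fib))
      (_ : FiberBundle G fib) (_ : VectorBundle ℝ G fib), ContMDiffVectorBundle ∞ G fib I ∧
      ∀ b₀, (trivializationAt G fib b₀).baseSet = U b₀ ∧
        ∀ z : TotalSpace G fib, (trivializationAt G fib b₀ z).2 = φ b₀ z.proj z.2 := by
  -- Each fiber carries the topology induced by its own frame, so that the fiber inclusions are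
  -- inducing.
  let top : ∀ b, TopologicalSpace (fib b) := fun b => TopologicalSpace.induced (φ b b) inferInstance
  let pre : B → Pretrivialization G (TotalSpace.proj : TotalSpace G fib → B) := fun b₀ =>
    framePretrivialization (hU b₀) (φ b₀) (hφ b₀)
  have hsymm : ∀ b₀ b₁, ∀ b ∈ U b₀ ∩ U b₁, ∀ v, T b₀ b₁ b v = (pre b₁ ⟨b, (pre b₀).symm b v⟩).2 := by
    intro b₀ b₁ b hb v
    have h1 := congrArg Prod.snd ((pre b₀).apply_mk_symm (b := b) hb.1 v)
    refine (congrArg (T b₀ b₁ b) h1.symm).trans ?_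
    exact hTφ b₀ b₁ b hb _
  let A : VectorPrebundle ℝ G fib :=
    { pretrivializationAtlas := range pre
      pretrivialization_linear' := by
        rintro _ ⟨b₀, rfl⟩
        exact ⟨fun b _ => (φ b₀ b).isLinear⟩
      pretrivializationAt := pre
      mem_base_pretrivializationAt := hmem
      pretrivialization_mem_atlas := fun b => ⟨b, rfl⟩
      exists_coordChange := by
        rintro _ ⟨b₀, rfl⟩ _ ⟨b₁, rfl⟩
        exact ⟨T b₀ b₁, (hT b₀ b₁).continuousOn, hsymm b₀ b₁⟩
      totalSpaceMk_isInducing := by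
        intro b
        have h1 : IsInducing (φ b b) := ⟨rfl⟩
        have h2 : (pre b ∘ TotalSpace.mk b : fib b → B × G) = (fun g => (b, g)) ∘ φ b b := rfl
        rw [h2]
        exact (isInducing_prodMkRight b).comp h1 }
  have hA : A.IsContMDiff I ∞ := by
    refine ⟨?_⟩
    rintro _ ⟨b₀, rfl⟩ _ ⟨b₁, rfl⟩
    exact ⟨T b₀ b₁, hT b₀ b₁, hsymm b₀ b₁⟩
  refine ⟨top, A.totalSpaceTopology, A.toFiberBundle, A.toVectorBundle,
    A.contMDiffVectorBundle (IB := I) (n := ∞), fun b₀ => ⟨rfl, fun z => rfl⟩⟩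

end FrameBundle

/-! ## Descent of a vector bundle along a representation of the submersion groupoid -/

section Descent

variable {n : ℕ} {M : Type u} [TopologicalSpace M] [ChartedSpace (EuclideanSpace ℝ (Fin n)) M]
  {F : Type w} [NormedAddCommGroup F] [NormedSpace ℝ F]
  {E : M → Type v} [∀ x, AddCommGroup (E x)] [∀ x, Module ℝ (E x)]
  [∀ x, TopologicalSpace (E x)] [TopologicalSpace (TotalSpace F E)]
  [FiberBundle F E] [VectorBundle ℝ F E]
  {K : ∀ x : M, Submodule ℝ (E x)}
  {G : Type*} [NormedAddCommGroup G] [NormedSpace ℝ G]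

variable (n F) in
/-- A coframe of `E / K` over the preimage of an open set, invariant under a representation of the
submersion groupoid. -/
structure IsInvariantCoframe {B : Type*} [TopologicalSpace B] (q : M → B)
    (Δ : ∀ x y : M, (E y ⧸ K y) →ₗ[ℝ] (E x ⧸ K x))
    (P : ∀ x : M, E x →ₗ[ℝ] G) (U : Set B) : Prop where
  isOpen : IsOpen U
  smooth : IsSmoothCoframeOn n F P (q ⁻¹' U)
  surj : ∀ x, q x ∈ U → Surjective (P x)
  le : ∀ x, K x ≤ LinearMap.ker (P x)
  ker : ∀ x, q x ∈ U → ∀ a, P x a = 0 → a ∈ K x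
  inv : ∀ x y, q x ∈ U → q x = q y → ∀ a c, Δ x y ((K y).mkQ c) = (K x).mkQ a → P x a = P y c

variable [IsManifold (𝓡 n) ∞ M] [ContMDiffVectorBundle ∞ F E (𝓡 n)] [FiniteDimensional ℝ F]

/-- The fiber over b is E/K at one chosen point of q_M⁻¹(b), and x ∈ q_M⁻¹(b) maps to it by Δ.
Invariant coframes serve as frames, and invariance lets them be evaluated at any other point of the
fiber of q_M, which gives smoothness although the choice of points has no regularity. -/
theorem exists_bundleSimpleQuotient (Q : SimpleQuotient n M)
    {Δ : ∀ x y : M, (E y ⧸ K y) →ₗ[ℝ] (E x ⧸ K x)} (hΔ : IsSubmersionGroupoidRep n F Q.map K Δ)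
    {r : ℕ} {P : Q.base → ∀ x : M, E x →ₗ[ℝ] EuclideanSpace ℝ (Fin r)} {U : Q.base → Set Q.base}
    (hmem : ∀ b, b ∈ U b) (hP : ∀ b, IsInvariantCoframe n F Q.map Δ (P b) (U b)) :
    ∃ Q' : BundleSimpleQuotient (n := n) F E, ∀ (e : TotalSpace F E)
      (w : EuclideanSpace ℝ (Fin n) × F),
      modelDeriv ((𝓡 n).prod 𝓘(ℝ, F)) Q'.model Q'.map e w = 0 ↔
      modelDeriv (𝓡 n) (𝓡 Q.dim) Q.map e.proj w.1 = 0 ∧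
      modelDeriv ((𝓡 n).prod 𝓘(ℝ, F)) 𝓘(ℝ, EuclideanSpace ℝ (Fin r))
        (fun e' : TotalSpace F E => P (Q.map e.proj) e'.proj e'.2) e w = 0 := by
  set s := surjInv Q.surjective with hs
  have hqs : ∀ b, Q.map (s b) = b := surjInv_eq Q.surjective
  let fib : Q.base → Type v := fun b => E (s b) ⧸ K (s b)
  let φ : ∀ (_ : Q.base) (b : Q.base), fib b →ₗ[ℝ] EuclideanSpace ℝ (Fin r) := fun b₀ b =>
    (K (s b)).liftQ (P b₀ (s b)) ((hP b₀).le (s b))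
  have hφmk : ∀ b₀ b (a : E (s b)), φ b₀ b ((K (s b)).mkQ a) = P b₀ (s b) a := fun b₀ b a => rfl
  have hmk : ∀ b (z : fib b), ∃ a : E (s b), (K (s b)).mkQ a = z := fun b =>
    (K (s b)).mkQ_surjective
  have hφ : ∀ b₀, ∀ b ∈ U b₀, Bijective (φ b₀ b) := by
    intro b₀ b hb
    have hb' : Q.map (s b) ∈ U b₀ := by rwa [hqs]
    refine ⟨(injective_iff_map_eq_zero _).2 fun z hz => ?_, fun v => ?_⟩
    · obtain ⟨a, rfl⟩ := hmk b z
      exact (Submodule.Quotient.mk_eq_zero _).2 ((hP b₀).ker _ hb' a hz)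
    · obtain ⟨a, rfl⟩ := (hP b₀).surj _ hb' v
      exact ⟨(K (s b)).mkQ a, rfl⟩
  have hfib : ∀ b₀ x, Q.map x ∈ U b₀ → ∀ a : E x,
      φ b₀ (Q.map x) (Δ (s (Q.map x)) x ((K x).mkQ a)) = P b₀ x a := by
    intro b₀ x hx a
    obtain ⟨c, hc⟩ := hmk _ (Δ (s (Q.map x)) x ((K x).mkQ a))
    rw [← hc, hφmk]
    exact (hP b₀).inv _ _ (by rwa [hqs]) (hqs _) _ _ hc.symm
  -- The transition map is defined by pure linear algebra, with value 0 outside the domain of the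
  -- first frame; its smoothness is shown separately.
  have hTex : ∀ b₀ b₁ b, ∃ T : EuclideanSpace ℝ (Fin r) →L[ℝ] EuclideanSpace ℝ (Fin r),
      b ∈ U b₀ → ∀ z, T (φ b₀ b z) = φ b₁ b z := by
    intro b₀ b₁ b
    by_cases hb : b ∈ U b₀
    · let ε := LinearEquiv.ofBijective (φ b₀ b) (hφ b₀ b hb)
      refine ⟨LinearMap.toContinuousLinearMap (φ b₁ b ∘ₗ ε.symm.toLinearMap), fun _ z => ?_⟩
      exact congrArg (φ b₁ b) (ε.symm_apply_apply z)
    · exact ⟨0, fun h => absurd h hb⟩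
  choose T hTφ using hTex
  have hT : ∀ b₀ b₁, ContMDiffOn (𝓡 Q.dim)
      𝓘(ℝ, EuclideanSpace ℝ (Fin r) →L[ℝ] EuclideanSpace ℝ (Fin r)) ∞ (T b₀ b₁) (U b₀ ∩ U b₁) := by
    rintro b₀ b₁ b ⟨hb₀, hb₁⟩
    refine ContMDiffAt.contMDiffWithinAt ?_
    obtain ⟨σ, hσ0, hσ⟩ := exists_local_section Q.smooth (s b) (Q.submersion (s b))
    rw [hqs] at hσ0 hσ
    have hx₀ : s b ∈ Q.map ⁻¹' U b₀ := by rwa [mem_preimage, hqs]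
    have hx₁ : s b ∈ Q.map ⁻¹' U b₁ := by rwa [mem_preimage, hqs]
    obtain ⟨R, hR⟩ := (hP b₀).smooth.exists_lift ((hP b₀).isOpen.preimage Q.smooth.continuous) hx₀
      ((hP b₀).surj _ hx₀)
    have h1 := (hP b₁).smooth.contMDiffAt_matrix hx₁ (mem_bundleDom (F := F) (E := E) (s b))
    have h2 := hR.self_of_nhds.2.2.1
    have hσs := hσ.self_of_nhds.1
    -- Computed along a smooth local section σ of q_M, the transition map lifts a vector through the
    -- first coframe and reads it in the second.
    have h3 : ContMDiffAt (𝓡 Q.dim)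
        𝓘(ℝ, EuclideanSpace ℝ (Fin r) →L[ℝ] EuclideanSpace ℝ (Fin r)) ∞
        (fun b' => (coframeMatrix F (P b₁) (s b) (σ b')).comp (R (σ b'))) b :=
      (h1.comp_of_eq hσs hσ0).clm_comp (h2.comp_of_eq hσs hσ0)
    refine h3.congr_of_eventuallyEq ?_
    have hσt : Tendsto σ (𝓝 b) (𝓝 (s b)) := by
      have := hσs.continuousAt
      rwa [ContinuousAt, hσ0] at this
    filter_upwards [hσ, hσt.eventually hR,
      (hP b₀).isOpen.mem_nhds hb₀, (hP b₁).isOpen.mem_nhds hb₁] with b' hb' hRb' hb₀' hb₁'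
    ext1 v
    set a := fibVec E (s b) (σ b') (R (σ b') v) with ha
    have hz₀ : φ b₀ b' (Δ (s b') (σ b') ((K (σ b')).mkQ a)) = v := by
      obtain ⟨c, hc⟩ := hmk b' (Δ (s b') (σ b') ((K (σ b')).mkQ a))
      rw [← hc, hφmk, ← hRb'.2.2.2 v]
      exact (hP b₀).inv _ _ (by rwa [hqs]) (by rw [hqs, hb'.2]) _ _ hc.symm
    have hz₁ : φ b₁ b' (Δ (s b') (σ b') ((K (σ b')).mkQ a)) = P b₁ (σ b') a := by
      obtain ⟨c, hc⟩ := hmk b' (Δ (s b') (σ b') ((K (σ b')).mkQ a))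
      rw [← hc, hφmk]
      exact (hP b₁).inv _ _ (by rwa [hqs]) (by rw [hqs, hb'.2]) _ _ hc.symm
    have h4 := hTφ b₀ b₁ b' hb₀' (Δ (s b') (σ b') ((K (σ b')).mkQ a))
    rw [hz₀, hz₁] at h4
    exact h4
  obtain ⟨top, topT, fb, vb, sb, htriv⟩ := exists_vectorBundle_of_frames (I := 𝓡 Q.dim)
    (fun b => (hP b).isOpen) hmem hφ hT fun b₀ b₁ b hb z => hTφ b₀ b₁ b hb.1 z
  let Q' : BundleSimpleQuotient (n := n) F E :=
    { qM := Q
      rk := r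
      fib := fib
      fibMap := fun x => Δ (s (Q.map x)) x ∘ₗ (K x).mkQ
      fib_surjective := by
        intro x z
        obtain ⟨a, ha⟩ := (K x).mkQ_surjective (Δ x (s (Q.map x)) z)
        refine ⟨a, ?_⟩
        have h1 := hΔ.comp_law (s (Q.map x)) x (s (Q.map x)) (hqs _) (hqs _).symm
        rw [hΔ.id_law] at h1
        rw [LinearMap.comp_apply, ha]
        exact congrArg (fun L => L z) h1
      smooth := by
        intro e
        rw [contMDiffAt_totalSpace]
        refine ⟨(Q.smooth e.proj).comp e (contMDiffAt_proj E), ?_⟩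
        refine ((hP (Q.map e.proj)).smooth e (hmem _)).congr_of_eventuallyEq ?_
        filter_upwards [eventually_proj_mem
          ((hP (Q.map e.proj)).isOpen.preimage Q.smooth.continuous) (hmem (Q.map e.proj))]
          with e' he'
        exact ((htriv (Q.map e.proj)).2 _).trans (hfib _ _ he' _) }
  refine ⟨Q', fun e w => ?_⟩
  have h1 := Q'.modelDeriv_map_eq_zero_iff (Q'.mem_coframeDom e.proj) w
  have h2 : (fun e' : TotalSpace F E => Q'.coframe (Q.map e.proj) e'.proj e'.2) =ᶠ[𝓝 e]
      fun e' : TotalSpace F E => P (Q.map e.proj) e'.proj e'.2 := by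
    filter_upwards [eventually_proj_mem
      (Q'.isOpen_coframeDom (Q.map e.proj)) (Q'.mem_coframeDom e.proj), eventually_proj_mem
      ((hP (Q.map e.proj)).isOpen.preimage Q.smooth.continuous) (hmem (Q.map e.proj))]
      with e' he' he''
    refine (fibCoord_eq he'.1 _).trans ?_
    exact ((htriv (Q.map e.proj)).2 _).trans (hfib _ _ he'' _)
  refine h1.trans (and_congr_right fun _ => ?_)
  exact iff_of_eq (congrArg
    (fun L : EuclideanSpace ℝ (Fin n) × F →L[ℝ] EuclideanSpace ℝ (Fin r) => L w = 0)
    (modelDeriv_congr (I := (𝓡 n).prod 𝓘(ℝ, F)) (I' := 𝓘(ℝ, EuclideanSpace ℝ (Fin r))) h2))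

end Descent

/-! ## From the infinitesimal conditions to kernel-reducibility -/

section Backward

variable {n m : ℕ} {M : Type u} [TopologicalSpace M] [ChartedSpace (EuclideanSpace ℝ (Fin n)) M]
  {F : Type w} [NormedAddCommGroup F] [NormedSpace ℝ F] [FiniteDimensional ℝ F]
  {E : M → Type v} [∀ x, AddCommGroup (E x)] [∀ x, Module ℝ (E x)]
  [∀ x, TopologicalSpace (E x)] [TopologicalSpace (TotalSpace F E)]
  [FiberBundle F E] [VectorBundle ℝ F E]
  [IsManifold (𝓡 n) ∞ M] [ContMDiffVectorBundle ∞ F E (𝓡 n)]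
  {G : Type*} [NormedAddCommGroup G] [NormedSpace ℝ G]

/-- Transport along a representation makes a local coframe invariant. -/
theorem exists_invariantCoframe {Q : SimpleQuotient n M} {K : ∀ x : M, Submodule ℝ (E x)}
    {Δ : ∀ x y : M, (E y ⧸ K y) →ₗ[ℝ] (E x ⧸ K x)} (hΔ : IsSubmersionGroupoidRep n F Q.map K Δ)
    {P : ∀ x : M, E x →ₗ[ℝ] G} (hle : ∀ x, K x ≤ LinearMap.ker (P x)) {V : Set M} (hV : IsOpen V)
    (hP : IsSmoothCoframeOn n F P V) (hsurj : ∀ x ∈ V, Surjective (P x))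
    (hker : ∀ x ∈ V, ∀ a, P x a = 0 → a ∈ K x) {x₀ : M} (hx₀ : x₀ ∈ V) :
    ∃ (P' : ∀ x : M, E x →ₗ[ℝ] G) (U : Set Q.base), Q.map x₀ ∈ U ∧
      IsInvariantCoframe n F Q.map Δ P' U := by
  obtain ⟨σ, hσ0, hσ⟩ := exists_local_section Q.smooth x₀ (Q.submersion x₀)
  have hσV : ∀ᶠ b in 𝓝 (Q.map x₀), σ b ∈ V :=
    hσ.self_of_nhds.1.continuousAt.preimage_mem_nhds (hV.mem_nhds (by rwa [hσ0]))
  obtain ⟨U, hU, hUo, hx₀U⟩ := eventually_nhds_iff.1 (hσ.and hσV)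
  have hinv : ∀ x y, Q.map x = Q.map y → ∀ a, Δ x y (Δ y x ((K x).mkQ a)) = (K x).mkQ a := by
    intro x y hxy a
    rw [← LinearMap.comp_apply, hΔ.comp_law x y x hxy hxy.symm, hΔ.id_law]
    rfl
  -- A vector at x is transported by Δ to the point of the local section σ over q(x) and read there
  -- in P. The composition law makes this invariant.
  let P' : ∀ x : M, E x →ₗ[ℝ] G := fun x =>
    (K (σ (Q.map x))).liftQ (P (σ (Q.map x))) (hle _) ∘ₗ Δ (σ (Q.map x)) x ∘ₗ (K x).mkQ
  have hP' : ∀ x y, σ (Q.map x) = y → ∀ (a : E x) (c : E y),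
      Δ y x ((K x).mkQ a) = (K y).mkQ c → P' x a = P y c := by
    rintro x _ rfl a c h
    change (K (σ (Q.map x))).liftQ (P (σ (Q.map x))) (hle _) (Δ (σ (Q.map x)) x ((K x).mkQ a)) = _
    rw [h]
    rfl
  refine ⟨P', U, hx₀U, hUo, ?_, ?_, ?_, ?_, ?_⟩
  · intro e he
    have hb := hU _ he
    -- Smoothness of P' comes from composing a smooth local representative of the action with the
    -- coframe P along (σ(q(x)), e).
    obtain ⟨W, Φ, hW, hmem, hΦ, hWΦ⟩ := hΔ.smooth (σ (Q.map e.proj)) e hb.1.2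
    obtain ⟨c, hc, -⟩ := hWΦ _ hmem hb.1.2
    have h1 : ContMDiffAt ((𝓡 n).prod 𝓘(ℝ, F)) (𝓡 n) ∞
        (fun e' : TotalSpace F E => σ (Q.map e'.proj)) e :=
      ContMDiffAt.comp e (g := σ) (f := fun e' : TotalSpace F E => Q.map e'.proj) hb.1.1
        ((Q.smooth e.proj).comp e (contMDiffAt_proj E))
    have h2 : ContMDiffAt ((𝓡 n).prod 𝓘(ℝ, F)) ((𝓡 n).prod ((𝓡 n).prod 𝓘(ℝ, F))) ∞
        (fun e' : TotalSpace F E => (σ (Q.map e'.proj), e')) e := h1.prodMk contMDiffAt_id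
    have h3 : ContMDiffAt ((𝓡 n).prod 𝓘(ℝ, F)) ((𝓡 n).prod 𝓘(ℝ, F)) ∞
        (fun e' : TotalSpace F E => Φ (σ (Q.map e'.proj), e')) e :=
      ContMDiffAt.comp (x := e) (f := fun e' : TotalSpace F E => (σ (Q.map e'.proj), e'))
        (g := Φ) (hΦ.contMDiffAt (hW.mem_nhds hmem)) h2
    have h4 : ContMDiffAt ((𝓡 n).prod 𝓘(ℝ, F)) 𝓘(ℝ, G) ∞
        (fun e' : TotalSpace F E => P (Φ (σ (Q.map e'.proj), e')).proj
          (Φ (σ (Q.map e'.proj), e')).2) e := by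
      refine ContMDiffAt.comp e (g := fun e : TotalSpace F E => P e.proj e.2) (hP _ ?_) h3
      rw [hc]
      exact hb.2
    refine h4.congr_of_eventuallyEq ?_
    filter_upwards [h2.continuousAt.preimage_mem_nhds (hW.mem_nhds hmem),
      eventually_proj_mem (hUo.preimage Q.smooth.continuous) he] with e' he' heU'
    obtain ⟨c', hc', hcΔ⟩ := hWΦ _ he' (hU _ heU').1.2
    rw [hc']
    exact hP' e'.proj _ rfl _ _ hcΔ.symm
  · intro x hx z
    obtain ⟨a, rfl⟩ := hsurj _ (hU _ hx).2 z
    obtain ⟨c, hc⟩ := (K x).mkQ_surjective (Δ x (σ (Q.map x)) ((K _).mkQ a))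
    exact ⟨c, hP' x _ rfl c a (by rw [hc, hinv _ _ (hU _ hx).1.2])⟩
  · intro x a ha
    have h0 : (K x).mkQ a = 0 := (Submodule.Quotient.mk_eq_zero _).2 ha
    refine (hP' x _ rfl a 0 ?_).trans (map_zero _)
    rw [h0, map_zero, map_zero]
  · intro x hx a ha
    obtain ⟨c, hc⟩ := (K (σ (Q.map x))).mkQ_surjective (Δ (σ (Q.map x)) x ((K x).mkQ a))
    rw [hP' x _ rfl a c hc.symm] at ha
    have h0 : (K (σ (Q.map x))).mkQ c = 0 :=
      (Submodule.Quotient.mk_eq_zero _).2 (hker _ (hU _ hx).2 c ha)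
    have h1 := hinv x (σ (Q.map x)) (hU _ hx).1.2.symm a
    rw [← hc, h0, map_zero] at h1
    exact (Submodule.Quotient.mk_eq_zero _).1 h1.symm
  · intro x y hx hxy a c h
    obtain ⟨d, hd⟩ := (K (σ (Q.map x))).mkQ_surjective (Δ (σ (Q.map x)) y ((K y).mkQ c))
    rw [hP' y (σ (Q.map x)) (by rw [hxy]) c d hd.symm]
    refine hP' x _ rfl a d ?_
    rw [hd, ← h, ← LinearMap.comp_apply, hΔ.comp_law _ _ _ (hU _ hx).1.2 hxy]

theorem continuous_fibCoord (x₀ x : M) : Continuous (fibCoord F x₀ x : E x → F) :=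
  ((trivializationAt F E x₀).continuousLinearMapAt ℝ x).continuous

variable {om : FormField ((𝓡 n).prod 𝓘(ℝ, F)) (TotalSpace F E) (m + 2)}
  {Q : SimpleQuotient n M} {Δ : ∀ x y : M, (E y ⧸ kerMu om y) →ₗ[ℝ] (E x ⧸ kerMu om x)}
  {P : ∀ x : M, E x →ₗ[ℝ] G} {U : Set Q.base}

/-- An invariant coframe computes the partial connection integrated by the representation. -/
theorem IsInvariantCoframe.apply_eq_of_curve (hP : IsInvariantCoframe n F Q.map Δ P U)
    (hint : IntegratesNablaBar om Q.map Δ) {γ : ℝ → M} (hγ : ContMDiff 𝓘(ℝ, ℝ) (𝓡 n) ∞ γ)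
    (hγq : ∀ t, Q.map (γ t) = Q.map (γ 0)) (hU : Q.map (γ 0) ∈ U) {e : ∀ x, E x}
    (he : IsSmoothSec n F e) {c : E (γ 0)}
    (hc : nablaBar om (x := γ 0) (modelDeriv 𝓘(ℝ, ℝ) (𝓡 n) γ 0 1)
      (fun x => (kerMu om x).mkQ (e x)) = (kerMu om (γ 0)).mkQ c) :
    P (γ 0) c = modelDeriv (𝓡 n) 𝓘(ℝ, G) (fun x => P x (e x)) (γ 0)
      (modelDeriv 𝓘(ℝ, ℝ) (𝓡 n) γ 0 1) := by
  set S : M → G := fun x => P x (e x) with hS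
  have hPc : Continuous (P (γ 0)) := by
    have h1 : (P (γ 0) : E (γ 0) → G) =
        (LinearMap.toContinuousLinearMap (P (γ 0) ∘ₗ fibVec E (γ 0) (γ 0))) ∘
          fibCoord F (γ 0) (γ 0) := by
      funext a
      exact congrArg (P (γ 0)) (fibVec_fibCoord (mem_bundleDom (γ 0)) a).symm
    rw [h1]
    exact (ContinuousLinearMap.continuous _).comp (continuous_fibCoord _ _)
  let L : (E (γ 0) ⧸ kerMu om (γ 0)) →ₗ[ℝ] G := (kerMu om (γ 0)).liftQ (P (γ 0)) (hP.le _)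
  have hL : Continuous L := isQuotientMap_quot_mk.continuous_iff.2 hPc
  have hLS : ∀ ε, L (Δ (γ 0) (γ ε) ((kerMu om (γ ε)).mkQ (e (γ ε)))) = S (γ ε) := by
    intro ε
    obtain ⟨a, ha⟩ := (kerMu om (γ 0)).mkQ_surjective
      (Δ (γ 0) (γ ε) ((kerMu om (γ ε)).mkQ (e (γ ε))))
    rw [← ha]
    exact hP.inv _ _ hU (hγq ε).symm a _ ha.symm
  have ht := (hL.tendsto _).comp
    (hint γ (fun x => (kerMu om x).mkQ (e x)) hγ hγq ⟨e, he, fun _ => rfl⟩)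
  have hd := (hasDerivAt_comp_curve hγ (S := S)
    ((hP.smooth.apply hU (he (γ 0))).mdifferentiableAt (by simp))).tendsto_slope_zero
  have h1 : L (nablaBar om (x := γ 0) (modelDeriv 𝓘(ℝ, ℝ) (𝓡 n) γ 0 1)
      (fun x => (kerMu om x).mkQ (e x))) = P (γ 0) c := by
    rw [hc]
    rfl
  -- The same difference quotients converge to P(∇̄ e), by integration of the connection, and to the
  -- derivative of P e along γ.
  refine h1.symm.trans (tendsto_nhds_unique ht ?_)
  have h2 : ∀ ε : ℝ, L (ε⁻¹ • (Δ (γ 0) (γ ε) ((kerMu om (γ ε)).mkQ (e (γ ε))) -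
      (kerMu om (γ 0)).mkQ (e (γ 0)))) = ε⁻¹ • (S (γ ε) - S (γ 0)) := fun ε => by
    rw [map_smul, map_sub, hLS]
    rfl
  refine hd.congr fun ε => ?_
  rw [zero_add]
  exact (h2 ε).symm

variable [T2Space M]

/-- The contraction condition provides d with i_v dμ(e) = μ(d), so that `nablaBar` is truly
determined by its defining equation. Realizing v by a curve in a fiber, invariance gives P(d) = v(P
e). -/
theorem IsInvariantCoframe.isAdaptedCoframe (hP : IsInvariantCoframe n F Q.map Δ P U)
    (hs : IsSmoothForm om) (hl : IsLocallyLinear om)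
    (hinf : IsInfKernelReducible om) (hQ : Q.Integrates (kerMuSharp om))
    (hint : IntegratesNablaBar om Q.map Δ) : IsAdaptedCoframe om P (Q.map ⁻¹' U) := by
  have hη : KerMuLeKerEta om := ⟨hinf.kerMu_le, hinf.kerMuSharp_le⟩
  have hD : ∀ x (v : EuclideanSpace ℝ (Fin n)),
      v ∈ kerMuSharp om x ↔ modelDeriv (𝓡 n) (𝓡 Q.dim) Q.map x v = 0 := fun x v => by
    rw [← hQ x]
    rfl
  have hk : ∀ x ∈ Q.map ⁻¹' U, ∀ a, P x a = 0 ↔ a ∈ kerMu om x := fun x hx a =>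
    ⟨hP.ker x hx a, fun h => hP.le x h⟩
  -- It is enough to treat sections with constant bundle coordinates: they determine Ker ω, and Ker
  -- ω determines the derivative property for all sections.
  refine isAdaptedCoframe_of_mem_kerForm_iff (hP.isOpen.preimage Q.smooth.continuous) hP.smooth
    hP.surj hs hl hη fun x hx a w => mem_kerForm_iff_of_coframe hP.smooth hs hl hη hx
      (hP.surj x hx) (hk x hx) a (fun v hv c hc => ?_) w
  set e : ∀ z, E z := fun z => fibVec E x z (fibCoord F x x a) with he
  have hes : ∀ᶠ z in 𝓝 x, IsSmoothSecAt (n := n) F e z := by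
    filter_upwards [bundleDom_mem_nhds (F := F) (E := E) x] with z hz
    exact isSmoothSecAt_fibVec hz contMDiffAt_const
  -- The contraction condition concerns global sections and vector fields, so both the section and
  -- the vector are extended.
  obtain ⟨e', he', hee'⟩ := exists_global_section hes
  obtain ⟨W, hW, hWx, -⟩ := exists_vertical_extension Q.smooth (Q.submersion x) hD hv univ_mem
  have hmu : (extD (muForm om e)).at x = (extD (muForm om e')).at x :=
    extD_at_congr (hee'.mono fun z hz => by rw [muForm, muForm, hz])
  obtain ⟨d, hd⟩ := hinf.contraction_mem W e' hW he' x
  have hd' : ((extD (muForm om e')).at x + zeroComp (extD om) x (e' x)).curryLeft v =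
      zeroComp om x d := by
    rw [← iprod_eq_curryLeft]
    exact (congrArg (iprod (extD (muForm om e') x + etaForm om e' x)) hWx).symm.trans hd.symm
  rw [ContinuousAlternatingMap.curryLeft_add, add_apply, hη.curryLeft_eq_zero hv, add_zero] at hd'
  have hn := nablaBar_eq (s := fun z => (kerMu om z).mkQ (e' z))
    (Eventually.of_forall fun _ => rfl) hd'
  rw [hmu, hd']
  have hS : (fun z => P z (e z)) =ᶠ[𝓝 x] fun z => P z (e' z) := by
    filter_upwards [hee'] with z hz
    rw [hz]
  rw [modelDeriv_congr hS] at hc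
  obtain ⟨γ, hγ, hγ0, hγq, hγv⟩ := exists_curve_in_fiber Q.smooth x (Q.submersion x) ((hD x v).1 hv)
  -- The curve realizes the vector, so x and v are replaced by γ(0) and γ'(0).
  have hPd : P x d = modelDeriv (𝓡 n) 𝓘(ℝ, G) (fun x => P x (e' x)) x v := by
    clear_value e
    clear hc hd hd' hmu hWx hv hee' hes hS
    subst hγ0
    subst hγv
    exact hP.apply_eq_of_curve hint hγ hγq hx he' hn
  have h1 : d - c ∈ kerMu om x := by
    rw [← hk x hx, map_sub, hPd, hc, sub_self]
  rw [mem_kerMu_iff, map_sub, sub_eq_zero] at h1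
  exact h1

theorem nablaBar_zero (x : M) (s : ∀ x : M, E x ⧸ kerMu om x) :
    nablaBar om (0 : TangentSpace (𝓡 n) x) s = 0 := by
  have hinj : Injective (muBar om x) := by
    rw [← LinearMap.ker_eq_bot]
    exact Submodule.ker_liftQ_eq_bot' _ _ rfl
  rw [nablaBar, map_zero, ← map_zero (muBar om x)]
  exact leftInverse_invFun hinj _

/-- The kernel of the form is contained in the kernel of its exterior derivative. -/
theorem IsAdaptedCoframe.kerForm_le [FiniteDimensional ℝ G] {U : Set M}
    (hP : IsAdaptedCoframe om P U) (hs : IsSmoothForm om) (hl : IsLocallyLinear om)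
    (hinf : IsInfKernelReducible om) (hQ : Q.Integrates (kerMuSharp om)) {x : M} (hx : x ∈ U)
    (a : E x) : kerForm om ⟨x, a⟩ ≤ kerForm (extD om) ⟨x, a⟩ := by
  have hη : KerMuLeKerEta om := ⟨hinf.kerMu_le, hinf.kerMuSharp_le⟩
  have hD : ∀ x (v : EuclideanSpace ℝ (Fin n)),
      v ∈ kerMuSharp om x ↔ modelDeriv (𝓡 n) (𝓡 Q.dim) Q.map x v = 0 := fun x v => by
    rw [← hQ x]
    rfl
  obtain ⟨R, hR⟩ := hP.smooth.exists_lift hP.isOpen hx (hP.surj x hx)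
  set f := fibCoord F x x a with hf
  -- The section with constant coordinates is corrected through the right inverse `R` so that its
  -- coframe value is constantly P(a) while its value at x remains a; thus ∇̄ of it vanishes near x.
  set g : M → F := fun z => f + R z (P x a - P z (fibVec E x z f)) with hg
  have hgs : ∀ᶠ z in 𝓝 x, IsSmoothSecAt (n := n) F (fun z => fibVec E x z (g z)) z := by
    filter_upwards [hR] with z hz
    exact isSmoothSecAt_fibVec hz.2.1 (contMDiffAt_const.add (hz.2.2.1.clm_apply
      (contMDiffAt_const.sub (hP.smooth.apply hz.1 (isSmoothSecAt_fibVec hz.2.1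
        contMDiffAt_const)))))
  have hgx : fibVec E x x (g x) = a := by
    have h0 : fibVec E x x f = a := fibVec_fibCoord (mem_bundleDom x) a
    simp only [hg, h0, sub_self, map_zero, add_zero]
  have hgP : ∀ᶠ z in 𝓝 x, P z (fibVec E x z (g z)) = P x a := by
    filter_upwards [hR] with z hz
    simp only [hg, map_add, hz.2.2.2, add_sub_cancel]
  obtain ⟨e, he, hee⟩ := exists_global_section hgs
  have hex : e x = a := hee.self_of_nhds.trans hgx
  have heP : ∀ᶠ z in 𝓝 x, z ∈ U ∧ P z (e z) = P x a := by
    filter_upwards [hgP, hee, hR] with z hz1 hz2 hz3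
    exact ⟨hz3.1, by rw [hz2, hz1]⟩
  have hd0 : ∀ z, (∀ᶠ z' in 𝓝 z, z' ∈ U ∧ P z' (e z') = P x a) → ∀ v : EuclideanSpace ℝ (Fin n),
      P z 0 = modelDeriv (𝓡 n) 𝓘(ℝ, G) (fun z => P z (e z)) z v := by
    intro z hz v
    have h1 : (fun z => P z (e z)) =ᶠ[𝓝 z] fun _ => P x a := hz.mono fun z' hz' => hz'.2
    have h2 : modelDeriv (𝓡 n) 𝓘(ℝ, G) (fun _ : M => P x a) z = 0 := mfderiv_const
    rw [modelDeriv_congr h1, h2, map_zero]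
    rfl
  rw [← hex]
  rintro ⟨v, b⟩ hw
  have h1 := (_root_.mem_kerForm_iff hs hl (he x) v b).1 hw
  have hv := h1.1
  rw [ContinuousAlternatingMap.curryLeft_add, add_apply, hη.curryLeft_eq_zero hv, add_zero,
    hP.deriv x hx e (he x) v hv 0 (hd0 x heP v), map_zero, zero_add] at h1
  refine (mem_kerForm_extD_iff hs hl (he x) v b).2 ⟨hη.2 x hv, ?_⟩
  -- The condition on dη asks for ∇̄_W e = 0 at every point of M, so W is taken to vanish wherever P
  -- e is not locally constant.
  obtain ⟨W, hW, hWx, hW0⟩ := exists_vertical_extension Q.smooth (Q.submersion x) hD hv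
    heP.eventually_nhds
  have hnabla : ∀ z, nablaBar om (W z) (fun y => (kerMu om y).mkQ (e y)) = 0 := by
    intro z
    by_cases hz : ∀ᶠ z' in 𝓝 z, z' ∈ U ∧ P z' (e z') = P x a
    · exact (hP.nablaBar_eq hz.self_of_nhds.1 (hW.2 z) (he z)
        (Eventually.of_forall fun _ => rfl) (hd0 z hz _)).trans (map_zero _)
    · rw [hW0 z hz]
      exact nablaBar_zero z _
  have h2 : ((extD (etaForm om e)).at x).curryLeft v = 0 := by
    rw [← iprod_eq_curryLeft]
    exact (congrArg (iprod (extD (etaForm om e) x)) hWx).symm.trans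
      (hinf.contraction_eta W e hW he hnabla x)
  have h3 : zeroComp (extD om) x (fibVec E x x (b - secDeriv F e x v)) = 0 :=
    hη.1 x (mem_kerMu_iff.2 h1.2)
  rw [h2, h3, add_zero]

/-- Rank-nullity for the surjective derivative of q gives the constant rank of Ker ω. -/
theorem BundleSimpleQuotient.Integrates.finrank_kerForm {Q : BundleSimpleQuotient (n := n) F E}
    (h : Q.Integrates (kerForm om)) (e : TotalSpace F E) :
    Module.finrank ℝ (kerForm om e) =
      (n + Module.finrank ℝ F) - (Q.qM.dim + Q.rk) := by
  set D := (modelDeriv ((𝓡 n).prod 𝓘(ℝ, F)) Q.model Q.map e).toLinearMap with hD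
  have h1 := D.finrank_range_add_finrank_ker
  have h2 : LinearMap.range D = ⊤ := LinearMap.range_eq_top.2 (Q.modelDeriv_map_surjective e)
  rw [h2, finrank_top, Module.finrank_prod, Module.finrank_prod, finrank_euclideanSpace_fin,
    finrank_euclideanSpace_fin, finrank_euclideanSpace_fin] at h1
  have h3 : Module.finrank ℝ (kerForm om e) = Module.finrank ℝ (LinearMap.ker D) := by
    rw [← h e]
    rfl
  omega

/-- Local coframes of constant rank are made invariant, and are then adapted; glued to a quotient
bundle, their joint kernel with Tq_M is at once Ker Tq and Ker ω. -/
theorem IsInfKernelReducible.isKernelReducible (hinf : IsInfKernelReducible om)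
    (hs : IsSmoothForm om) (hl : IsLocallyLinear om) (hQ : Q.Integrates (kerMuSharp om))
    (hΔ : IsSubmersionGroupoidRep n F Q.map (kerMu om) Δ) (hint : IntegratesNablaBar om Q.map Δ) :
    IsKernelReducible om := by
  have hη : KerMuLeKerEta om := ⟨hinf.kerMu_le, hinf.kerMuSharp_le⟩
  obtain ⟨r, hr⟩ := hinf.mu_constRank
  have hex : ∀ b : Q.base, ∃ (P : ∀ x : M, E x →ₗ[ℝ] EuclideanSpace ℝ (Fin r)) (U : Set Q.base),
      b ∈ U ∧ IsInvariantCoframe n F Q.map Δ P U := by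
    intro b
    obtain ⟨x, rfl⟩ := Q.surjective b
    obtain ⟨P, hle, V, hV, hxV, hP, hPV⟩ := exists_coframe_of_constRank hs hr x
    exact exists_invariantCoframe hΔ hle hV hP (fun z hz => (hPV z hz).1)
      (fun z hz a => ((hPV z hz).2 a).1) hxV
  choose P U hmem hP using hex
  have hPa := fun b => (hP b).isAdaptedCoframe hs hl hinf hQ hint
  obtain ⟨Q', hQ'⟩ := exists_bundleSimpleQuotient Q hΔ hmem hP
  have hD : ∀ x (v : EuclideanSpace ℝ (Fin n)),
      modelDeriv (𝓡 n) (𝓡 Q.dim) Q.map x v = 0 ↔ v ∈ kerMuSharp om x := fun x v => by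
    rw [← hQ x]
    rfl
  have hI : Q'.Integrates (kerForm om) := by
    rintro ⟨x, a⟩
    refine Submodule.ext fun w => ?_
    refine (hQ' ⟨x, a⟩ w).trans ?_
    exact (and_congr_left' (hD x w.1)).trans
      ((hPa (Q.map x)).mem_kerForm_iff hs hl hη (hmem (Q.map x)) a w).symm
  exact ⟨⟨_, hI.finrank_kerForm⟩,
    fun e => (hPa (Q.map e.proj)).kerForm_le hs hl hinf hQ (hmem (Q.map e.proj)) e.2, Q', hI⟩

end Backward

end

theorem mainTheorem8 {n m : ℕ} {M : Type u} [TopologicalSpace M] [T2Space M]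
    [SecondCountableTopology M] [ChartedSpace (EuclideanSpace ℝ (Fin n)) M]
    [IsManifold (𝓡 n) ∞ M]
    {F : Type w} [NormedAddCommGroup F] [NormedSpace ℝ F] [FiniteDimensional ℝ F]
    {E : M → Type v} [∀ x, AddCommGroup (E x)] [∀ x, Module ℝ (E x)]
    [∀ x, TopologicalSpace (E x)] [TopologicalSpace (TotalSpace F E)]
    [FiberBundle F E] [VectorBundle ℝ F E] [ContMDiffVectorBundle ∞ F E (𝓡 n)]
    (om : FormField ((𝓡 n).prod 𝓘(ℝ, F)) (TotalSpace F E) (m + 2))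
    (hsmooth : IsSmoothForm om) (hlin : IsLinearForm om) :
    (IsKernelReducible om ↔
      IsInfKernelReducible om ∧
      ∃ Q : SimpleQuotient n M, Q.Integrates (kerMuSharp om) ∧
        ∃ Δ : ∀ x y : M, (E y ⧸ kerMu om y) →ₗ[ℝ] (E x ⧸ kerMu om x),
          IsSubmersionGroupoidRep n F Q.map (kerMu om) Δ ∧ IntegratesNablaBar om Q.map Δ) ∧
    (IsKernelReducible om →
      ∀ Q : BundleSimpleQuotient (n := n) F E, Q.Integrates (kerForm om) →
        (∃ om' : FormField Q.model Q.Total (m + 2),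
          IsSmoothForm om' ∧ pullbackForm Q.map om' = om) ∧
        ∀ om' : FormField Q.model Q.Total (m + 2),
          IsSmoothForm om' → pullbackForm Q.map om' = om → ∀ e, kerForm om' e = ⊥) := by
  have hl : IsLocallyLinear om := fun x₀ y hy => hlin.isFiberHom hy
  refine ⟨⟨?_, ?_⟩, ?_⟩
  · rintro ⟨-, hd, Q, hI⟩
    have hη : KerMuLeKerEta om := kerMuLeKerEta_of_kerForm_le hsmooth hl hd
    obtain ⟨Δ, hΔ⟩ := Q.exists_transport (K := kerMu om) fun x a => by
      have h := Q.coframe_eq_iff (Q.mem_coframeDom x) (a := a) (b := 0)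
      rw [map_zero, map_zero] at h
      exact ((hI.isAdaptedCoframe hsmooth hl hη (Q.qM.map x)).ker x (Q.mem_coframeDom x) a).symm.trans h
    exact ⟨hI.isInfKernelReducible hsmooth hl hd, Q.qM, hI.integrates_qM hsmooth hl, Δ,
      Q.isSubmersionGroupoidRep hΔ, hI.integratesNablaBar hsmooth hl hη hΔ⟩
  · rintro ⟨hinf, Q, hQ, Δ, hΔ, hint⟩
    exact hinf.isKernelReducible hsmooth hl hQ hΔ hint
  · rintro ⟨-, hd, -⟩ Q hI
    exact ⟨hI.exists_quotientForm hsmooth hd, fun om' _ hp e => hI.kerForm_quotientForm hp e⟩
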